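/- **Theorem (Filtering compactness for Navier–Stokes).** *Setting.* Let $d,N\in\mathbb{N}$, $T>0$, and let $\Gamma\in\mathbb{R}^{d\times d}$ be symmetric positive definite. Write $|y|_\Gamma=\langle y,\Gamma^{-1}y\rangle^{1/2}$ on $\mathbb{R}^d$ and $|\boldsymbol y|_\Gamma=(\sum_{j=1}^N|y_j|_\Gamma^2)^{1/2}$ for $\boldsymbol y=(y_1,\dots,y_N)\in\mathbb{R}^{d\times N}$. Let $\rho>0$ be a probability density on $\mathbb{R}^d$ that is bounded, Lipschitz continuous with respect to $|\cdot|_\Gamma$, and satisfies $\rho(y)\ge \frac1c\exp(-\frac12|y|_\Gamma^2)$ for some $c>0$. Let $L^2_x=L^2(\mathbb{T}^n;\mathbb{R}^n)$, where $\mathbb{T}^n$ is the $2\pi$-periodic torus, and let $0=t_0<t_1<\dots<t_N=T$. Let the observables $\mathcal{G}_j:L^1([0,T];L^2_x)\to\mathbb{R}^d$, $j=1,\dots,N$, satisfy $$|\mathcal{G}_j(u)-\mathcal{G}_j(u')|\le L_{\mathcal G}\int_{t_{j-1}}^{t_j}\|u-u'\|_{L^2_x}\,dt\quad\text{for all } u,u',\qquad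 |\mathcal{G}_j(0)|\le g_0 .$$ Let $\mu_{\mathrm{prior}}$ be a Borel probability measure on $L^2_x$, concentrated on divergence-free fields, with $\mu_{\mathrm{prior}}(\|\bar u\|_{L^2_x}\le M)=1$ for some $M>0$. Let $\nu>0$ and, for each $\Delta>0$, let $\mathcal{S}^\Delta:[0,T]\times L^2_x\to L^2_x$, $(t,\bar u)\mapsto\mathcal S^\Delta_t(\bar u)$, be Borel measurable such that for all divergence-free $\bar u\in L^2_x$ and all $\Delta>0$: - ($\Delta$.1) $\|\mathcal S^\Delta_t(\bar u)\|_{L^2_x}\le\|\bar u\|_{L^2_x}$ for all $t\in[0,T]$; - ($\Delta$.2) $\int_0^T\|\nabla\mathcal S^\Delta_t(\bar u)\|_{L^2_x}^2\,dt\le\nu^{-1}\|\bar u\|_{L^2_x}^2$; - ($\Delta$.3) $\|\mathcal S^\Delta_t(\bar u)-\mathcal S^\Delta_s(\bar u)\|_{H^{-L}_x}\le c(\|\bar u\|_{L^2_x})\,|t-s|$ for all $s,t\in[0,T]$, with some $L>0$ and some function $c$, both independent of $\Delta$. For $\boldsymbol y\in\mathbb{R}^{d\times N}$ and $t\in[0,T]$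 let $$\nu^{\Delta,\boldsymbol y}_t=\mathcal S^\Delta_{t,\#}\mu^{\Delta,\boldsymbol y}_{(t)},\qquad \mu^{\Delta,\boldsymbol y}_{(t)}(d\bar u)=\frac1{Z}\prod_{j:\,t_j\le t}\rho\big(y_j-\mathcal G_j(\mathcal S^\Delta(\bar u))\big)\,\mu_{\mathrm{prior}}(d\bar u),$$ with $Z$ the normalization constant; this is the filtering distribution, i.e. the law of $\mathcal S^\Delta_t(\bar u)$ given the measurements $y_j=\mathcal G_j(\mathcal S^\Delta(\bar u))+\eta_j$ with $t_j\le t$, where $\bar u\sim\mu_{\mathrm{prior}}$ and the $\eta_j\sim\rho(y)\,dy$ are i.i.d. and independent of $\bar u$. Let $W_1$ be the $1$-Wasserstein distance on the set $\mathcal P_1(L^2_x)$ of Borel probability measures with finite first moment, and let $L^1_t(\mathcal P)$ be the space of weak-$*$ measurable maps $t\mapsto\nu_t\in\mathcal P_1(L^2_x)$ on $[0,T]$ with $\int_0^T\int\|u\|_{L^2_x}\,\nu_t(du)\,dt<\infty$, with metric $d_T(\nu_t,\nu_t')=\int_0^TW_1(\nu_t,\nu'_t)\,dt$. *Claim.*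 For all $R,M>0$ there is a constant $C=C(R,M)>0$, depending only on $R$, $M$, $N$, the noise ($\rho$ and $\Gamma$) and, through the observables, on $T$, $L_{\mathcal G}$ and $g_0$ (in particular independent of $n$, $\nu$, $\Delta$, the times $t_j$, the particular observables, prior and solution operators), such that the following hold. 1. $\boldsymbol y\mapsto\nu^{\Delta,\boldsymbol y}_t$ belongs to $C_{\mathrm{loc}}(\mathbb{R}^{d\times N};L^1_t(\mathcal P))$ for each $\Delta>0$, and $\{\nu^{\Delta,\boldsymbol y}_t:\Delta>0\}$ is pre-compact in this space. 2. For all $R>0$, $\Delta>0$, $t\in[0,T]$ and all $\boldsymbol y,\boldsymbol y'$ with $|\boldsymbol y|_\Gamma,|\boldsymbol y'|_\Gamma\le R$, $$W_1(\nu^{\Delta,\boldsymbol y}_t,\nu^{\Delta,\boldsymbol y'}_t)\le C\,|\boldsymbol y-\boldsymbol y'|_\Gamma .$$ 3. Every sequence $\Delta_k\to0$ of positive numbers has a subsequence (not relabelled) for which there is $\nu^{*,\boldsymbol y}_t\in C_{\mathrm{loc}}(\mathbb{R}^{d\times N};L^1_t(\mathcal P))$ such that, for all $R>0$, $$\sup_{|\boldsymbol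 y|_\Gamma\le R}\int_0^TW_1(\nu^{\Delta_k,\boldsymbol y}_t,\nu^{*,\boldsymbol y}_t)\,dt\to0 .$$ 4. Any limit $\nu^{*,\boldsymbol y}_t$ in this sense along any sequence $\Delta_k\to0$ satisfies, after modification for each $\boldsymbol y$ on a null set of times $t$, the estimate of item 2 for all $R>0$ and all $t\in[0,T]$, with the same constant $C$. -/

import Mathlib

open MeasureTheory ProbabilityTheory Set Filter Topology
open scoped ENNReal NNReal BoundedContinuousFunction Matrix

set_option linter.unusedSectionVars false

noncomputable section

namespace FilteringNS

section Wasserstein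
variable {X : Type*} [NormedAddCommGroup X] [MeasurableSpace X]

/-- `π` is a coupling of `μ` and `ν`. -/
def IsCoupling (π : Measure (X × X)) (μ ν : Measure X) : Prop :=
  π.map Prod.fst = μ ∧ π.map Prod.snd = ν

/-- The `1`-Wasserstein distance `inf_π ∫ ‖u - v‖ π(du, dv)` over all couplings `π`. -/
def W₁ (μ ν : Measure X) : ℝ≥0∞ :=
  ⨅ (π : Measure (X × X)) (_ : IsCoupling π μ ν), ∫⁻ p, edist p.1 p.2 ∂π

theorem IsCoupling.W₁_le {π : Measure (X × X)} {μ ν : Measure X} (h : IsCoupling π μ ν) :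
    W₁ μ ν ≤ ∫⁻ p, edist p.1 p.2 ∂π := iInf₂_le π h

variable [BorelSpace X] [SecondCountableTopology X]

theorem W₁_self (μ : Measure X) : W₁ μ μ = 0 := by
  have hm : Measurable fun x : X => (x, x) := by fun_prop
  have h : IsCoupling (μ.map fun x => (x, x)) μ μ := by
    constructor
    · rw [Measure.map_map measurable_fst hm]; exact Measure.map_id
    · rw [Measure.map_map measurable_snd hm]; exact Measure.map_id
  refine le_antisymm (h.W₁_le.trans ?_) bot_le
  rw [lintegral_map (by fun_prop) hm]
  simp

theorem W₁_comm_le (μ ν : Measure X) : W₁ μ ν ≤ W₁ ν μ := by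
  refine le_iInf₂ fun π h => ?_
  have h' : IsCoupling (π.map Prod.swap) μ ν := by
    constructor
    · rw [Measure.map_map measurable_fst measurable_swap]; exact h.2
    · rw [Measure.map_map measurable_snd measurable_swap]; exact h.1
  refine h'.W₁_le.trans ?_
  rw [lintegral_map (by fun_prop) measurable_swap]
  simp [edist_comm]

theorem W₁_comm (μ ν : Measure X) : W₁ μ ν = W₁ ν μ :=
  le_antisymm (W₁_comm_le μ ν) (W₁_comm_le ν μ)

/-- Triangle inequality, by gluing couplings along their common marginal. -/
theorem W₁_triangle [CompleteSpace X] (μ₁ μ₂ μ₃ : Measure X) [IsProbabilityMeasure μ₁]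
    [IsProbabilityMeasure μ₂] : W₁ μ₁ μ₃ ≤ W₁ μ₁ μ₂ + W₁ μ₂ μ₃ := by
  unfold W₁
  rw [ENNReal.iInf_add]
  refine le_iInf fun π => ?_
  rw [ENNReal.iInf_add]
  refine le_iInf fun h => ?_
  rw [ENNReal.add_iInf]
  refine le_iInf fun π' => ?_
  rw [ENNReal.add_iInf]
  refine le_iInf fun h' => ?_
  have : IsProbabilityMeasure (π.map Prod.fst) := by rw [h.1]; infer_instance
  have hπ : IsProbabilityMeasure π := Measure.isProbabilityMeasure_of_map (f := Prod.fst)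
  have : IsProbabilityMeasure (π'.map Prod.fst) := by rw [h'.1]; infer_instance
  have hπ' : IsProbabilityMeasure π' := Measure.isProbabilityMeasure_of_map (f := Prod.fst)
  set σ := π.map Prod.swap with hσ
  have : IsProbabilityMeasure σ := Measure.isProbabilityMeasure_map (by fun_prop)
  have hσ1 : σ.fst = μ₂ := by
    rw [Measure.fst, hσ, Measure.map_map measurable_fst measurable_swap]; exact h.2
  have hσ2 : σ.snd = μ₁ := by
    rw [Measure.snd, hσ, Measure.map_map measurable_snd measurable_swap]; exact h.1
  have hπ'1 : π'.fst = μ₂ := h'.1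
  have hπ'2 : π'.snd = μ₃ := h'.2
  have d1 : μ₂ ⊗ₘ σ.condKernel = σ := by rw [← hσ1]; exact σ.disintegrate _
  have d2 : μ₂ ⊗ₘ π'.condKernel = π' := by rw [← hπ'1]; exact π'.disintegrate _
  set κ := σ.condKernel
  set η := π'.condKernel
  have hc : IsCoupling (μ₂.bind (κ ×ₖ η)) μ₁ μ₃ := by
    constructor
    · rw [Measure.map_comp _ _ measurable_fst, ← Kernel.fst_eq, Kernel.fst_prod,
        ← Measure.snd_compProd, d1, hσ2]
    · rw [Measure.map_comp _ _ measurable_snd, ← Kernel.snd_eq, Kernel.snd_prod,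
        ← Measure.snd_compProd, d2, hπ'2]
  refine hc.W₁_le.trans ?_
  have e1 : ∫⁻ p, edist p.1 p.2 ∂π = ∫⁻ y, ∫⁻ a, edist a y ∂(κ y) ∂μ₂ := by
    have : ∫⁻ p, edist p.1 p.2 ∂π = ∫⁻ p, edist p.2 p.1 ∂σ := by
      rw [hσ, lintegral_map (by fun_prop) measurable_swap]; rfl
    rw [this, ← d1, Measure.lintegral_compProd (by fun_prop)]
  have e2 : ∫⁻ p, edist p.1 p.2 ∂π' = ∫⁻ y, ∫⁻ b, edist y b ∂(η y) ∂μ₂ := by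
    rw [← d2, Measure.lintegral_compProd (by fun_prop)]
  rw [e1, e2, Measure.lintegral_bind (Kernel.aemeasurable _) (by fun_prop),
    ← lintegral_add_left]
  · refine lintegral_mono fun y => ?_
    rw [Kernel.prod_apply, lintegral_prod _ (by fun_prop)]
    calc ∫⁻ a, ∫⁻ b, edist a b ∂(η y) ∂(κ y)
        ≤ ∫⁻ a, ∫⁻ b, (edist a y + edist y b) ∂(η y) ∂(κ y) :=
          lintegral_mono fun a => lintegral_mono fun b => edist_triangle _ _ _
      _ = _ := by
          simp only [lintegral_add_left measurable_const, lintegral_const, measure_univ, mul_one]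
          rw [lintegral_add_left (by fun_prop)]
          simp
  · exact Measurable.lintegral_kernel_prod_right' (f := fun p : X × X => edist p.2 p.1)
      (by fun_prop)

/-- Mass common to both measures need not be moved. -/
theorem W₁_add_le (m p q : Measure X) [IsFiniteMeasure m] [IsFiniteMeasure p] [IsFiniteMeasure q]
    (h : p univ = q univ) (D : ℝ≥0∞) (hD : ∀ᵐ x ∂p, ∀ᵐ y ∂q, edist x y ≤ D) :
    W₁ (m + p) (m + q) ≤ D * q univ := by
  rcases eq_or_ne (p univ) 0 with h0 | h0
  · have hp : p = 0 := by simpa using h0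
    have hq : q = 0 := by simpa [hp] using h.symm
    subst hp hq
    simp [W₁_self]
  have hm : Measurable fun x : X => (x, x) := by fun_prop
  have hT : p univ ≠ ⊤ := measure_ne_top _ _
  have hc : IsCoupling (m.map (fun x => (x, x)) + (p univ)⁻¹ • p.prod q) (m + p) (m + q) := by
    constructor
    · rw [Measure.map_add _ _ measurable_fst, Measure.map_map measurable_fst hm,
        Measure.map_smul, Measure.map_fst_prod, ← h, smul_smul, ENNReal.inv_mul_cancel h0 hT,
        one_smul]
      congr 1; exact Measure.map_id
    · rw [Measure.map_add _ _ measurable_snd, Measure.map_map measurable_snd hm,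
        Measure.map_smul, Measure.map_snd_prod, smul_smul, ENNReal.inv_mul_cancel h0 hT,
        one_smul]
      congr 1; exact Measure.map_id
  refine hc.W₁_le.trans ?_
  rw [lintegral_add_measure, lintegral_map (by fun_prop) hm, lintegral_smul_measure,
    lintegral_prod _ (by fun_prop)]
  simp only [edist_self, lintegral_zero, zero_add]
  calc (p univ)⁻¹ • ∫⁻ x, ∫⁻ y, edist x y ∂q ∂p
      ≤ (p univ)⁻¹ • ∫⁻ x, ∫⁻ y, D ∂q ∂p := by
        gcongr ?_ • ?_
        refine lintegral_mono_ae ?_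
        filter_upwards [hD] with x hx
        exact lintegral_mono_ae hx
    _ = D * q univ := by
        simp only [lintegral_const, smul_eq_mul]
        rw [mul_comm (D * q univ), ← mul_assoc, ENNReal.inv_mul_cancel h0 hT, one_mul]

theorem W₁_map_le (μ : Measure X) {f : X → X} (hf : Measurable f) :
    W₁ μ (μ.map f) ≤ ∫⁻ x, edist x (f x) ∂μ := by
  have hm : Measurable fun x : X => (x, f x) := by fun_prop
  have h : IsCoupling (μ.map fun x => (x, f x)) μ (μ.map f) := by
    constructor
    · rw [Measure.map_map measurable_fst hm]; exact Measure.map_id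
    · rw [Measure.map_map measurable_snd hm]; rfl
  refine h.W₁_le.trans_eq ?_
  rw [lintegral_map (by fun_prop) hm]

/-- The finitely supported measure with weights `w` at the points `e`. -/
def atomic {m : ℕ} (e : Fin m → X) (w : Fin m → ℝ) : Measure X :=
  ∑ i, ENNReal.ofReal (w i) • Measure.dirac (e i)

instance {m : ℕ} (e : Fin m → X) (w : Fin m → ℝ) : IsFiniteMeasure (atomic e w) := by
  constructor
  simp [atomic, ENNReal.sum_lt_top]

theorem atomic_univ {m : ℕ} (e : Fin m → X) (w : Fin m → ℝ) :
    atomic e w univ = ∑ i, ENNReal.ofReal (w i) := by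
  simp [atomic]

theorem isProbabilityMeasure_atomic {m : ℕ} (e : Fin m → X) {w : Fin m → ℝ}
    (hw : w ∈ stdSimplex ℝ (Fin m)) : IsProbabilityMeasure (atomic e w) := by
  constructor
  rw [atomic_univ, ← ENNReal.ofReal_sum_of_nonneg fun i _ => hw.1 i, hw.2, ENNReal.ofReal_one]

theorem ae_atomic {m : ℕ} (e : Fin m → X) (w : Fin m → ℝ) {s : X → Prop}
    (h : ∀ i, s (e i)) : ∀ᵐ x ∂(atomic e w), s x := by
  have hz : ∀ᵐ x ∂(atomic e w), x ∈ range e := by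
    rw [ae_iff]
    simp [atomic]
  filter_upwards [hz] with x hx
  obtain ⟨i, rfl⟩ := hx
  exact h i

theorem W₁_atomic_le {m : ℕ} (e : Fin m → X) (D : ℝ≥0∞) (hD : ∀ i j, edist (e i) (e j) ≤ D)
    {w w' : Fin m → ℝ} (hw : w ∈ stdSimplex ℝ (Fin m)) (hw' : w' ∈ stdSimplex ℝ (Fin m)) :
    W₁ (atomic e w) (atomic e w') ≤ D * m * edist w w' := by
  set a : Fin m → ℝ := fun i => min (w i) (w' i) with ha
  have hsplit : ∀ v : Fin m → ℝ, (∀ i, a i ≤ v i) →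
      atomic e v = atomic e a + atomic e (v - a) := by
    intro v hv
    simp only [atomic, ← Finset.sum_add_distrib, ← add_smul]
    refine Finset.sum_congr rfl fun i _ => ?_
    rw [← ENNReal.ofReal_add (le_min (hw.1 i) (hw'.1 i)) (by simpa using hv i)]
    simp [ha]
  have h1 : ∀ v ∈ stdSimplex ℝ (Fin m), (∀ i, a i ≤ v i) →
      atomic e (v - a) univ = ENNReal.ofReal (1 - ∑ i, a i) := by
    intro v hv hav
    rw [atomic_univ, ← ENNReal.ofReal_sum_of_nonneg (fun i _ => by simpa using hav i)]
    simp [Finset.sum_sub_distrib, hv.2]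
  have l1 : ∀ i, a i ≤ w i := fun i => min_le_left _ _
  have l2 : ∀ i, a i ≤ w' i := fun i => min_le_right _ _
  rw [hsplit w l1, hsplit w' l2]
  refine (W₁_add_le _ _ _ (by rw [h1 w hw l1, h1 w' hw' l2]) D
    (ae_atomic _ _ fun i => ae_atomic _ _ fun j => hD i j)).trans ?_
  rw [mul_assoc]
  gcongr
  rw [atomic_univ]
  calc ∑ i, ENNReal.ofReal ((w' - a) i) ≤ ∑ _i : Fin m, edist w w' := by
        refine Finset.sum_le_sum fun i _ => le_trans ?_ (edist_le_pi_edist w w' i)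
        rw [edist_dist, Real.dist_eq]
        refine ENNReal.ofReal_le_ofReal ?_
        simp only [ha, Pi.sub_apply]
        rcases le_total (w i) (w' i) with h | h
        · rw [min_eq_left h, abs_sub_comm]; exact le_abs_self _
        · rw [min_eq_right h]; simp
    _ = _ := by simp

theorem continuous_W₁_atomic [CompleteSpace X] {m : ℕ} (e : Fin m → X) :
    Continuous fun p : stdSimplex ℝ (Fin m) × stdSimplex ℝ (Fin m) =>
      W₁ (atomic e p.1) (atomic e p.2) := by
  obtain ⟨D, hDt, hD⟩ : ∃ D : ℝ≥0∞, D ≠ ⊤ ∧ ∀ i j, edist (e i) (e j) ≤ D :=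
    ⟨∑ i, ∑ j, edist (e i) (e j),
      ENNReal.sum_ne_top.2 fun i _ => ENNReal.sum_ne_top.2 fun j _ => edist_ne_top _ _,
      fun i j => (Finset.single_le_sum (f := fun j => edist (e i) (e j))
        (fun _ _ => zero_le) (Finset.mem_univ j)).trans
        (Finset.single_le_sum (f := fun i => ∑ j, edist (e i) (e j))
        (fun _ _ => zero_le) (Finset.mem_univ i))⟩
  refine continuous_of_le_add_edist (2 * (D * m))
    (ENNReal.mul_ne_top (by simp) (ENNReal.mul_ne_top hDt (by simp))) ?_
  rintro ⟨p, p'⟩ ⟨q, q'⟩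
  have := isProbabilityMeasure_atomic e p.2
  have := isProbabilityMeasure_atomic e p'.2
  have := isProbabilityMeasure_atomic e q.2
  have := isProbabilityMeasure_atomic e q'.2
  calc W₁ (atomic e p) (atomic e p')
      ≤ W₁ (atomic e p) (atomic e q) +
          (W₁ (atomic e q) (atomic e q') + W₁ (atomic e q') (atomic e p')) :=
        (W₁_triangle _ (atomic e q) _).trans
          (add_le_add le_rfl (W₁_triangle _ (atomic e q') _))
    _ ≤ D * m * edist (p, p') (q, q') +
          (W₁ (atomic e q) (atomic e q') + D * m * edist (p, p') (q, q')) := by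
        gcongr
        · exact (W₁_atomic_le e D hD p.2 q.2).trans
            (mul_le_mul_right (le_max_left _ _) _)
        · refine (W₁_atomic_le e D hD q'.2 p'.2).trans (mul_le_mul_right ?_ _)
          rw [edist_comm]; exact le_max_right (edist p q) (edist p' q')
    _ = _ := by ring

/-- `W₁` is measurable along measurable families of measures with finite first moment. -/
theorem measurable_W₁ [CompleteSpace X] {α : Type*} [MeasurableSpace α] {a b : α → Measure X}
    [∀ t, IsProbabilityMeasure (a t)] [∀ t, IsProbabilityMeasure (b t)]
    (ha : Measurable a) (hb : Measurable b) (ha1 : ∀ t, ∫⁻ u, ‖u‖ₑ ∂(a t) < ∞)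
    (hb1 : ∀ t, ∫⁻ u, ‖u‖ₑ ∂(b t) < ∞) : Measurable fun t => W₁ (a t) (b t) := by
  set e : ℕ → X := TopologicalSpace.denseSeq X
  set P : ℕ → SimpleFunc X X := SimpleFunc.nearestPt e
  set J : ℕ → SimpleFunc X ℕ := SimpleFunc.nearestPtInd e
  -- the discretized measures
  have hdisc : ∀ (n : ℕ) (μ : Measure X) [IsProbabilityMeasure μ],
      μ.map (P n) = atomic (fun i : Fin (n + 1) => e i) (fun i => μ.real (J n ⁻¹' {(i : ℕ)})) := by
    intro n μ _
    ext s hs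
    rw [Measure.map_apply (P n).measurable hs]
    have hU : P n ⁻¹' s = ⋃ i : Fin (n + 1), (J n ⁻¹' {(i : ℕ)} ∩ {_x | e i ∈ s}) := by
      ext x
      simp only [mem_preimage, mem_iUnion, mem_inter_iff, mem_singleton_iff, mem_ofPred_eq]
      have hx : P n x = e (J n x) := rfl
      rw [hx]
      constructor
      · intro h
        exact ⟨⟨J n x, Nat.lt_succ_of_le (SimpleFunc.nearestPtInd_le e n x)⟩, rfl, h⟩
      · rintro ⟨i, hi, h⟩
        rwa [hi]
    rw [hU, measure_iUnion]
    · simp only [atomic, Measure.coe_finsetSum, Finset.sum_apply, Measure.smul_apply,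
        tsum_fintype, smul_eq_mul, Measure.dirac_apply' _ hs]
      refine Finset.sum_congr rfl fun i _ => ?_
      rw [ofReal_measureReal]
      by_cases h : e i ∈ s <;> simp [h]
    · intro i j hij
      refine Disjoint.mono inter_subset_left inter_subset_left ?_
      rw [disjoint_left]
      rintro x (hx : J n x = i) (hx' : J n x = j)
      exact hij (Fin.ext (hx ▸ hx'))
    · intro i
      exact ((J n).measurableSet_preimage _).inter (MeasurableSet.const _)
  have hsimp : ∀ (n : ℕ) (μ : Measure X) [IsProbabilityMeasure μ],
      (fun i : Fin (n + 1) => μ.real (J n ⁻¹' {(i : ℕ)})) ∈ stdSimplex ℝ (Fin (n + 1)) := by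
    intro n μ _
    refine ⟨fun i => measureReal_nonneg, ?_⟩
    have h1 : IsProbabilityMeasure (μ.map (P n)) :=
      Measure.isProbabilityMeasure_map (P n).measurable.aemeasurable
    have h2 := h1.measure_univ
    rw [hdisc, atomic_univ, ← ENNReal.ofReal_sum_of_nonneg fun i _ => measureReal_nonneg] at h2
    simpa using h2
  have hmeas : ∀ n, Measurable fun t => W₁ ((a t).map (P n)) ((b t).map (P n)) := by
    intro n
    have hw : ∀ {c : α → Measure X} [∀ t, IsProbabilityMeasure (c t)], Measurable c →
        Measurable fun t => (⟨_, hsimp n (c t)⟩ : stdSimplex ℝ (Fin (n + 1))) := by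
      intro c _ hc
      refine Measurable.subtype_mk (measurable_pi_lambda _ fun i => ?_)
      exact (Measure.measurable_coe ((J n).measurableSet_preimage _)).ennreal_toReal.comp hc
    have := (continuous_W₁_atomic (fun i : Fin (n + 1) => e i)).measurable.comp
      ((hw ha).prodMk (hw hb))
    refine (congrArg Measurable (funext fun t => ?_)).mp this
    simp only [Function.comp_apply, hdisc]
    rfl
  -- the discretization error
  have herr : ∀ {c : α → Measure X} [∀ t, IsProbabilityMeasure (c t)] (t : α),
      ∫⁻ u, ‖u‖ₑ ∂(c t) < ∞ →
      Tendsto (fun n => ∫⁻ x, edist x (P n x) ∂(c t)) atTop (𝓝 0) := by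
    intro c _ t hc
    have h0 : ∫⁻ _x, (0 : ℝ≥0∞) ∂(c t) = 0 := by simp
    rw [← h0]
    refine tendsto_lintegral_of_dominated_convergence (fun x => ‖e 0‖ₑ + ‖x‖ₑ)
      (fun n => measurable_id.edist (P n).measurable) (fun n => ae_of_all _ fun x => ?_) ?_
      (ae_of_all _ fun x => ?_)
    · change edist x (P n x) ≤ _
      rw [edist_comm]
      refine (SimpleFunc.edist_nearestPt_le e x (Nat.zero_le n)).trans ?_
      rw [edist_eq_enorm_sub]
      exact enorm_sub_le
    · rw [lintegral_add_left measurable_const]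
      simp [hc.ne]
    · have h1 : Tendsto (fun n => P n x) atTop (𝓝 x) :=
        SimpleFunc.tendsto_nearestPt (TopologicalSpace.denseRange_denseSeq X x)
      simpa using (tendsto_const_nhds (x := x)).edist h1
  refine measurable_of_tendsto_metrizable hmeas (tendsto_pi_nhds.2 fun t => ?_)
  set δ : ℕ → ℝ≥0∞ := fun n =>
    ∫⁻ x, edist x (P n x) ∂(a t) + ∫⁻ x, edist x (P n x) ∂(b t)
  have hδ : Tendsto δ atTop (𝓝 0) := by
    simpa using (herr t (ha1 t)).add (herr t (hb1 t))
  have hP : ∀ n (μ : Measure X) [IsProbabilityMeasure μ], IsProbabilityMeasure (μ.map (P n)) :=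
    fun n μ _ => Measure.isProbabilityMeasure_map (P n).measurable.aemeasurable
  have hup : ∀ n, W₁ ((a t).map (P n)) ((b t).map (P n)) ≤ W₁ (a t) (b t) + δ n := by
    intro n
    have := hP n (a t)
    calc _ ≤ W₁ ((a t).map (P n)) (a t) + (W₁ (a t) (b t) + W₁ (b t) ((b t).map (P n))) :=
          (W₁_triangle _ (a t) _).trans (add_le_add le_rfl (W₁_triangle _ (b t) _))
      _ ≤ ∫⁻ x, edist x (P n x) ∂(a t) +
          (W₁ (a t) (b t) + ∫⁻ x, edist x (P n x) ∂(b t)) := by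
          rw [W₁_comm]
          gcongr <;> exact W₁_map_le _ (P n).measurable
      _ = _ := by simp only [δ]; ring
  have hlow : ∀ n, W₁ (a t) (b t) ≤ W₁ ((a t).map (P n)) ((b t).map (P n)) + δ n := by
    intro n
    have := hP n (a t)
    have := hP n (b t)
    calc _ ≤ W₁ (a t) ((a t).map (P n)) +
          (W₁ ((a t).map (P n)) ((b t).map (P n)) + W₁ ((b t).map (P n)) (b t)) :=
          (W₁_triangle _ ((a t).map (P n)) _).trans
            (add_le_add le_rfl (W₁_triangle _ ((b t).map (P n)) _))
      _ ≤ ∫⁻ x, edist x (P n x) ∂(a t) +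
          (W₁ ((a t).map (P n)) ((b t).map (P n)) + ∫⁻ x, edist x (P n x) ∂(b t)) := by
          rw [W₁_comm _ (b t)]
          gcongr <;> exact W₁_map_le _ (P n).measurable
      _ = _ := by simp only [δ]; ring
  refine tendsto_of_tendsto_of_tendsto_of_le_of_le (g := fun n => W₁ (a t) (b t) - δ n)
    (h := fun n => W₁ (a t) (b t) + δ n) ?_ ?_ (fun n => tsub_le_iff_right.2 (hlow n)) hup
  · simpa using ENNReal.Tendsto.sub (tendsto_const_nhds (x := W₁ (a t) (b t))) hδ (by simp)
  · simpa using tendsto_const_nhds.add hδ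

end Wasserstein
section TimeParametrized

/-- The time interval `[0,T]`. -/
abbrev Time (T : ℝ) : Type := Set.Icc (0 : ℝ) T

/-- Lebesgue measure on `[0,T]`. -/
def lebT (T : ℝ) : Measure (Time T) := Measure.comap Subtype.val volume

/-- The space `L¹_t([0,T]; 𝒫₁(X))` of weak-* measurable maps `t ↦ ν_t` into the Borel probability
measures with finite first moment, with `∫₀ᵀ ∫ ‖u‖ ν_t(du) dt < ∞`. -/
structure L1P (T : ℝ) (X : Type*) [NormedAddCommGroup X] [MeasurableSpace X] where
  meas : Time T → Measure X
  prob : ∀ t, IsProbabilityMeasure (meas t)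
  moment : ∀ t, ∫⁻ u, ‖u‖ₑ ∂(meas t) < ∞
  weakMeasurable : ∀ Φ : X →ᵇ ℝ, Measurable fun t => ∫ u, Φ u ∂(meas t)
  integrable : ∫⁻ t, ∫⁻ u, ‖u‖ₑ ∂(meas t) ∂(lebT T) < ∞

variable {T : ℝ} {X : Type*} [NormedAddCommGroup X] [MeasurableSpace X]

instance (ν : L1P T X) (t : Time T) : IsProbabilityMeasure (ν.meas t) := ν.prob t

variable [BorelSpace X]

theorem L1P.measurable_meas (ν : L1P T X) : Measurable ν.meas := by
  have hgen : (inferInstance : MeasurableSpace X) =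
      MeasurableSpace.generateFrom {s : Set X | IsClosed s} := by
    rw [← borel_eq_generateFrom_isClosed]; exact BorelSpace.measurable_eq
  refine Measurable.measure_of_isPiSystem_of_isProbabilityMeasure hgen isPiSystem_isClosed ?_
  intro F hF
  have hpos : ∀ n : ℕ, (0 : ℝ) < 1 / ((n : ℝ) + 1) := fun n => Nat.one_div_pos_of_nat
  have hlim : Tendsto (fun n : ℕ => 1 / ((n : ℝ) + 1)) atTop (𝓝 0) :=
    tendsto_one_div_add_atTop_nhds_zero_nat
  refine measurable_of_tendsto_metrizable
    (f := fun n t => ∫⁻ u, (thickenedIndicator (hpos n) F u : ℝ≥0∞) ∂(ν.meas t)) (fun n => ?_)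
    (tendsto_pi_nhds.2 fun t =>
      tendsto_lintegral_thickenedIndicator_of_isClosed (ν.meas t) hF hpos hlim)
  set g := thickenedIndicator (hpos n) F
  have h1 := (ν.weakMeasurable (BoundedContinuousFunction.ofNormedAddCommGroup
    (fun u => (g u : ℝ)) (NNReal.continuous_coe.comp g.continuous) 1 fun u => by
      rw [Real.norm_of_nonneg (g u).coe_nonneg]
      exact NNReal.coe_le_one.2 (thickenedIndicator_le_one (hpos n) F u))).ennreal_ofReal
  refine (congrArg Measurable (funext fun t => ?_)).mp h1
  change ENNReal.ofReal (∫ u, (g u : ℝ) ∂(ν.meas t)) = _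
  rw [← BoundedContinuousFunction.toReal_lintegral_coe_eq_integral, ENNReal.ofReal_toReal]
  exact (BoundedContinuousFunction.lintegral_lt_top_of_nnreal (ν.meas t) g).ne

/-- The metric `d_T(ν, ν') = ∫₀ᵀ W₁(ν_t, ν'_t) dt` (elements that agree for almost every `t` are at
distance zero). -/
instance [SecondCountableTopology X] [CompleteSpace X] : PseudoEMetricSpace (L1P T X) where
  edist ν ν' := ∫⁻ t, W₁ (ν.meas t) (ν'.meas t) ∂(lebT T)
  edist_self ν := by simp [W₁_self]
  edist_comm ν ν' := by simp only [W₁_comm]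
  edist_triangle ν₁ ν₂ ν₃ := by
    rw [← lintegral_add_left
      (measurable_W₁ ν₁.measurable_meas ν₂.measurable_meas ν₁.moment ν₂.moment)]
    exact lintegral_mono fun t => W₁_triangle _ _ _

end TimeParametrized

section Torus

instance : Fact (0 < 2 * Real.pi) := ⟨Real.two_pi_pos⟩

/-- The `2π`-periodic torus `𝕋ⁿ = (ℝ / 2πℤ)ⁿ`, carrying Lebesgue measure (total mass `(2π)ⁿ`). -/
abbrev Torus (n : ℕ) : Type := Fin n → AddCircle (2 * Real.pi)

/-- `L²_x = L²(𝕋ⁿ; ℝⁿ)`. -/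
abbrev L2x (n : ℕ) : Type := Lp (EuclideanSpace ℝ (Fin n)) 2 (volume : Measure (Torus n))

instance : Fact ((2 : ℝ≥0∞) ≠ ∞) := ⟨by simp⟩

instance (n : ℕ) : MeasurableSpace (L2x n) := borel _

instance (n : ℕ) : BorelSpace (L2x n) := ⟨rfl⟩

variable {n : ℕ}

/-- The Fourier coefficient `û_k = (2π)⁻ⁿ ∫ u(x) e^{-ik·x} dx ∈ ℂⁿ`. -/
def fourierCoef (u : L2x n) (k : Fin n → ℤ) : EuclideanSpace ℂ (Fin n) :=
  WithLp.toLp 2 fun i =>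
    ((2 * Real.pi : ℂ) ^ n)⁻¹ *
      ∫ x : Torus n, (∏ j, fourier (-(k j)) (x j)) * ((u x i : ℝ) : ℂ)

/-- `|k|²` for a wave vector `k ∈ ℤⁿ`. -/
def waveSq (k : Fin n → ℤ) : ℝ := ∑ j, (k j : ℝ) ^ 2

/-- `div u = 0` in the sense of distributions, i.e. `k · û_k = 0` for all `k`. -/
def DivFree (u : L2x n) : Prop := ∀ k : Fin n → ℤ, ∑ j, (k j : ℂ) * fourierCoef u k j = 0

/-- `‖∇u‖²_{L²_x} = (2π)ⁿ ∑_k |k|² |û_k|²`, equal to `∞` if `u` is not in `H¹_x`. -/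
def gradNormSq (u : L2x n) : ℝ≥0∞ :=
  ∑' k : Fin n → ℤ, ENNReal.ofReal ((2 * Real.pi) ^ n * (waveSq k * ‖fourierCoef u k‖ ^ 2))

/-- The Sobolev norm `‖u‖_{H^s_x} = ((2π)ⁿ ∑_k (1 + |k|²)^s |û_k|²)^{1/2}`, `s ∈ ℝ`. -/
def sobolevNorm (s : ℝ) (u : L2x n) : ℝ≥0∞ :=
  (∑' k : Fin n → ℤ,
    ENNReal.ofReal ((2 * Real.pi) ^ n * ((1 + waveSq k) ^ s * ‖fourierCoef u k‖ ^ 2))) ^ (1 / 2 : ℝ)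

end Torus

section Noise

variable {d N : ℕ}

/-- `|y|_Γ = ⟨y, Γ⁻¹ y⟩^{1/2}` on `ℝᵈ`. -/
def gammaNorm (Γ : Matrix (Fin d) (Fin d) ℝ) (y : EuclideanSpace ℝ (Fin d)) : ℝ :=
  √(y.ofLp ⬝ᵥ (Γ⁻¹ *ᵥ y.ofLp))

/-- `|𝐲|_Γ = (∑_j |y_j|_Γ²)^{1/2}` on `ℝ^{d×N}`. -/
def gammaNormN (Γ : Matrix (Fin d) (Fin d) ℝ) (y : Fin N → EuclideanSpace ℝ (Fin d)) : ℝ :=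
  √(∑ j, gammaNorm Γ (y j) ^ 2)

/-- `ρ` is a positive probability density on `ℝᵈ` which is Lipschitz continuous, bounded, and
satisfies the tail condition `ρ(y) ≥ exp(-|y|_Γ²/2) / C`. -/
structure IsNoiseDensity (Γ : Matrix (Fin d) (Fin d) ℝ) (ρ : EuclideanSpace ℝ (Fin d) → ℝ) :
    Prop where
  pos : ∀ y, 0 < ρ y
  integral_eq_one : ∫⁻ y, ENNReal.ofReal (ρ y) = 1
  lipschitz : ∃ L > 0, ∀ y y', |ρ y - ρ y'| ≤ L * gammaNorm Γ (y - y')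
  bounded : ∃ C > 0, ∀ y, ρ y ≤ C
  tail : ∃ C > 0, ∀ y, Real.exp (-(1 / 2) * gammaNorm Γ y ^ 2) / C ≤ ρ y

end Noise

section Filtering

variable {T : ℝ} {n d N : ℕ}

/-- The space `L¹([0,T]; L²_x)`. -/
abbrev PathSpace (T : ℝ) (n : ℕ) : Type := Lp (L2x n) 1 (lebT T)

/-- Lipschitz continuous observables `𝒢_j : L¹([0,T]; L²_x) → ℝᵈ` that depend only on the values on
`[t_{j-1}, t_j]`; here `𝒢 j` is observed on `[t j.castSucc, t j.succ]`. -/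
def LipschitzObservables (t : Fin (N + 1) → ℝ) (G : Fin N → PathSpace T n → EuclideanSpace ℝ (Fin d))
    (L : ℝ) : Prop :=
  ∀ (j : Fin N) (u u' : PathSpace T n),
    ‖G j u - G j u'‖ ≤
      L * ∫ s in {s : Time T | t j.castSucc ≤ s ∧ (s : ℝ) ≤ t j.succ}, ‖u s - u' s‖ ∂(lebT T)

open Classical in
/-- The trajectory `s ↦ 𝒮_s(ū)` as an element of `L¹([0,T]; L²_x)`. (The value `0` is only used for
initial data `ū` whose trajectory is not integrable in time.) -/
def trajectory (S : Time T → L2x n → L2x n) (u : L2x n) : PathSpace T n :=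
  if h : MemLp (fun s => S s u) 1 (lebT T) then h.toLp else 0

/-- The likelihood `∏_{t_j ≤ s} ρ(y_j - 𝒢_j(𝒮(ū)))` of the measurements `y_j = 𝒢_j(𝒮(ū)) + η_j`
available at time `s`. -/
def likelihood (ρ : EuclideanSpace ℝ (Fin d) → ℝ) (t : Fin (N + 1) → ℝ)
    (G : Fin N → PathSpace T n → EuclideanSpace ℝ (Fin d)) (S : Time T → L2x n → L2x n)
    (y : Fin N → EuclideanSpace ℝ (Fin d)) (s : Time T) (u : L2x n) : ℝ≥0∞ :=
  ENNReal.ofReal (∏ j with t (Fin.succ j) ≤ s, ρ (y j - G j (trajectory S u)))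

/-- The posterior on the initial data given the measurements `y_j` with `t_j ≤ s`: by Bayes'
formula, it is the prior reweighted by the likelihood and normalized. -/
def posterior (ρ : EuclideanSpace ℝ (Fin d) → ℝ) (t : Fin (N + 1) → ℝ)
    (G : Fin N → PathSpace T n → EuclideanSpace ℝ (Fin d)) (S : Time T → L2x n → L2x n)
    (prior : Measure (L2x n)) (y : Fin N → EuclideanSpace ℝ (Fin d)) (s : Time T) :
    Measure (L2x n) :=
  (∫⁻ u, likelihood ρ t G S y s u ∂prior)⁻¹ • prior.withDensity (likelihood ρ t G S y s)

/-- The filtering distribution `ν^𝐲_s`: the law of `𝒮_s(ū)` given the measurements `y_j` with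
`t_j ≤ s`, i.e. the push-forward under `𝒮_s` of the posterior on the initial data. -/
def filtering (ρ : EuclideanSpace ℝ (Fin d) → ℝ) (t : Fin (N + 1) → ℝ)
    (G : Fin N → PathSpace T n → EuclideanSpace ℝ (Fin d)) (S : Time T → L2x n → L2x n)
    (prior : Measure (L2x n)) (y : Fin N → EuclideanSpace ℝ (Fin d)) (s : Time T) :
    Measure (L2x n) :=
  (posterior ρ t G S prior y s).map (S s)

/-- Approximate solution operators `𝒮^Δ_s : L²_x → L²_x`, `Δ > 0`, `s ∈ [0,T]`, for the
Navier-Stokes equations with viscosity `visc`. The bounds are required for divergence-free initial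
data, and uniformly in `Δ`. -/
structure ApproxSolutionOperators (visc : ℝ) (S : Set.Ioi (0 : ℝ) → Time T → L2x n → L2x n) :
    Prop where
  measurable : ∀ Δ, Measurable fun p : Time T × L2x n => S Δ p.1 p.2
  energy : ∀ Δ s u, DivFree u → ‖S Δ s u‖ ≤ ‖u‖
  coercivity : ∀ Δ u, DivFree u →
    ∫⁻ s, gradNormSq (S Δ s u) ∂(lebT T) ≤ ENNReal.ofReal (visc⁻¹ * ‖u‖ ^ 2)
  timeRegularity : ∃ L > 0, ∃ C : ℝ → ℝ, ∀ Δ u, DivFree u → ∀ s s',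
    sobolevNorm (-L) (S Δ s u - S Δ s' u) ≤ ENNReal.ofReal (C ‖u‖ * |(s : ℝ) - s'|)

end Filtering

end FilteringNS

end

open FilteringNS

/-! The argument combines stability in the measurements with Arzelà–Ascoli in `L1P`.

Stability. On the support of the prior the trajectories are bounded by `M`, so the observables are
bounded. The tail condition on `ρ` then bounds the likelihood below by some `m R M > 0`; it is also
bounded above, and it is Lipschitz in the data as a product of Lipschitz bounded factors
(`exists_likelihood_bounds`). Normalized densities therefore differ uniformly by a multiple of the
distance of the data. Only their excess mass has to be moved, and only inside a ball of radius `M`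
(`W₁_map_reweight_le`). The resulting constant `C R M` is continuous and increasing in `R`, so all
estimates are instances of one bound by a continuous gauge `c y y'` vanishing on the diagonal.

Compactness for fixed data. The posteriors are dominated by a fixed multiple of the prior
(`exists_filtering_bounds`) and change only at observation times. Projecting the solutions to low
frequencies costs little in time average because of the gradient bound. After projection the
trajectories are equicontinuous in time in expectation, because on low frequencies the `L²` norm is
controlled by the `H^{-L}` norm. Hence time may be rounded to a finite grid containing the
observation times, and at each grid time the measures live on a compact subset of a
finite-dimensional space, where `exists_finite_W₁_net` supplies finitely many atomic models. This is
`exists_finite_pushforward_net`; it gives total boundedness.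

Completeness of `L1P` turns total boundedness into relative compactness. It reduces to completeness
of `W₁` (`exists_tendsto_W₁`): near-optimal couplings of consecutive measures are glued into one
random sequence, which converges almost surely when the costs are summable. Equicontinuity from the
stability estimate and `isCompact_closure_range_of_equicontinuous` then give compactness locally
uniformly in the data, and convergent subsequences.

Limits. Convergence in `L1P` preserves the bound by `c` for almost every time only, with a null set
depending on the pair of data. `L1P.exists_modification` removes this dependence: a single null set
serves a countable dense set of data, and the family is extended from there by completeness of `W₁`.
-/

noncomputable section

namespace FilteringNS

/-! ### Completeness, separation and measurability for `W₁`. -/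

section WassersteinCompleteness

variable {X : Type*} [NormedAddCommGroup X] [MeasurableSpace X] [BorelSpace X]
  [SecondCountableTopology X]

theorem exists_isCoupling_lintegral_lt {μ ν : Measure X} {r : ℝ≥0∞} (h : W₁ μ ν < r) :
    ∃ π : Measure (X × X), IsCoupling π μ ν ∧ ∫⁻ p, edist p.1 p.2 ∂π < r := by
  unfold W₁ at h
  simpa [iInf_lt_iff] using h

theorem IsCoupling.isProbabilityMeasure {π : Measure (X × X)} {μ ν : Measure X}
    [IsProbabilityMeasure μ] (h : IsCoupling π μ ν) : IsProbabilityMeasure π := by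
  have : IsProbabilityMeasure (π.map Prod.fst) := by rw [h.1]; infer_instance
  exact Measure.isProbabilityMeasure_of_map (f := Prod.fst)

theorem W₁_map_map_le {Ω : Type*} [MeasurableSpace Ω] (P : Measure Ω) {f g : Ω → X}
    (hf : Measurable f) (hg : Measurable g) :
    W₁ (P.map f) (P.map g) ≤ ∫⁻ ω, edist (f ω) (g ω) ∂P := by
  have hm : Measurable fun ω => (f ω, g ω) := hf.prodMk hg
  have h : IsCoupling (P.map fun ω => (f ω, g ω)) (P.map f) (P.map g) := by
    constructor
    · rw [Measure.map_map measurable_fst hm]; rfl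
    · rw [Measure.map_map measurable_snd hm]; rfl
  refine h.W₁_le.trans_eq ?_
  rw [lintegral_map (by fun_prop) hm]

/-- A kernel that reads its input only through `e` produces a joint law with `e` that depends only
on the law of `e`. For the glued chain below, `e` is evaluation at the last coordinate. -/
theorem map_compProd_comap {A B : Type*} [MeasurableSpace A] [MeasurableSpace B] {μ : Measure A}
    [IsProbabilityMeasure μ] {e : A → B} (he : Measurable e) (κ : Kernel B X) [IsMarkovKernel κ] :
    (μ ⊗ₘ κ.comap e he).map (Prod.map e id) = μ.map e ⊗ₘ κ := by
  have : IsProbabilityMeasure (μ.map e) := Measure.isProbabilityMeasure_map he.aemeasurable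
  ext s hs
  rw [Measure.map_apply (he.prodMap measurable_id) hs,
    Measure.compProd_apply ((he.prodMap measurable_id) hs), Measure.compProd_apply hs,
    lintegral_map (Kernel.measurable_kernel_prodMk_left hs) he]
  rfl

theorem map_zero_trajMeasure {μ : Measure X} [IsProbabilityMeasure μ]
    (κ : (k : ℕ) → Kernel (Π _ : Finset.Iic k, X) X) [∀ k, IsMarkovKernel (κ k)] :
    (Kernel.trajMeasure (X := fun _ => X) μ κ).map (fun x => x 0) = μ := by
  have he : Measurable fun x : (Π _ : Finset.Iic 0, X) => x ⟨0, by simp⟩ := measurable_pi_apply _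
  have h2 : (Kernel.trajMeasure (X := fun _ => X) μ κ).map (Preorder.frestrictLe 0) =
      μ.map (MeasurableEquiv.piUnique (fun _ : Finset.Iic 0 => X)).symm := by
    rw [Kernel.trajMeasure, Measure.map_comp _ _ (by fun_prop), Kernel.traj_map_frestrictLe,
      Kernel.partialTraj_self, Measure.id_comp]
  have h3 : (Kernel.trajMeasure (X := fun _ => X) μ κ).map (fun x => x 0) =
      ((Kernel.trajMeasure (X := fun _ => X) μ κ).map (Preorder.frestrictLe 0)).map
        (fun x : (Π _ : Finset.Iic 0, X) => x ⟨0, by simp⟩) := by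
    rw [Measure.map_map he (by fun_prop)]; rfl
  rw [h3, h2, Measure.map_map he (by fun_prop)]
  exact Measure.map_id

/-- Couplings of consecutive members of a sequence of measures can be glued to a single sequence
of random variables. -/
theorem exists_measure_map_prodMk_eq [CompleteSpace X] (μ : ℕ → Measure X)
    [∀ k, IsProbabilityMeasure (μ k)] (π : ℕ → Measure (X × X))
    (hπ : ∀ k, IsCoupling (π k) (μ k) (μ (k + 1))) :
    ∃ P : Measure (ℕ → X), IsProbabilityMeasure P ∧
      ∀ k, P.map (fun x => (x k, x (k + 1))) = π k := by
  have := fun k => (hπ k).isProbabilityMeasure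
  have he : ∀ k : ℕ, Measurable fun x : (Π _ : Finset.Iic k, X) => x ⟨k, Finset.mem_Iic.2 le_rfl⟩ :=
    fun k => measurable_pi_apply (⟨k, Finset.mem_Iic.2 le_rfl⟩ : Finset.Iic k)
  -- The transition kernel at step `k` sees only the last coordinate of the history, so the
  -- trajectory measure is a Markov chain.
  obtain ⟨κ, hκ⟩ : ∃ κ : (k : ℕ) → Kernel (Π _ : Finset.Iic k, X) X,
    ∀ k, κ k = (π k).condKernel.comap _ (he k) := ⟨_, fun k => rfl⟩
  have hκm : ∀ k, IsMarkovKernel (κ k) := fun k => by rw [hκ]; infer_instance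
  have h1 := fun k => Kernel.map_frestrictLe_trajMeasure_compProd_eq_map_trajMeasure
    (X := fun _ => X) (μ₀ := μ 0) (κ := κ) (a := k)
  have h0 := map_zero_trajMeasure (μ := μ 0) κ
  have hP : IsProbabilityMeasure (Kernel.trajMeasure (X := fun _ => X) (μ 0) κ) := inferInstance
  generalize Kernel.trajMeasure (X := fun _ => X) (μ 0) κ = P at *
  have key : ∀ k, P.map (fun x => x k) = μ k → P.map (fun x => (x k, x (k + 1))) = π k := by
    intro k hk
    have hP' : IsProbabilityMeasure (P.map (Preorder.frestrictLe (π := fun _ => X) k)) :=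
      Measure.isProbabilityMeasure_map (by fun_prop)
    have h3 : (P.map (Preorder.frestrictLe k)).map
        (fun x : (Π _ : Finset.Iic k, X) => x ⟨k, by simp⟩) = μ k := by
      rw [Measure.map_map (he k) (by fun_prop)]; exact hk
    have h4 : μ k ⊗ₘ (π k).condKernel = π k := by
      have : (π k).fst = μ k := (hπ k).1
      rw [← this]; exact (π k).disintegrate _
    have h5 := map_compProd_comap (μ := P.map (Preorder.frestrictLe (π := fun _ => X) k)) (he k)
      (π k).condKernel
    rw [h3, h4, ← hκ k, h1 k, Measure.map_map ((he k).prodMap measurable_id) (by fun_prop)] at h5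
    exact h5
  refine ⟨P, hP, fun k => key k ?_⟩
  induction k with
  | zero => exact h0
  | succ k ih =>
    rw [← (hπ k).2, ← key k ih, Measure.map_map measurable_snd (by fun_prop)]
    rfl

/-- In the glued sequence of random variables the expected increments are summable, so almost every
path is Cauchy in `X`. The law of the pathwise limit is the limit measure, and the coupling with the
limit has cost at most the tail of the series. -/
theorem exists_tendsto_W₁ [CompleteSpace X] (μ : ℕ → Measure X) [∀ k, IsProbabilityMeasure (μ k)]
    (h : ∑' k, W₁ (μ k) (μ (k + 1)) ≠ ∞) :
    ∃ ν : Measure X, IsProbabilityMeasure ν ∧ Tendsto (fun k => W₁ (μ k) ν) atTop (𝓝 0) := by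
  -- Optimal couplings are not needed: a summable slack leaves the total cost finite.
  have hlt : ∀ k, W₁ (μ k) (μ (k + 1)) < W₁ (μ k) (μ (k + 1)) + 2⁻¹ ^ k := fun k =>
    ENNReal.lt_add_right (ENNReal.ne_top_of_tsum_ne_top h k)
      (pow_ne_zero _ (by simp))
  choose π hπ hlt using fun k => exists_isCoupling_lintegral_lt (hlt k)
  obtain ⟨P, hP, hPπ⟩ := exists_measure_map_prodMk_eq μ π hπ
  have hcost : ∀ k, ∫⁻ x, edist (x k) (x (k + 1)) ∂P = ∫⁻ p, edist p.1 p.2 ∂(π k) := by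
    intro k
    rw [← hPπ k, lintegral_map (by fun_prop) (by fun_prop)]
  have hsum : ∑' k, ∫⁻ p, edist p.1 p.2 ∂(π k) ≠ ∞ := by
    refine ne_top_of_le_ne_top ?_ (ENNReal.tsum_le_tsum fun k => (hlt k).le)
    rw [ENNReal.tsum_add]
    refine ENNReal.add_ne_top.2 ⟨h, ?_⟩
    rw [ENNReal.tsum_geometric]
    simp
  have hmeas : ∀ k, Measurable fun x : ℕ → X => edist (x k) (x (k + 1)) := fun k => by fun_prop
  have hae : ∀ᵐ x ∂P, ∑' k, edist (x k) (x (k + 1)) < ∞ := by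
    refine ae_lt_top (Measurable.tsum hmeas) ?_
    rw [lintegral_tsum fun k => (hmeas k).aemeasurable]
    simpa only [hcost] using hsum
  obtain ⟨Z, hZ, hlim⟩ := measurable_limit_of_tendsto_metrizable_ae (μ := P) (L := atTop)
    (f := fun k (x : ℕ → X) => x k) (fun k => (measurable_pi_apply k).aemeasurable) (by
      filter_upwards [hae] with x hx
      exact cauchySeq_tendsto_of_complete
        (cauchySeq_of_edist_le_of_tsum_ne_top _ (fun _ => le_rfl) hx.ne))
  have hmarg : ∀ k, P.map (fun x => x k) = μ k := by
    intro k
    rw [← (hπ k).1, ← hPπ k, Measure.map_map measurable_fst (by fun_prop)]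
    rfl
  refine ⟨P.map Z, Measure.isProbabilityMeasure_map hZ.aemeasurable, ?_⟩
  refine tendsto_of_tendsto_of_tendsto_of_le_of_le tendsto_const_nhds
    (ENNReal.tendsto_sum_nat_add _ hsum) (fun k => zero_le) fun k => ?_
  change W₁ (μ k) _ ≤ _
  rw [← hmarg k]
  refine (W₁_map_map_le P (measurable_pi_apply k) hZ).trans ?_
  calc ∫⁻ x, edist (x k) (Z x) ∂P ≤ ∫⁻ x, ∑' j, edist (x (k + j)) (x (k + j + 1)) ∂P := by
        refine lintegral_mono_ae ?_
        filter_upwards [hlim] with x hx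
        exact edist_le_tsum_of_edist_le_of_tendsto _ (fun _ => le_rfl) hx k
    _ = ∑' j, ∫⁻ p, edist p.1 p.2 ∂(π (j + k)) := by
        rw [lintegral_tsum fun j => (hmeas _).aemeasurable]
        simp only [hcost, add_comm]

/-- The construction of the limit only gives a tail bound that includes the slack of the chosen
couplings; the triangle inequality removes it. -/
theorem W₁_le_tsum_of_tendsto [CompleteSpace X] {μ : ℕ → Measure X}
    [∀ k, IsProbabilityMeasure (μ k)] {ν : Measure X} [IsProbabilityMeasure ν]
    (h : Tendsto (fun k => W₁ (μ k) ν) atTop (𝓝 0)) (k : ℕ) :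
    W₁ (μ k) ν ≤ ∑' j, W₁ (μ (j + k)) (μ (j + k + 1)) := by
  have hstep : ∀ m, W₁ (μ k) (μ (m + k)) ≤ ∑ j ∈ Finset.range m, W₁ (μ (j + k)) (μ (j + k + 1)) := by
    intro m
    induction m with
    | zero => simp [W₁_self]
    | succ m ih =>
      rw [Finset.sum_range_succ, Nat.add_right_comm]
      exact (W₁_triangle _ (μ (m + k)) _).trans (by gcongr)
  have h' : Tendsto (fun m => ∑' j, W₁ (μ (j + k)) (μ (j + k + 1)) + W₁ (μ (m + k)) ν) atTop
      (𝓝 (∑' j, W₁ (μ (j + k)) (μ (j + k + 1)) + 0)) :=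
    tendsto_const_nhds.add (h.comp (tendsto_add_atTop_nat k))
  rw [add_zero] at h'
  refine ge_of_tendsto' h' fun m => (W₁_triangle _ (μ (m + k)) _).trans ?_
  gcongr
  exact (hstep m).trans (ENNReal.sum_le_tsum _)

/-- This is the easy half of Kantorovich duality: integrate the Lipschitz bound against an arbitrary
coupling. The conditions on `K` allow it to be moved inside the infimum. -/
theorem lintegral_le_add_W₁ (μ ν : Measure X) {f : X → ℝ≥0∞} (hf : Measurable f) {K : ℝ≥0∞}
    (hK0 : K ≠ 0) (hK : K ≠ ∞) (hL : ∀ x y, f x ≤ f y + K * edist x y) :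
    ∫⁻ u, f u ∂μ ≤ ∫⁻ u, f u ∂ν + K * W₁ μ ν := by
  unfold W₁
  rw [ENNReal.mul_iInf_of_ne hK0 hK, ENNReal.add_iInf]
  refine le_iInf fun π => ?_
  rw [ENNReal.mul_iInf_of_ne hK0 hK, ENNReal.add_iInf]
  refine le_iInf fun h => ?_
  rw [← h.1, ← h.2, lintegral_map hf measurable_fst, lintegral_map hf measurable_snd,
    ← lintegral_const_mul _ (by fun_prop), ← lintegral_add_left (by fun_prop)]
  exact lintegral_mono fun p => hL _ _

theorem lintegral_enorm_le_add_W₁ (μ ν : Measure X) :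
    ∫⁻ u, ‖u‖ₑ ∂μ ≤ ∫⁻ u, ‖u‖ₑ ∂ν + W₁ μ ν := by
  have h := lintegral_le_add_W₁ μ ν (f := fun u => ‖u‖ₑ) (by fun_prop) one_ne_zero
    ENNReal.one_ne_top fun x y => by
      calc ‖x‖ₑ = ‖y + (x - y)‖ₑ := by simp
        _ ≤ _ := by rw [one_mul, edist_eq_enorm_sub]; exact enorm_add_le _ _
  simpa using h

theorem lintegral_thickenedIndicator_le_add_W₁ (μ ν : Measure X) {δ : ℝ} (hδ : 0 < δ) (F : Set X) :
    ∫⁻ u, (thickenedIndicator hδ F u : ℝ≥0∞) ∂μ ≤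
      ∫⁻ u, (thickenedIndicator hδ F u : ℝ≥0∞) ∂ν + ENNReal.ofReal δ⁻¹ * W₁ μ ν := by
  have hL := lipschitzWith_thickenedIndicator hδ F
  refine lintegral_le_add_W₁ μ ν (by fun_prop) (by simpa using hδ) ENNReal.ofReal_ne_top
    fun x y => ?_
  have h := hL x y
  have h2 : ((thickenedIndicator hδ F x : ℝ≥0) : ℝ≥0∞) ≤
      (thickenedIndicator hδ F y : ℝ≥0) +
        edist (thickenedIndicator hδ F x) (thickenedIndicator hδ F y) := by
    rw [edist_nndist, ← ENNReal.coe_add, ENNReal.coe_le_coe, NNReal.nndist_eq]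
    exact (tsub_le_iff_left.1 le_rfl).trans (add_le_add_right (le_max_left _ _) _)
  refine h2.trans ?_
  gcongr
  refine h.trans_eq ?_
  rw [ENNReal.ofReal, Real.toNNReal_inv]

/-- `W₁` separates probability measures. -/
theorem eq_of_W₁_eq_zero {μ ν : Measure X} [IsProbabilityMeasure μ] [IsProbabilityMeasure ν]
    (h : W₁ μ ν = 0) : μ = ν := by
  -- Thickened indicators of a closed set are Lipschitz, so they have equal integrals; letting the
  -- thickness tend to zero compares the masses of closed sets, which form a generating π-system.
  have key : ∀ {μ ν : Measure X} [IsProbabilityMeasure μ] [IsProbabilityMeasure ν],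
      W₁ μ ν = 0 → ∀ F, IsClosed F → μ F ≤ ν F := by
    intro μ ν _ _ h F hF
    have hpos : ∀ n : ℕ, (0 : ℝ) < 1 / ((n : ℝ) + 1) := fun n => Nat.one_div_pos_of_nat
    have hlim : Tendsto (fun n : ℕ => 1 / ((n : ℝ) + 1)) atTop (𝓝 0) :=
      tendsto_one_div_add_atTop_nhds_zero_nat
    refine le_of_tendsto_of_tendsto'
      (tendsto_lintegral_thickenedIndicator_of_isClosed μ hF hpos hlim)
      (tendsto_lintegral_thickenedIndicator_of_isClosed ν hF hpos hlim) fun n => ?_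
    simpa [h] using lintegral_thickenedIndicator_le_add_W₁ μ ν (hpos n) F
  refine ext_of_generate_finite {s | IsClosed s} ?_ isPiSystem_isClosed (fun F hF => ?_) (by simp)
  · rw [← borel_eq_generateFrom_isClosed]; exact BorelSpace.measurable_eq
  · exact le_antisymm (key h F hF) (key (by rw [W₁_comm]; exact h) F hF)

/-- Pointwise `W₁`-limits of measurable families of probability measures are measurable. -/
theorem measurable_of_tendsto_W₁ {α : Type*} [MeasurableSpace α] {a : ℕ → α → Measure X}
    {b : α → Measure X} [∀ t, IsProbabilityMeasure (b t)] (ha : ∀ k, Measurable (a k))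
    (h : ∀ t, Tendsto (fun k => W₁ (a k t) (b t)) atTop (𝓝 0)) : Measurable b := by
  have hgen : (inferInstance : MeasurableSpace X) =
      MeasurableSpace.generateFrom {s : Set X | IsClosed s} := by
    rw [← borel_eq_generateFrom_isClosed]; exact BorelSpace.measurable_eq
  refine Measurable.measure_of_isPiSystem_of_isProbabilityMeasure hgen isPiSystem_isClosed ?_
  intro F hF
  have hpos : ∀ n : ℕ, (0 : ℝ) < 1 / ((n : ℝ) + 1) := fun n => Nat.one_div_pos_of_nat
  have hlim : Tendsto (fun n : ℕ => 1 / ((n : ℝ) + 1)) atTop (𝓝 0) :=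
    tendsto_one_div_add_atTop_nhds_zero_nat
  refine measurable_of_tendsto_metrizable
    (f := fun n t => ∫⁻ u, (thickenedIndicator (hpos n) F u : ℝ≥0∞) ∂(b t)) (fun n => ?_)
    (tendsto_pi_nhds.2 fun t =>
      tendsto_lintegral_thickenedIndicator_of_isClosed (b t) hF hpos hlim)
  -- For a fixed thickness the test function is Lipschitz, so its integrals converge along `k`; the
  -- thickness is sent to zero only afterwards.
  refine measurable_of_tendsto_metrizable
    (f := fun k t => ∫⁻ u, (thickenedIndicator (hpos n) F u : ℝ≥0∞) ∂(a k t))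
    (fun k => (Measure.measurable_lintegral (by fun_prop)).comp (ha k))
    (tendsto_pi_nhds.2 fun t => ?_)
  have h0 : Tendsto (fun k => ENNReal.ofReal (1 / ((n : ℝ) + 1))⁻¹ * W₁ (a k t) (b t)) atTop
      (𝓝 0) := by
    simpa using ENNReal.Tendsto.const_mul (h t) (Or.inr ENNReal.ofReal_ne_top)
  refine tendsto_of_tendsto_of_tendsto_of_le_of_le
    (g := fun k => ∫⁻ u, (thickenedIndicator (hpos n) F u : ℝ≥0∞) ∂(b t) -
      ENNReal.ofReal (1 / ((n : ℝ) + 1))⁻¹ * W₁ (a k t) (b t))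
    (h := fun k => ∫⁻ u, (thickenedIndicator (hpos n) F u : ℝ≥0∞) ∂(b t) +
      ENNReal.ofReal (1 / ((n : ℝ) + 1))⁻¹ * W₁ (a k t) (b t)) ?_ ?_
    (fun k => tsub_le_iff_right.2 ?_) fun k => lintegral_thickenedIndicator_le_add_W₁ _ _ _ _
  · simpa using ENNReal.Tendsto.sub tendsto_const_nhds h0 (by simp)
  · simpa using tendsto_const_nhds.add h0
  · rw [W₁_comm]; exact lintegral_thickenedIndicator_le_add_W₁ _ _ _ _

end WassersteinCompleteness

/-! ### Completeness of the space `L1P`. -/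

section L1PCompleteness

variable {T : ℝ} {X : Type*} [NormedAddCommGroup X] [MeasurableSpace X] [BorelSpace X]

instance : IsFiniteMeasure (lebT T) := by
  constructor
  rw [lebT, Measure.comap_apply _ Subtype.val_injective
    (fun s hs => measurableSet_Icc.subtype_image hs) _ MeasurableSet.univ, image_univ, Subtype.range_coe]
  exact measure_Icc_lt_top

/-- A measurable family of probability measures with integrable first moments. -/
def L1P.ofMeasurable (a : Time T → Measure X) (hp : ∀ t, IsProbabilityMeasure (a t))
    (ha : Measurable a) (h1 : ∀ t, ∫⁻ u, ‖u‖ₑ ∂(a t) < ∞)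
    (h2 : ∫⁻ t, ∫⁻ u, ‖u‖ₑ ∂(a t) ∂(lebT T) < ∞) : L1P T X where
  meas := a
  prob := hp
  moment := h1
  weakMeasurable Φ := by
    have hc := Φ.continuous
    have : Measurable fun t => ∫⁻ u, ENNReal.ofReal (Φ u) ∂(a t) :=
      (Measure.measurable_lintegral (by fun_prop)).comp ha
    have h' : Measurable fun t => ∫⁻ u, ENNReal.ofReal (-Φ u) ∂(a t) :=
      (Measure.measurable_lintegral (by fun_prop)).comp ha
    have e : (fun t => ∫ u, Φ u ∂(a t)) = fun t =>
        (∫⁻ u, ENNReal.ofReal (Φ u) ∂(a t)).toReal -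
          (∫⁻ u, ENNReal.ofReal (-Φ u) ∂(a t)).toReal := by
      ext t
      have := hp t
      exact integral_eq_lintegral_pos_part_sub_lintegral_neg_part (Φ.integrable (a t))
    rw [e]
    exact this.ennreal_toReal.sub h'.ennreal_toReal
  integrable := h2

theorem L1P.measurable_moment (ν : L1P T X) : Measurable fun t => ∫⁻ u, ‖u‖ₑ ∂(ν.meas t) :=
  (Measure.measurable_lintegral (by fun_prop)).comp ν.measurable_meas

variable [SecondCountableTopology X] [CompleteSpace X]

theorem L1P.edist_def (ν ν' : L1P T X) :
    edist ν ν' = ∫⁻ t, W₁ (ν.meas t) (ν'.meas t) ∂(lebT T) := rfl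

theorem L1P.measurable_W₁ (ν ν' : L1P T X) : Measurable fun t => W₁ (ν.meas t) (ν'.meas t) :=
  FilteringNS.measurable_W₁ ν.measurable_meas ν'.measurable_meas ν.moment ν'.moment

theorem W₁_dirac_zero_le (μ : Measure X) [IsProbabilityMeasure μ] :
    W₁ μ (Measure.dirac 0) ≤ ∫⁻ u, ‖u‖ₑ ∂μ := by
  have := W₁_map_map_le μ measurable_id (measurable_const (a := (0 : X)))
  simpa [Measure.map_const] using this

theorem W₁_ne_top {μ ν : Measure X} [IsProbabilityMeasure μ] [IsProbabilityMeasure ν]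
    (hμ : ∫⁻ u, ‖u‖ₑ ∂μ < ∞) (hν : ∫⁻ u, ‖u‖ₑ ∂ν < ∞) : W₁ μ ν ≠ ∞ := by
  refine ne_top_of_le_ne_top ?_ (W₁_triangle μ (Measure.dirac 0) ν)
  refine ENNReal.add_ne_top.2 ⟨ne_top_of_le_ne_top hμ.ne (W₁_dirac_zero_le μ), ?_⟩
  rw [W₁_comm]
  exact ne_top_of_le_ne_top hν.ne (W₁_dirac_zero_le ν)

open Classical in
/-- A family of measures at finite distance from an element of `L1P`, for almost every time the
`W₁`-limit of elements of `L1P`, defines an element of `L1P`. -/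
theorem L1P.exists_of_tendsto (a : ℕ → L1P T X) {𝒢 : Set (Time T)} (h𝒢 : MeasurableSet 𝒢)
    (b : Time T → Measure X) (hb : ∀ t ∈ 𝒢, IsProbabilityMeasure (b t))
    (h : ∀ t ∈ 𝒢, Tendsto (fun k => W₁ ((a k).meas t) (b t)) atTop (𝓝 0))
    (hfin : ∫⁻ t in 𝒢, W₁ (b t) ((a 0).meas t) ∂(lebT T) ≠ ∞) :
    ∃ ν : L1P T X, (∀ t ∈ 𝒢, ν.meas t = b t) ∧ ∀ t ∉ 𝒢, ν.meas t = Measure.dirac 0 := by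
  -- The Dirac mass at the origin is a filler with zero first moment, so integrability is only an
  -- issue on `𝒢`.
  set b' : Time T → Measure X := fun t => if t ∈ 𝒢 then b t else Measure.dirac 0 with hb'
  have hp : ∀ t, IsProbabilityMeasure (b' t) := by
    intro t
    by_cases ht : t ∈ 𝒢
    · simpa [hb', ht] using hb t ht
    · simp only [hb', ht, if_false]; infer_instance
  have hm : Measurable b' := by
    refine measurable_of_tendsto_W₁
      (a := fun k t => if t ∈ 𝒢 then (a k).meas t else Measure.dirac 0)
      (fun k => Measurable.ite h𝒢 (a k).measurable_meas measurable_const) fun t => ?_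
    by_cases ht : t ∈ 𝒢
    · simpa [hb', ht] using h t ht
    · simp [hb', ht, W₁_self]
  -- The integral bound gives finiteness only almost everywhere, while `L1P` demands finite moments
  -- at every time; comparison with one `a k` at distance less than one gives it on all of `𝒢`.
  have hW : ∀ t ∈ 𝒢, W₁ (b t) ((a 0).meas t) ≠ ∞ := by
    intro t ht
    have := hb t ht
    obtain ⟨k, hk⟩ := ((h t ht).eventually (gt_mem_nhds one_pos)).exists
    refine ne_top_of_le_ne_top ?_ (W₁_triangle (b t) ((a k).meas t) ((a 0).meas t))
    refine ENNReal.add_ne_top.2 ⟨?_, W₁_ne_top ((a k).moment t) ((a 0).moment t)⟩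
    rw [W₁_comm]
    exact (hk.trans ENNReal.one_lt_top).ne
  refine ⟨L1P.ofMeasurable b' hp hm (fun t => ?_) ?_, fun t ht => by simp [L1P.ofMeasurable, hb', ht],
    fun t ht => by simp [L1P.ofMeasurable, hb', ht]⟩
  · by_cases ht : t ∈ 𝒢
    · simp only [hb', ht, if_true]
      exact (lintegral_enorm_le_add_W₁ _ _).trans_lt
        (ENNReal.add_lt_top.2 ⟨(a 0).moment t, (hW t ht).lt_top⟩)
    · simp [hb', ht]
  · rw [← lintegral_add_compl _ h𝒢]
    refine ENNReal.add_lt_top.2 ⟨?_, ?_⟩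
    · calc ∫⁻ t in 𝒢, ∫⁻ u, ‖u‖ₑ ∂(b' t) ∂(lebT T)
          ≤ ∫⁻ t in 𝒢, (∫⁻ u, ‖u‖ₑ ∂((a 0).meas t) + W₁ (b t) ((a 0).meas t)) ∂(lebT T) := by
            refine setLIntegral_mono' h𝒢 fun t ht => ?_
            simp only [hb', ht, if_true]
            exact lintegral_enorm_le_add_W₁ _ _
        _ < ∞ := by
            rw [lintegral_add_left (a 0).measurable_moment]
            exact ENNReal.add_lt_top.2
              ⟨(setLIntegral_le_lintegral _ _).trans_lt (a 0).integrable, hfin.lt_top⟩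
    · have : ∫⁻ t in 𝒢ᶜ, ∫⁻ u, ‖u‖ₑ ∂(b' t) ∂(lebT T) = 0 := by
        rw [setLIntegral_congr_fun (g := fun _ => 0) h𝒢.compl fun t ht => ?_]
        · simp
        · have ht' : t ∉ 𝒢 := ht
          simp [hb', ht']
      simp [this]

/-- As for `L¹`: a sequence with geometrically small increments has, for almost every time, summable
`W₁`-increments, hence a `W₁`-limit at that time. The integrated tail bound gives convergence in
`L1P`. -/
instance : CompleteSpace (L1P T X) := by
  refine EMetric.complete_of_convergent_controlled_sequences (fun n => 2⁻¹ ^ n)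
    (fun n => ENNReal.pow_pos (by simp) n) fun a ha => ?_
  have hsum : ∫⁻ t, ∑' k, W₁ ((a k).meas t) ((a (k + 1)).meas t) ∂(lebT T) ≠ ∞ := by
    rw [lintegral_tsum fun k => ((a k).measurable_W₁ _).aemeasurable]
    refine ne_top_of_le_ne_top (b := ∑' k : ℕ, (2⁻¹ : ℝ≥0∞) ^ k) ?_
      (ENNReal.tsum_le_tsum fun k => (ha k k (k + 1) le_rfl (Nat.le_succ k)).le)
    rw [ENNReal.tsum_geometric]
    simp
  set 𝒢 : Set (Time T) := {t | ∑' k, W₁ ((a k).meas t) ((a (k + 1)).meas t) < ∞} with h𝒢def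
  have hm : Measurable fun t => ∑' k, W₁ ((a k).meas t) ((a (k + 1)).meas t) :=
    Measurable.tsum fun k => (a k).measurable_W₁ _
  have h𝒢 : MeasurableSet 𝒢 := measurableSet_lt hm measurable_const
  have hae : ∀ᵐ t ∂(lebT T), t ∈ 𝒢 := ae_lt_top hm hsum
  have hex : ∀ t, ∃ b : Measure X, t ∈ 𝒢 → IsProbabilityMeasure b ∧
      Tendsto (fun k => W₁ ((a k).meas t) b) atTop (𝓝 0) := by
    intro t
    by_cases ht : t ∈ 𝒢
    · obtain ⟨b, hb⟩ := exists_tendsto_W₁ (fun k => (a k).meas t) ht.ne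
      exact ⟨b, fun _ => hb⟩
    · exact ⟨0, fun h => absurd h ht⟩
  choose b hb using hex
  have hle : ∀ t ∈ 𝒢, ∀ k, W₁ ((a k).meas t) (b t) ≤
      ∑' j, W₁ ((a (j + k)).meas t) ((a (j + k + 1)).meas t) := by
    intro t ht k
    have := (hb t ht).1
    exact W₁_le_tsum_of_tendsto (μ := fun k => (a k).meas t) (hb t ht).2 k
  have hfin : ∫⁻ t in 𝒢, W₁ (b t) ((a 0).meas t) ∂(lebT T) ≠ ∞ := by
    refine ne_top_of_le_ne_top hsum (le_trans (setLIntegral_mono' h𝒢 fun t ht => ?_)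
      (setLIntegral_le_lintegral 𝒢 _))
    rw [W₁_comm]
    simpa using hle t ht 0
  obtain ⟨ν, hν, -⟩ := L1P.exists_of_tendsto a h𝒢 b (fun t ht => (hb t ht).1)
    (fun t ht => (hb t ht).2) hfin
  have hgeo : ∑' k : ℕ, (2⁻¹ : ℝ≥0∞) ^ k ≠ ∞ := by
    rw [ENNReal.tsum_geometric]
    simp
  refine ⟨ν, tendsto_iff_edist_tendsto_0.2 (tendsto_of_tendsto_of_tendsto_of_le_of_le
    tendsto_const_nhds (ENNReal.tendsto_sum_nat_add _ hgeo) (fun _ => zero_le) fun k => ?_)⟩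
  calc edist (a k) ν
      ≤ ∫⁻ t, ∑' j, W₁ ((a (j + k)).meas t) ((a (j + k + 1)).meas t) ∂(lebT T) := by
        refine lintegral_mono_ae ?_
        filter_upwards [hae] with t ht
        rw [hν t ht]
        exact hle t ht k
    _ = ∑' j, edist (a (j + k)) (a (j + k + 1)) :=
        lintegral_tsum fun j => ((a (j + k)).measurable_W₁ _).aemeasurable
    _ ≤ ∑' j, 2⁻¹ ^ (j + k) :=
        ENNReal.tsum_le_tsum fun j => (ha _ _ _ le_rfl (Nat.le_succ _)).le

end L1PCompleteness

/-! ### Fourier series on the torus and low-frequency projections. -/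

section Parseval

variable {n : ℕ}

/-- Normalized Haar measure on the torus of side length one. -/
def unitTorusMeasure (n : ℕ) : Measure (UnitAddTorus (Fin n)) :=
  Measure.pi fun _ => AddCircle.haarAddCircle

instance : IsProbabilityMeasure (unitTorusMeasure n) := by
  unfold unitTorusMeasure; infer_instance

theorem hasSum_sq_mFourierCoeff_memLp {g : UnitAddTorus (Fin n) → ℂ}
    (hg : MemLp g 2 (unitTorusMeasure n)) :
    HasSum (fun k : Fin n → ℤ => ‖∫ t, UnitAddTorus.mFourier (-k) t • g t ∂(unitTorusMeasure n)‖ ^ 2)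
      (∫ t, ‖g t‖ ^ 2 ∂(unitTorusMeasure n)) := by
  have h := UnitAddTorus.hasSum_sq_mFourierCoeff (d := Fin n) (hg.toLp g)
  have e1 : ∀ k : Fin n → ℤ, UnitAddTorus.mFourierCoeff (hg.toLp g) k =
      ∫ t, UnitAddTorus.mFourier (-k) t • g t ∂(unitTorusMeasure n) := fun k =>
    integral_congr_ae (hg.coeFn_toLp.mono fun t ht => by simp only [ht])
  have e2 : ∫ t, ‖hg.toLp g t‖ ^ 2 ∂(unitTorusMeasure n) =
      ∫ t, ‖g t‖ ^ 2 ∂(unitTorusMeasure n) :=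
    integral_congr_ae (hg.coeFn_toLp.mono fun t ht => by simp only [ht])
  rw [← e2]
  simp only [← e1]
  exact h

/-- The rescaling of the torus of side length one to the torus of side length `2π`. -/
def torusRescale (n : ℕ) : UnitAddTorus (Fin n) ≃ᵐ Torus n :=
  (Homeomorph.piCongrRight fun _ : Fin n => AddCircle.homeomorphAddCircle 1 (2 * Real.pi)
    one_ne_zero Real.two_pi_pos.ne').toMeasurableEquiv

theorem torusRescale_apply (x : UnitAddTorus (Fin n)) (j : Fin n) : torusRescale n x j =
    AddCircle.homeomorphAddCircle 1 (2 * Real.pi) one_ne_zero Real.two_pi_pos.ne' (x j) := rfl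

/-- The characters are normalized by the period, so rescaling the circle leaves the frequency
unchanged and Parseval's identity can be imported from the unit torus. -/
theorem fourier_homeomorphAddCircle (k : ℤ) (x : AddCircle (1 : ℝ)) :
    fourier k (AddCircle.homeomorphAddCircle 1 (2 * Real.pi) one_ne_zero Real.two_pi_pos.ne' x) =
      fourier k x := by
  induction x using QuotientAddGroup.induction_on with
  | H x =>
    rw [AddCircle.homeomorphAddCircle_apply_mk, fourier_coe_apply, fourier_coe_apply]
    congr 1
    have : (Real.pi : ℂ) ≠ 0 := by exact_mod_cast Real.pi_ne_zero
    push_cast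
    field_simp

/-- A continuous surjective homomorphism of compact groups carries normalized Haar measure to
normalized Haar measure. -/
theorem measurePreserving_homeomorphAddCircle :
    MeasurePreserving (AddCircle.homeomorphAddCircle 1 (2 * Real.pi) one_ne_zero
      Real.two_pi_pos.ne') AddCircle.haarAddCircle AddCircle.haarAddCircle := by
  exact AddMonoidHom.measurePreserving
    (f := (AddCircle.equivAddCircle 1 (2 * Real.pi) one_ne_zero Real.two_pi_pos.ne').toAddMonoidHom)
    (AddCircle.homeomorphAddCircle 1 (2 * Real.pi) one_ne_zero Real.two_pi_pos.ne').continuous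
    (AddCircle.equivAddCircle 1 (2 * Real.pi) one_ne_zero Real.two_pi_pos.ne').surjective
    (by simp)

theorem volume_torus_eq : (volume : Measure (Torus n)) =
    ENNReal.ofReal (2 * Real.pi) ^ n • Measure.pi fun _ => AddCircle.haarAddCircle := by
  refine Measure.pi_eq fun s hs => ?_
  rw [Measure.smul_apply, Measure.pi_pi]
  simp [AddCircle.volume_eq_smul_haarAddCircle, Finset.prod_mul_distrib]

theorem measurePreserving_torusRescale :
    MeasurePreserving (torusRescale n) (unitTorusMeasure n)
      (Measure.pi fun _ => AddCircle.haarAddCircle) :=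
  measurePreserving_pi _ _ fun _ => measurePreserving_homeomorphAddCircle

theorem integral_comp_torusRescale {E : Type*} [NormedAddCommGroup E] [NormedSpace ℝ E]
    (f : Torus n → E) : ∫ x, f (torusRescale n x) ∂(unitTorusMeasure n) =
      ((2 * Real.pi) ^ n)⁻¹ • ∫ x, f x := by
  rw [measurePreserving_torusRescale.integral_comp (torusRescale n).measurableEmbedding,
    volume_torus_eq, integral_smul_measure, smul_smul]
  have : ((2 * Real.pi) ^ n)⁻¹ * (ENNReal.ofReal (2 * Real.pi) ^ n).toReal = 1 := by
    rw [ENNReal.toReal_pow, ENNReal.toReal_ofReal Real.two_pi_pos.le]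
    exact inv_mul_cancel₀ (pow_pos Real.two_pi_pos n).ne'
  rw [this, one_smul]

theorem memLp_comp_torusRescale {f : Torus n → ℂ} (hf : MemLp f 2) :
    MemLp (fun x => f (torusRescale n x)) 2 (unitTorusMeasure n) := by
  have h : MemLp f 2 (Measure.pi fun _ => AddCircle.haarAddCircle) := by
    rw [volume_torus_eq] at hf
    refine hf.of_measure_le_smul (c := (ENNReal.ofReal (2 * Real.pi) ^ n)⁻¹) (by simp [Real.pi_pos]) ?_
    rw [smul_smul, ENNReal.inv_mul_cancel (by simp [Real.pi_pos]) (by finiteness), one_smul]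
  exact h.comp_measurePreserving measurePreserving_torusRescale

theorem L2x.memLp_apply (u : L2x n) (i : Fin n) : MemLp (fun x => ((u x i : ℝ) : ℂ)) 2 := by
  have h : MemLp (fun x => u x i) 2 := (Lp.memLp u).continuousLinearMap_comp
    (EuclideanSpace.proj (𝕜 := ℝ) i)
  exact h.ofReal

theorem fourierCoef_apply (u : L2x n) (k : Fin n → ℤ) (i : Fin n) : fourierCoef u k i =
    ∫ x, UnitAddTorus.mFourier (-k) x • ((u (torusRescale n x) i : ℝ) : ℂ)
      ∂(unitTorusMeasure n) := by
  have h := integral_comp_torusRescale (n := n)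
    (fun x => (∏ j, fourier (-(k j)) (x j)) * ((u x i : ℝ) : ℂ))
  simp only [torusRescale_apply, fourier_homeomorphAddCircle] at h
  rw [Complex.real_smul] at h
  push_cast at h
  exact h.symm

/-- Parseval's identity on `L²_x`. -/
theorem hasSum_sq_fourierCoef (u : L2x n) :
    HasSum (fun k => (2 * Real.pi) ^ n * ‖fourierCoef u k‖ ^ 2) (‖u‖ ^ 2) := by
  have h1 : ∀ i, HasSum (fun k => ‖fourierCoef u k i‖ ^ 2)
      (((2 * Real.pi) ^ n)⁻¹ * ∫ x, ‖u x i‖ ^ 2) := by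
    intro i
    have h := hasSum_sq_mFourierCoeff_memLp (memLp_comp_torusRescale (u.memLp_apply i))
    simp only [← fourierCoef_apply] at h
    have h' := integral_comp_torusRescale (fun x => ‖((u x i : ℝ) : ℂ)‖ ^ 2)
    rw [h'] at h
    simpa using h
  have h2 := (hasSum_sum fun i (_ : i ∈ Finset.univ) => h1 i).mul_left ((2 * Real.pi) ^ n)
  have e1 : ∀ k, ‖fourierCoef u k‖ ^ 2 = ∑ i, ‖fourierCoef u k i‖ ^ 2 := fun k =>
    EuclideanSpace.norm_sq_eq _
  have e2 : ‖u‖ ^ 2 = ∫ x, ∑ i, ‖u x i‖ ^ 2 := by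
    rw [← real_inner_self_eq_norm_sq, L2.inner_def]
    refine integral_congr_ae (Eventually.of_forall fun x => ?_)
    simp only [real_inner_self_eq_norm_sq]
    exact EuclideanSpace.norm_sq_eq _
  rw [← Finset.mul_sum, ← mul_assoc, mul_inv_cancel₀ (pow_pos Real.two_pi_pos n).ne', one_mul,
    ← integral_finsetSum] at h2
  · rw [e2]
    simpa only [e1] using h2
  · intro i _
    have := (u.memLp_apply i).integrable_norm_pow (by simp)
    simpa using this

theorem sq_norm_fourierCoef_le (u : L2x n) (k : Fin n → ℤ) :
    (2 * Real.pi) ^ n * ‖fourierCoef u k‖ ^ 2 ≤ ‖u‖ ^ 2 :=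
  le_hasSum (hasSum_sq_fourierCoef u) k fun _ _ => by positivity

theorem integrable_mFourier_mul (u : L2x n) (k : Fin n → ℤ) (i : Fin n) :
    Integrable (fun x => UnitAddTorus.mFourier (-k) x • ((u (torusRescale n x) i : ℝ) : ℂ))
      (unitTorusMeasure n) := by
  have h := (memLp_comp_torusRescale (u.memLp_apply i)).integrable (by norm_num)
  refine h.bdd_smul 1 (UnitAddTorus.mFourier (-k)).continuous.aestronglyMeasurable
    (Eventually.of_forall fun x => ?_)
  exact ((UnitAddTorus.mFourier (-k)).norm_coe_le_norm x).trans UnitAddTorus.mFourier_norm.le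

theorem ae_comp_torusRescale {p : Torus n → Prop} (h : ∀ᵐ x, p x) :
    ∀ᵐ x ∂(unitTorusMeasure n), p (torusRescale n x) := by
  refine measurePreserving_torusRescale.quasiMeasurePreserving.ae ?_
  rw [volume_torus_eq] at h
  rwa [ae_iff, Measure.smul_apply, smul_eq_mul, mul_eq_zero, or_iff_right] at h
  exact pow_ne_zero _ (by simp [Real.pi_pos])

/-- A Fourier coefficient as a continuous linear map. -/
def fourierCoefL (k : Fin n → ℤ) : L2x n →L[ℝ] EuclideanSpace ℂ (Fin n) :=
  LinearMap.mkContinuousOfExistsBound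
    { toFun := fun u => fourierCoef u k
      map_add' := fun u v => by
        ext i
        rw [PiLp.add_apply, fourierCoef_apply, fourierCoef_apply, fourierCoef_apply,
          ← integral_add (integrable_mFourier_mul u k i) (integrable_mFourier_mul v k i)]
        refine integral_congr_ae ((ae_comp_torusRescale (Lp.coeFn_add u v)).mono fun x hx => ?_)
        simp only [hx, Pi.add_apply, PiLp.add_apply, Complex.ofReal_add, smul_add]
      map_smul' := fun c u => by
        ext i
        rw [PiLp.smul_apply, fourierCoef_apply, fourierCoef_apply, RingHom.id_apply,
          ← integral_smul]
        refine integral_congr_ae ((ae_comp_torusRescale (Lp.coeFn_smul c u)).mono fun x hx => ?_)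
        simp only [hx, Pi.smul_apply, PiLp.smul_apply, smul_eq_mul, Complex.ofReal_mul,
          Complex.real_smul]
        ring }
    (by
      have hpos : (0 : ℝ) < (2 * Real.pi) ^ n := pow_pos Real.two_pi_pos n
      refine ⟨√(((2 * Real.pi) ^ n)⁻¹), fun u => ?_⟩
      change ‖fourierCoef u k‖ ≤ _
      rw [← Real.sqrt_sq (norm_nonneg u), ← Real.sqrt_mul (by positivity)]
      refine Real.le_sqrt_of_sq_le ?_
      rw [inv_mul_eq_div, le_div_iff₀' hpos]
      exact sq_norm_fourierCoef_le u k)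

theorem measurable_gradNormSq : Measurable (gradNormSq : L2x n → ℝ≥0∞) := by
  refine Measurable.tsum fun k => ?_
  have : Measurable fun u : L2x n => fourierCoef u k := (fourierCoefL k).continuous.measurable
  fun_prop

theorem waveSq_nonneg (k : Fin n → ℤ) : 0 ≤ waveSq k := Finset.sum_nonneg fun _ _ => sq_nonneg _

theorem finite_waveSq_le (r : ℝ) : {k : Fin n → ℤ | waveSq k ≤ r}.Finite := by
  refine (Set.finite_Icc (fun _ : Fin n => -⌈r⌉) (fun _ => ⌈r⌉)).subset fun k hk => ?_
  have h : ∀ j, |k j| ≤ ⌈r⌉ := by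
    intro j
    have h1 : ((k j : ℝ)) ^ 2 ≤ r :=
      (Finset.single_le_sum (f := fun j => ((k j : ℝ)) ^ 2) (fun _ _ => sq_nonneg _)
        (Finset.mem_univ j)).trans hk
    have h2 : (k j) ^ 2 ≤ ⌈r⌉ := by
      have := h1.trans (Int.le_ceil r)
      exact_mod_cast this
    refine le_trans ?_ h2
    rw [← sq_abs]
    -- For integers, `|k| ≤ |k|²`: either `k = 0` or `|k| ≥ 1`.
    nlinarith [abs_nonneg (k j), Int.one_le_abs (z := k j), eq_or_ne (k j) 0]
  exact ⟨fun j => (abs_le.1 (h j)).1, fun j => (abs_le.1 (h j)).2⟩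

/-- A single coefficient is at most the whole series, and at frequencies with `|k|² ≤ r` the weight
`(1 + |k|²)^(-L)` loses at most the factor `(1 + r)^L`. -/
theorem sq_norm_fourierCoef_le_sobolevNorm (L : ℝ) (hL : 0 < L) {r : ℝ} (hr : 0 ≤ r) (u : L2x n)
    {k : Fin n → ℤ} (hk : waveSq k ≤ r) :
    ‖fourierCoef u k‖ₑ ≤
      ENNReal.ofReal (√((1 + r) ^ L / (2 * Real.pi) ^ n)) * sobolevNorm (-L) u := by
  have hpos : (0 : ℝ) < (2 * Real.pi) ^ n := pow_pos Real.two_pi_pos n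
  have h1 : ENNReal.ofReal ((2 * Real.pi) ^ n * ((1 + waveSq k) ^ (-L) * ‖fourierCoef u k‖ ^ 2)) ≤
      sobolevNorm (-L) u ^ (2 : ℝ) := by
    rw [sobolevNorm, ← ENNReal.rpow_mul]
    norm_num
    exact ENNReal.le_tsum (f := fun k => ENNReal.ofReal ((2 * Real.pi) ^ n *
      ((1 + waveSq k) ^ (-L) * ‖fourierCoef u k‖ ^ 2))) k
  have hk0 := waveSq_nonneg k
  have h2 : ‖fourierCoef u k‖ ^ 2 ≤ (1 + r) ^ L / (2 * Real.pi) ^ n *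
      ((2 * Real.pi) ^ n * ((1 + waveSq k) ^ (-L) * ‖fourierCoef u k‖ ^ 2)) := by
    have e : (1 + r) ^ L / (2 * Real.pi) ^ n *
        ((2 * Real.pi) ^ n * ((1 + waveSq k) ^ (-L) * ‖fourierCoef u k‖ ^ 2)) =
        ((1 + r) ^ L * (1 + waveSq k) ^ (-L)) * ‖fourierCoef u k‖ ^ 2 := by
      field_simp
    rw [e]
    refine le_mul_of_one_le_left (sq_nonneg _) ?_
    rw [Real.rpow_neg (by linarith), ← div_eq_mul_inv,
      one_le_div (Real.rpow_pos_of_pos (by linarith) _)]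
    exact Real.rpow_le_rpow (by linarith) (by linarith) hL.le
  rw [← ENNReal.rpow_le_rpow_iff (z := 2) (by norm_num), ENNReal.mul_rpow_of_nonneg _ _ (by norm_num)]
  calc ‖fourierCoef u k‖ₑ ^ (2 : ℝ) = ENNReal.ofReal (‖fourierCoef u k‖ ^ 2) := by
        rw [← ofReal_norm, ENNReal.rpow_two, ENNReal.ofReal_pow (norm_nonneg _)]
    _ ≤ _ := ENNReal.ofReal_le_ofReal h2
    _ = ENNReal.ofReal (√((1 + r) ^ L / (2 * Real.pi) ^ n)) ^ (2 : ℝ) * ENNReal.ofReal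
          ((2 * Real.pi) ^ n * ((1 + waveSq k) ^ (-L) * ‖fourierCoef u k‖ ^ 2)) := by
        rw [ENNReal.ofReal_mul (by positivity), ENNReal.rpow_two,
          ← ENNReal.ofReal_pow (Real.sqrt_nonneg _), Real.sq_sqrt (by positivity)]
    _ ≤ _ := by gcongr

/-- Finite-rank projections approximate the identity on `H¹`, uniformly on bounded sets, and are
controlled by the negative Sobolev norms. -/
theorem exists_finiteRank_approx (n : ℕ) {ε : ℝ} (hε : 0 < ε) :
    ∃ P : L2x n →L[ℝ] L2x n, FiniteDimensional ℝ P.range ∧ (∀ v, ‖P v‖ ≤ ‖v‖) ∧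
      (∀ v, ENNReal.ofReal (‖v - P v‖ ^ 2) ≤ ENNReal.ofReal ε * gradNormSq v) ∧
      ∀ L > 0, ∃ C : ℝ≥0, ∀ v, ‖P v‖ₑ ≤ C * sobolevNorm (-L) v := by
  classical
  set A : Finset (Fin n → ℤ) := (finite_waveSq_le (n := n) ε⁻¹).toFinset with hA
  have hAmem : ∀ k, k ∈ A ↔ waveSq k ≤ ε⁻¹ := fun k => by simp [hA]
  set ι : L2x n →L[ℝ] (A → EuclideanSpace ℂ (Fin n)) :=
    ContinuousLinearMap.pi fun k => fourierCoefL (k : Fin n → ℤ) with hι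
  -- `K` consists of the fields without low frequencies, and `P` projects onto its orthogonal
  -- complement. The coefficient map is injective there, which makes the range finite-dimensional
  -- without synthesizing real fields from complex coefficients.
  set K : Submodule ℝ (L2x n) := ι.ker with hK
  have : CompleteSpace K := (ι.isClosed_ker).completeSpace_coe
  have hinj : Function.Injective (ι.toLinearMap.comp Kᗮ.subtype) := by
    rw [← LinearMap.ker_eq_bot, LinearMap.ker_eq_bot']
    rintro ⟨x, hx⟩ h
    have hxK : x ∈ K := h
    ext1
    exact (Submodule.mem_bot ℝ).1 (K.inf_orthogonal_eq_bot ▸ ⟨hxK, hx⟩)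
  have hfin : FiniteDimensional ℝ Kᗮ := FiniteDimensional.of_injective _ hinj
  set P : L2x n →L[ℝ] L2x n := Kᗮ.starProjection with hP
  have hPv : ∀ v, P v ∈ Kᗮ := fun v => Kᗮ.starProjection_apply_mem v
  have hsub : ∀ v, v - P v = K.starProjection v := fun v => by
    rw [hP, Submodule.starProjection_orthogonal_val, sub_sub_cancel]
  have hcoef : ∀ v, ι (P v) = ι v := by
    intro v
    have : ι (v - P v) = 0 := hsub v ▸ K.starProjection_apply_mem v
    rw [map_sub, sub_eq_zero] at this
    exact this.symm
  have hpyth : ∀ v, ‖v - P v‖ ^ 2 = ‖v‖ ^ 2 - ‖P v‖ ^ 2 := fun v => by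
    rw [hsub, Submodule.norm_sq_eq_add_norm_sq_starProjection v K, add_sub_cancel_right]
  refine ⟨P, ?_, fun v => Kᗮ.norm_starProjection_apply_le v, fun v => ?_, fun L hL => ?_⟩
  · refine Submodule.finiteDimensional_of_le (S₂ := Kᗮ) ?_
    rintro _ ⟨v, rfl⟩
    exact hPv v
  · have hpos : (0 : ℝ) < (2 * Real.pi) ^ n := pow_pos Real.two_pi_pos n
    set g : (Fin n → ℤ) → ℝ :=
      fun k => if k ∈ A then 0 else (2 * Real.pi) ^ n * ‖fourierCoef v k‖ ^ 2 with hg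
    have hg0 : ∀ k, 0 ≤ g k := fun k => by
      simp only [hg]; split_ifs <;> positivity
    have hgs : Summable g := by
      refine Summable.of_nonneg_of_le hg0 (fun k => ?_) (hasSum_sq_fourierCoef v).summable
      simp only [hg]; split_ifs
      · positivity
      · exact le_rfl
    -- By Pythagoras the error is a difference of two Parseval sums; the terms in `A` cancel because
    -- `P` keeps these coefficients, and elsewhere the subtracted terms are dropped.
    have h1 : ‖v - P v‖ ^ 2 ≤ ∑' k, g k := by
      rw [hpyth]
      refine hasSum_le (fun k => ?_) ((hasSum_sq_fourierCoef v).sub (hasSum_sq_fourierCoef (P v)))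
        hgs.hasSum
      simp only [hg]
      split_ifs with hk
      · have : fourierCoef (P v) k = fourierCoef v k := congrFun (hcoef v) ⟨k, hk⟩
        rw [this, sub_self]
      · exact sub_le_self _ (by positivity)
    refine (ENNReal.ofReal_le_ofReal h1).trans ?_
    rw [ENNReal.ofReal_tsum_of_nonneg hg0 hgs, gradNormSq, ← ENNReal.tsum_mul_left]
    refine ENNReal.tsum_le_tsum fun k => ?_
    rw [← ENNReal.ofReal_mul hε.le]
    refine ENNReal.ofReal_le_ofReal ?_
    have hk0 := waveSq_nonneg k
    simp only [hg]
    split_ifs with hk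
    · positivity
    · rw [hAmem, not_le] at hk
      have h2 : 1 ≤ ε * waveSq k := by
        have := mul_lt_mul_of_pos_left hk hε
        rw [mul_inv_cancel₀ hε.ne'] at this
        exact this.le
      calc (2 * Real.pi) ^ n * ‖fourierCoef v k‖ ^ 2
          ≤ (ε * waveSq k) * ((2 * Real.pi) ^ n * ‖fourierCoef v k‖ ^ 2) :=
            le_mul_of_one_le_left (by positivity) h2
        _ = _ := by ring
  -- An injective linear map on a finite-dimensional space is bounded below, so the low coefficients
  -- control `‖P v‖`.
  · obtain ⟨C, -, hC⟩ := LinearMap.exists_antilipschitzWith (ι.toLinearMap.comp Kᗮ.subtype)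
      (LinearMap.ker_eq_bot.2 hinj)
    refine ⟨C * Real.toNNReal (√((1 + ε⁻¹) ^ L / (2 * Real.pi) ^ n)), fun v => ?_⟩
    have h1 : ‖P v‖ₑ ≤ C * ‖ι v‖ₑ := by
      have := hC ⟨P v, hPv v⟩ 0
      rw [map_zero, edist_zero_right, edist_zero_right] at this
      rw [← hcoef v]
      exact this
    refine h1.trans ?_
    rw [ENNReal.coe_mul, mul_assoc]
    gcongr
    have h2 : ‖ι v‖ₑ = edist (ι v) 0 := (edist_zero_right _).symm
    rw [h2, edist_pi_le_iff]
    intro k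
    rw [Pi.zero_apply, edist_zero_right]
    exact sq_norm_fourierCoef_le_sobolevNorm L hL (inv_pos.2 hε).le v ((hAmem k).1 k.2)

end Parseval

/-! ### The weighted norms as Euclidean norms in other coordinates. -/

section GammaNorm

variable {d N : ℕ}

/-- Factor `Γ⁻¹ = Bᴴ B`; positive definiteness makes `B` injective, hence invertible. Norm
inequalities, continuity and compactness of balls are then inherited from the Euclidean norm. -/
theorem exists_gammaNorm_eq_norm {Γ : Matrix (Fin d) (Fin d) ℝ} (hΓ : Γ.PosDef) :
    ∃ A : EuclideanSpace ℝ (Fin d) ≃L[ℝ] EuclideanSpace ℝ (Fin d), ∀ y, gammaNorm Γ y = ‖A y‖ := by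
  have hinv := hΓ.inv
  obtain ⟨B, hB⟩ : ∃ B : Matrix (Fin d) (Fin d) ℝ, Γ⁻¹ = Bᴴ * B := by
    open scoped MatrixOrder in
    obtain ⟨B, hB⟩ := CStarAlgebra.nonneg_iff_eq_star_mul_self.mp hinv.posSemidef.nonneg
    exact ⟨B, hB⟩
  set f : EuclideanSpace ℝ (Fin d) →ₗ[ℝ] EuclideanSpace ℝ (Fin d) := Matrix.toEuclideanLin B with hf
  have hnorm : ∀ y, y.ofLp ⬝ᵥ (Γ⁻¹ *ᵥ y.ofLp) = ‖f y‖ ^ 2 := by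
    intro y
    rw [hB, ← Matrix.mulVec_mulVec, Matrix.conjTranspose_eq_transpose_of_trivial,
      Matrix.dotProduct_mulVec, Matrix.vecMul_transpose, EuclideanSpace.norm_sq_eq]
    simp [dotProduct, hf, sq, Matrix.toEuclideanLin]
  have hinj : Function.Injective f := by
    rw [← LinearMap.ker_eq_bot, LinearMap.ker_eq_bot']
    intro y hy
    by_contra hne
    have h1 := hinv.dotProduct_mulVec_pos (x := y.ofLp) (fun h => hne (by ext i; simp [h]))
    rw [star_trivial, hnorm, hy] at h1
    simp at h1
  refine ⟨(LinearEquiv.ofInjectiveEndo f hinj).toContinuousLinearEquiv, fun y => ?_⟩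
  rw [gammaNorm, hnorm, Real.sqrt_sq (norm_nonneg _)]
  rfl

theorem exists_gammaNormN_eq_norm {Γ : Matrix (Fin d) (Fin d) ℝ} (hΓ : Γ.PosDef) :
    ∃ A : (Fin N → EuclideanSpace ℝ (Fin d)) ≃L[ℝ]
      PiLp 2 (fun _ : Fin N => EuclideanSpace ℝ (Fin d)), ∀ y, gammaNormN Γ y = ‖A y‖ := by
  obtain ⟨A, hA⟩ := exists_gammaNorm_eq_norm hΓ
  refine ⟨(ContinuousLinearEquiv.piCongrRight fun _ : Fin N => A).trans
    (PiLp.continuousLinearEquiv 2 ℝ (fun _ : Fin N => EuclideanSpace ℝ (Fin d))).symm, fun y => ?_⟩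
  rw [gammaNormN, PiLp.norm_eq_of_L2]
  simp [hA]

theorem gammaNorm_nonneg (Γ : Matrix (Fin d) (Fin d) ℝ) (y : EuclideanSpace ℝ (Fin d)) :
    0 ≤ gammaNorm Γ y := Real.sqrt_nonneg _

theorem gammaNormN_nonneg (Γ : Matrix (Fin d) (Fin d) ℝ) (y : Fin N → EuclideanSpace ℝ (Fin d)) :
    0 ≤ gammaNormN Γ y := Real.sqrt_nonneg _

theorem gammaNorm_apply_le (Γ : Matrix (Fin d) (Fin d) ℝ) (y : Fin N → EuclideanSpace ℝ (Fin d))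
    (j : Fin N) : gammaNorm Γ (y j) ≤ gammaNormN Γ y :=
  Real.le_sqrt_of_sq_le (Finset.single_le_sum (f := fun j => gammaNorm Γ (y j) ^ 2)
    (fun _ _ => sq_nonneg _) (Finset.mem_univ j))

theorem continuous_gammaNormN {Γ : Matrix (Fin d) (Fin d) ℝ} (hΓ : Γ.PosDef) :
    Continuous (gammaNormN Γ : (Fin N → EuclideanSpace ℝ (Fin d)) → ℝ) := by
  obtain ⟨A, hA⟩ := exists_gammaNormN_eq_norm (N := N) hΓ
  rw [show (gammaNormN Γ : (Fin N → EuclideanSpace ℝ (Fin d)) → ℝ) = fun y => ‖A y‖ from funext hA]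
  fun_prop

theorem isCompact_gammaNormN_le {Γ : Matrix (Fin d) (Fin d) ℝ} (hΓ : Γ.PosDef) (R : ℝ) :
    IsCompact {y : Fin N → EuclideanSpace ℝ (Fin d) | gammaNormN Γ y ≤ R} := by
  obtain ⟨A, hA⟩ := exists_gammaNormN_eq_norm (N := N) hΓ
  have : {y | gammaNormN Γ y ≤ R} = A ⁻¹' Metric.closedBall 0 R := by
    ext y; simp [hA]
  rw [this, ← ContinuousLinearEquiv.coe_toHomeomorph, Homeomorph.isCompact_preimage]
  exact isCompact_closedBall 0 R

theorem IsNoiseDensity.continuous {Γ : Matrix (Fin d) (Fin d) ℝ} (hΓ : Γ.PosDef)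
    {ρ : EuclideanSpace ℝ (Fin d) → ℝ} (hρ : IsNoiseDensity Γ ρ) : Continuous ρ := by
  obtain ⟨A, hA⟩ := exists_gammaNorm_eq_norm hΓ
  obtain ⟨L, hL, h⟩ := hρ.lipschitz
  rw [continuous_iff_continuousAt]
  intro y
  rw [ContinuousAt, tendsto_iff_dist_tendsto_zero]
  have h0 : Tendsto (fun x => L * ‖A (x - y)‖) (𝓝 y) (𝓝 0) := by
    have : Continuous fun x => L * ‖A (x - y)‖ := by fun_prop
    simpa using this.tendsto y
  refine squeeze_zero (fun _ => dist_nonneg) (fun x => ?_) h0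
  rw [Real.dist_eq, ← hA]
  exact h x y

end GammaNorm

/-! ### Continuity of the observables and measurability along trajectories. -/

section Observables

variable {T : ℝ} {n d N : ℕ}

theorem lebT_univ : lebT T univ = ENNReal.ofReal T := by
  rw [lebT, Measure.comap_apply _ Subtype.val_injective
    (fun s hs => measurableSet_Icc.subtype_image hs) _ MeasurableSet.univ, image_univ,
    Subtype.range_coe, Real.volume_Icc, sub_zero]

theorem LipschitzObservables.norm_sub_le {t : Fin (N + 1) → ℝ}
    {G : Fin N → PathSpace T n → EuclideanSpace ℝ (Fin d)} {L : ℝ}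
    (hG : LipschitzObservables t G L) (j : Fin N) (u u' : PathSpace T n) :
    ‖G j u - G j u'‖ ≤ |L| * ‖u - u'‖ := by
  have hint : Integrable (fun s => ‖u s - u' s‖) (lebT T) :=
    ((L1.integrable_coeFn u).sub (L1.integrable_coeFn u')).norm
  have h1 : ∫ s, ‖u s - u' s‖ ∂(lebT T) = ‖u - u'‖ := by
    rw [L1.norm_eq_integral_norm]
    exact integral_congr_ae ((Lp.coeFn_sub u u').mono fun s hs => by
      simp only [hs, Pi.sub_apply])
  refine (hG j u u').trans ?_
  rw [← h1]
  refine mul_le_mul (le_abs_self L) (setIntegral_le_integral hint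
    (Eventually.of_forall fun _ => norm_nonneg _)) (integral_nonneg fun _ => norm_nonneg _)
    (abs_nonneg L)

theorem LipschitzObservables.continuous {t : Fin (N + 1) → ℝ}
    {G : Fin N → PathSpace T n → EuclideanSpace ℝ (Fin d)} {L : ℝ}
    (hG : LipschitzObservables t G L) (j : Fin N) : Continuous (G j) :=
  (LipschitzWith.of_dist_le_mul (K := |L|.toNNReal) fun u u' => by
    rw [dist_eq_norm, dist_eq_norm, Real.coe_toNNReal _ (abs_nonneg L)]
    exact hG.norm_sub_le j u u').continuous

/-- Where the trajectory is integrable, the distance is an integral over time of a jointly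
measurable function, so Tonelli applies; the set of integrable trajectories is measurable for the
same reason. -/
theorem measurable_edist_trajectory {S : Time T → L2x n → L2x n}
    (hS : Measurable fun p : Time T × L2x n => S p.1 p.2) (f : PathSpace T n) :
    Measurable fun u => edist (trajectory S u) f := by
  have hsec : ∀ u, Measurable fun s => S s u := fun u =>
    hS.comp (measurable_id.prodMk measurable_const)
  have hmem : ∀ u, MemLp (fun s => S s u) 1 (lebT T) ↔ ∫⁻ s, ‖S s u‖ₑ ∂(lebT T) < ∞ := by
    intro u
    rw [memLp_one_iff_integrable, Integrable, and_iff_right (hsec u).aestronglyMeasurable]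
    rfl
  have hm : MeasurableSet {u | ∫⁻ s, ‖S s u‖ₑ ∂(lebT T) < ∞} :=
    measurableSet_lt (Measurable.lintegral_prod_left' (f := fun p : Time T × L2x n => ‖S p.1 p.2‖ₑ)
      hS.enorm) measurable_const
  have hf : Measurable (f : Time T → L2x n) := (Lp.stronglyMeasurable f).measurable
  have hd : Measurable fun u => ∫⁻ s, edist (S s u) (f s) ∂(lebT T) :=
    Measurable.lintegral_prod_left' (f := fun p : Time T × L2x n => edist (S p.1 p.2) (f p.1))
      (hS.edist (hf.comp measurable_fst))
  classical
  have : (fun u => edist (trajectory S u) f) = fun u =>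
      if u ∈ {u | ∫⁻ s, ‖S s u‖ₑ ∂(lebT T) < ∞} then ∫⁻ s, edist (S s u) (f s) ∂(lebT T)
      else edist (0 : PathSpace T n) f := by
    ext u
    by_cases hu : MemLp (fun s => S s u) 1 (lebT T)
    · rw [if_pos (by exact (hmem u).1 hu), trajectory, dif_pos hu, Lp.edist_def,
        eLpNorm_one_eq_lintegral_enorm]
      refine lintegral_congr_ae (hu.coeFn_toLp.mono fun s hs => ?_)
      simp only [Pi.sub_apply, hs, edist_eq_enorm_sub]
    · rw [if_neg (by exact fun h => hu ((hmem u).2 h)), trajectory, dif_neg hu]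
  rw [this]
  exact Measurable.ite hm hd measurable_const

/-- `PathSpace` is separable, so every open set is a countable union of balls, and preimages of
balls are sublevel sets of the measurable distance functions above. -/
theorem measurable_comp_trajectory {S : Time T → L2x n → L2x n}
    (hS : Measurable fun p : Time T × L2x n => S p.1 p.2) {g : PathSpace T n → EuclideanSpace ℝ (Fin d)}
    (hg : Continuous g) : Measurable fun u => g (trajectory S u) := by
  borelize (PathSpace T n)
  refine hg.measurable.comp (measurable_of_isOpen fun U hU => ?_)
  have : Fact ((1 : ℝ≥0∞) ≠ ∞) := ⟨ENNReal.one_ne_top⟩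
  have : SecondCountableTopology (PathSpace T n) := Lp.SecondCountableTopology
  choose! r hr hrU using EMetric.isOpen_iff.1 hU
  obtain ⟨c, hc, hcU⟩ := TopologicalSpace.isOpen_iUnion_countable
    (fun x : U => Metric.eball (x : PathSpace T n) (r x)) fun _ => Metric.isOpen_eball
  have hU' : U = ⋃ x ∈ c, Metric.eball (x : PathSpace T n) (r x) := by
    rw [hcU]
    refine Subset.antisymm (fun x hx => ?_) (iUnion_subset fun x => hrU x x.2)
    exact mem_iUnion.2 ⟨⟨x, hx⟩, Metric.mem_eball_self (hr x hx)⟩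
  rw [hU']
  simp only [preimage_iUnion]
  refine MeasurableSet.biUnion hc fun p _ => ?_
  exact measurableSet_lt (measurable_edist_trajectory hS p) measurable_const

end Observables

/-! ### Uniform bounds on the likelihood. -/

section Likelihood

variable {T : ℝ} {n d N : ℕ}

/-- Replace one factor at a time; `1 ≤ B` lets every step be estimated with the full power of `B`.
-/
theorem abs_prod_sub_prod_le {ι : Type*} (s : Finset ι) {f g : ι → ℝ} {B δ : ℝ} (hB : 1 ≤ B)
    (hf : ∀ i ∈ s, |f i| ≤ B) (hg : ∀ i ∈ s, |g i| ≤ B) (hfg : ∀ i ∈ s, |f i - g i| ≤ δ)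
    (hδ : 0 ≤ δ) : |∏ i ∈ s, f i - ∏ i ∈ s, g i| ≤ s.card * B ^ s.card * δ := by
  classical
  induction s using Finset.induction_on with
  | empty => simp
  | insert a s ha ih =>
    have ih' := ih (fun i hi => hf i (Finset.mem_insert_of_mem hi))
      (fun i hi => hg i (Finset.mem_insert_of_mem hi))
      (fun i hi => hfg i (Finset.mem_insert_of_mem hi))
    have hgp : |∏ i ∈ s, g i| ≤ B ^ s.card := by
      rw [Finset.abs_prod, ← Finset.prod_const]
      exact Finset.prod_le_prod (fun _ _ => abs_nonneg _)
        fun i hi => hg i (Finset.mem_insert_of_mem hi)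
    rw [Finset.prod_insert ha, Finset.prod_insert ha, Finset.card_insert_of_notMem ha]
    have e : f a * ∏ i ∈ s, f i - g a * ∏ i ∈ s, g i =
        f a * (∏ i ∈ s, f i - ∏ i ∈ s, g i) + (f a - g a) * ∏ i ∈ s, g i := by ring
    have hfa := hf a (Finset.mem_insert_self a s)
    have hfga := hfg a (Finset.mem_insert_self a s)
    have hB0 : 0 ≤ B := zero_le_one.trans hB
    have hBs : B ^ s.card ≤ B ^ (s.card + 1) := pow_le_pow_right₀ hB (Nat.le_succ _)
    rw [e]
    calc _ ≤ |f a| * |∏ i ∈ s, f i - ∏ i ∈ s, g i| + |f a - g a| * |∏ i ∈ s, g i| := by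
          rw [← abs_mul, ← abs_mul]; exact abs_add_le _ _
      _ ≤ B * (s.card * B ^ s.card * δ) + δ * B ^ s.card := by gcongr
      _ ≤ B * (s.card * B ^ s.card * δ) + δ * B ^ (s.card + 1) := by gcongr
      _ = _ := by push_cast; ring

/-- The real-valued likelihood. -/
def realLikelihood (ρ : EuclideanSpace ℝ (Fin d) → ℝ) (t : Fin (N + 1) → ℝ)
    (G : Fin N → PathSpace T n → EuclideanSpace ℝ (Fin d)) (S : Time T → L2x n → L2x n)
    (y : Fin N → EuclideanSpace ℝ (Fin d)) (s : Time T) (u : L2x n) : ℝ :=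
  ∏ j with t (Fin.succ j) ≤ s, ρ (y j - G j (trajectory S u))

theorem norm_trajectory_le {S : Time T → L2x n → L2x n}
    (hS : Measurable fun p : Time T × L2x n => S p.1 p.2) (hT : 0 ≤ T) {u : L2x n} {M : ℝ}
    (hu : ∀ s, ‖S s u‖ ≤ M) : ‖trajectory S u‖ ≤ T * M := by
  have hm : Measurable fun s => S s u := hS.comp (measurable_id.prodMk measurable_const)
  have hmem : MemLp (fun s => S s u) 1 (lebT T) :=
    MemLp.of_bound hm.aestronglyMeasurable M (Eventually.of_forall hu)
  have e : ∫ s, ‖hmem.toLp _ s‖ ∂(lebT T) = ∫ s, ‖S s u‖ ∂(lebT T) :=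
    integral_congr_ae (hmem.coeFn_toLp.mono fun s hs => by simp only [hs])
  rw [trajectory, dif_pos hmem, L1.norm_eq_integral_norm, e]
  calc ∫ s, ‖S s u‖ ∂(lebT T) ≤ ∫ _s, M ∂(lebT T) :=
        integral_mono (hmem.integrable le_rfl).norm (integrable_const M) hu
    _ = T * M := by
        rw [integral_const, Measure.real, lebT_univ, ENNReal.toReal_ofReal hT, smul_eq_mul]

/-- Bounds on the likelihood, uniform in everything but the noise, the size of the measurements and
the size of the trajectories. -/
theorem exists_likelihood_bounds {Γ : Matrix (Fin d) (Fin d) ℝ} (hΓ : Γ.PosDef)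
    {ρ : EuclideanSpace ℝ (Fin d) → ℝ} (hρ : IsNoiseDensity Γ ρ) (hT : 0 < T) (N : ℕ) (L_G g₀ : ℝ) :
    ∃ (B ℓ : ℝ) (m : ℝ → ℝ → ℝ), 0 < B ∧ 0 < ℓ ∧ (∀ R M, 0 < m R M) ∧
      (∀ M, Continuous fun R => m R M) ∧ (∀ M, AntitoneOn (fun R => m R M) (Ici 0)) ∧
      ∀ (n : ℕ) (t : Fin (N + 1) → ℝ) (G : Fin N → PathSpace T n → EuclideanSpace ℝ (Fin d)),
        LipschitzObservables t G L_G → (∀ j, ‖G j 0‖ ≤ g₀) →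
      ∀ S : Time T → L2x n → L2x n, (Measurable fun p : Time T × L2x n => S p.1 p.2) →
      ∀ (s : Time T) (u : L2x n),
      (∀ y, 0 < realLikelihood ρ t G S y s u) ∧
      (∀ y, realLikelihood ρ t G S y s u ≤ B) ∧
      (∀ y y', |realLikelihood ρ t G S y s u - realLikelihood ρ t G S y' s u| ≤
        ℓ * gammaNormN Γ (y - y')) ∧
      ∀ R M, (∀ s, ‖S s u‖ ≤ M) → ∀ y, gammaNormN Γ y ≤ R → m R M ≤ realLikelihood ρ t G S y s u := by
  obtain ⟨A, hA⟩ := exists_gammaNorm_eq_norm hΓ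
  obtain ⟨L, hL, hLip⟩ := hρ.lipschitz
  obtain ⟨B₀, hB₀, hbd⟩ := hρ.bounded
  obtain ⟨c, hc, htail⟩ := hρ.tail
  -- A bound of at least one makes `B ^ N` dominate every product of at most `N` factors, whatever
  -- number of observations is available at the given time.
  set B := max B₀ 1 with hBdef
  have hB1 : 1 ≤ B := le_max_right _ _
  have hB0 : 0 < B := zero_lt_one.trans_le hB1
  have hρB : ∀ y, ρ y ≤ B := fun y => (hbd y).trans (le_max_left _ _)
  -- `a R M` bounds the weighted norm of the argument of `ρ`: the data contribute `R`, the
  -- observables their value at zero plus the Lipschitz constant times the `L¹` norm of the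
  -- trajectory. Absolute values make it nonnegative for all parameters.
  set a : ℝ → ℝ → ℝ := fun R M =>
    |R| + ‖(A : EuclideanSpace ℝ (Fin d) →L[ℝ] EuclideanSpace ℝ (Fin d))‖ *
      (|g₀| + |L_G| * (T * |M|)) with ha
  have ha0 : ∀ R M, 0 ≤ a R M := fun R M => by positivity
  -- Capping each factor at one makes the `N`-th power a lower bound for products with fewer
  -- factors.
  set m : ℝ → ℝ → ℝ := fun R M => (min (Real.exp (-(1 / 2) * a R M ^ 2) / c) 1) ^ N with hm
  have hm1 : ∀ R M, 0 < min (Real.exp (-(1 / 2) * a R M ^ 2) / c) 1 := fun R M =>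
    lt_min (by positivity) one_pos
  -- The added one keeps the Lipschitz constant positive even when `N = 0`.
  refine ⟨B ^ N, (N * B ^ N * L) + 1, m, by positivity, by positivity,
    fun R M => pow_pos (hm1 R M) N, fun M => ?_, fun M R hR R' hR' hRR' => ?_, ?_⟩
  · simp only [hm, ha]
    fun_prop
  · have hle : a R M ≤ a R' M := by
      simp only [ha, abs_of_nonneg (mem_Ici.1 hR), abs_of_nonneg (mem_Ici.1 hR')]
      gcongr
    have := ha0 R M
    simp only [hm]
    refine pow_le_pow_left₀ (hm1 _ _).le (min_le_min_right _ ?_) N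
    gcongr ?_ / c
    refine Real.exp_le_exp.2 ?_
    nlinarith [pow_le_pow_left₀ (ha0 R M) hle 2]
  · intro n t G hG hg S hS s u
    set J : Finset (Fin N) := Finset.univ.filter fun j => t (Fin.succ j) ≤ s with hJ
    have hcard : J.card ≤ N := (Finset.card_le_univ J).trans_eq (Fintype.card_fin N)
    have hlik : ∀ y, realLikelihood ρ t G S y s u = ∏ j ∈ J, ρ (y j - G j (trajectory S u)) :=
      fun _ => rfl
    refine ⟨fun y => Finset.prod_pos fun j _ => hρ.pos _, fun y => ?_, fun y y' => ?_,
      fun R M hu y hy => ?_⟩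
    · rw [hlik]
      calc _ ≤ ∏ _j ∈ J, B := Finset.prod_le_prod (fun j _ => (hρ.pos _).le) fun j _ => hρB _
        _ = B ^ J.card := by rw [Finset.prod_const]
        _ ≤ B ^ N := pow_le_pow_right₀ hB1 hcard
    · have h0 := gammaNormN_nonneg Γ (y - y')
      rw [hlik, hlik]
      refine (abs_prod_sub_prod_le J (B := B) (δ := L * gammaNormN Γ (y - y')) hB1 ?_ ?_ ?_
        (by positivity)).trans ?_
      · intro j _; rw [abs_of_pos (hρ.pos _)]; exact hρB _
      · intro j _; rw [abs_of_pos (hρ.pos _)]; exact hρB _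
      · intro j _
        refine (hLip _ _).trans ?_
        rw [sub_sub_sub_cancel_right]
        have := gammaNorm_apply_le Γ (y - y') j
        rw [Pi.sub_apply] at this
        gcongr
      · have h1 : (J.card : ℝ) * B ^ J.card ≤ N * B ^ N := by
          gcongr
        calc _ ≤ N * B ^ N * (L * gammaNormN Γ (y - y')) := by gcongr
          _ ≤ _ := by nlinarith
    · have hM : 0 ≤ M := (norm_nonneg _).trans (hu s)
      have hR : 0 ≤ R := (gammaNormN_nonneg Γ y).trans hy
      have hGb : ∀ j, ‖G j (trajectory S u)‖ ≤ |g₀| + |L_G| * (T * |M|) := by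
        intro j
        have h1 := hG.norm_sub_le j (trajectory S u) 0
        rw [sub_zero] at h1
        have h2 := norm_trajectory_le hS hT.le hu
        calc ‖G j (trajectory S u)‖ ≤ ‖G j 0‖ + ‖G j (trajectory S u) - G j 0‖ := by
              have := norm_add_le (G j 0) (G j (trajectory S u) - G j 0)
              rwa [add_sub_cancel] at this
          _ ≤ |g₀| + |L_G| * (T * M) := by
              gcongr
              · exact (hg j).trans (le_abs_self _)
              · exact h1.trans (by gcongr)
          _ = _ := by rw [abs_of_nonneg hM]
      have hfac : ∀ j, min (Real.exp (-(1 / 2) * a R M ^ 2) / c) 1 ≤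
          ρ (y j - G j (trajectory S u)) := by
        intro j
        refine (min_le_left _ _).trans (le_trans ?_ (htail _))
        have h1 : gammaNorm Γ (y j - G j (trajectory S u)) ≤ a R M := by
          rw [hA, map_sub]
          refine (norm_sub_le _ _).trans (add_le_add ?_ ?_)
          · rw [← hA, abs_of_nonneg hR]
            exact (gammaNorm_apply_le Γ y j).trans hy
          · exact (A : EuclideanSpace ℝ (Fin d) →L[ℝ] EuclideanSpace ℝ (Fin d)).le_opNorm_of_le
              (hGb j)
        gcongr ?_ / c
        refine Real.exp_le_exp.2 ?_
        nlinarith [pow_le_pow_left₀ (gammaNorm_nonneg Γ _) h1 2]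
      rw [hlik]
      calc m R M ≤ (min (Real.exp (-(1 / 2) * a R M ^ 2) / c) 1) ^ J.card :=
            pow_le_pow_of_le_one (hm1 R M).le (min_le_right _ _) hcard
        _ = ∏ _j ∈ J, min (Real.exp (-(1 / 2) * a R M ^ 2) / c) 1 := by rw [Finset.prod_const]
        _ ≤ _ := Finset.prod_le_prod (fun j _ => (hm1 R M).le) fun j _ => hfac j

theorem measurable_likelihood {Γ : Matrix (Fin d) (Fin d) ℝ} (hΓ : Γ.PosDef)
    {ρ : EuclideanSpace ℝ (Fin d) → ℝ} (hρ : IsNoiseDensity Γ ρ) {t : Fin (N + 1) → ℝ}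
    {G : Fin N → PathSpace T n → EuclideanSpace ℝ (Fin d)} {L_G : ℝ}
    (hG : LipschitzObservables t G L_G) {S : Time T → L2x n → L2x n}
    (hS : Measurable fun p : Time T × L2x n => S p.1 p.2) (y : Fin N → EuclideanSpace ℝ (Fin d)) :
    Measurable fun p : Time T × L2x n => likelihood ρ t G S y p.1 p.2 := by
  have hρc := (hρ.continuous hΓ).measurable
  simp only [likelihood, Finset.prod_filter]
  refine ENNReal.measurable_ofReal.comp (Finset.measurable_prod _ fun j _ => Measurable.ite ?_ ?_
    measurable_const)
  · exact measurableSet_le measurable_const (measurable_subtype_coe.comp measurable_fst)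
  · exact hρc.comp (measurable_const.sub
      ((measurable_comp_trajectory hS (hG.continuous j)).comp measurable_snd))

end Likelihood

/-! ### Stability of normalized reweightings. -/

section Reweighting

variable {X : Type*} [NormedAddCommGroup X] [MeasurableSpace X] [BorelSpace X]
  [SecondCountableTopology X]

/-- The probability measure with density proportional to `f` with respect to `μ`. -/
def reweight (μ : Measure X) (f : X → ℝ≥0∞) : Measure X := (∫⁻ u, f u ∂μ)⁻¹ • μ.withDensity f

theorem isProbabilityMeasure_reweight {μ : Measure X} {f : X → ℝ≥0∞}
    (h0 : ∫⁻ u, f u ∂μ ≠ 0) (h1 : ∫⁻ u, f u ∂μ ≠ ∞) : IsProbabilityMeasure (reweight μ f) := by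
  constructor
  rw [reweight, Measure.smul_apply, withDensity_apply _ MeasurableSet.univ, Measure.restrict_univ,
    smul_eq_mul, ENNReal.inv_mul_cancel h0 h1]

variable {μ : Measure X} [IsProbabilityMeasure μ] {f f' : X → ℝ} {m B : ℝ}

theorem integrable_of_ae_bounds (hf : Measurable f) (hm : 0 < m)
    (hfm : ∀ᵐ u ∂μ, m ≤ f u) (hfB : ∀ᵐ u ∂μ, f u ≤ B) : Integrable f μ := by
  refine Integrable.of_bound hf.aestronglyMeasurable B ?_
  filter_upwards [hfm, hfB] with u h1 h2
  rwa [Real.norm_of_nonneg (hm.le.trans h1)]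

theorem le_integral_of_ae_bounds (hf : Measurable f) (hm : 0 < m)
    (hfm : ∀ᵐ u ∂μ, m ≤ f u) (hfB : ∀ᵐ u ∂μ, f u ≤ B) : m ≤ ∫ u, f u ∂μ := by
  have := integral_mono_ae (integrable_const m) (integrable_of_ae_bounds hf hm hfm hfB) hfm
  simpa using this

theorem lintegral_ofReal_eq_of_ae_bounds (hf : Measurable f) (hm : 0 < m)
    (hfm : ∀ᵐ u ∂μ, m ≤ f u) (hfB : ∀ᵐ u ∂μ, f u ≤ B) :
    ∫⁻ u, ENNReal.ofReal (f u) ∂μ = ENNReal.ofReal (∫ u, f u ∂μ) :=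
  (ofReal_integral_eq_lintegral_ofReal (integrable_of_ae_bounds hf hm hfm hfB)
    (hfm.mono fun _ h => hm.le.trans h)).symm

theorem isProbabilityMeasure_reweight_ofReal (hf : Measurable f) (hm : 0 < m)
    (hfm : ∀ᵐ u ∂μ, m ≤ f u) (hfB : ∀ᵐ u ∂μ, f u ≤ B) :
    IsProbabilityMeasure (reweight μ fun u => ENNReal.ofReal (f u)) := by
  have h := hm.trans_le (le_integral_of_ae_bounds hf hm hfm hfB)
  refine isProbabilityMeasure_reweight ?_ ?_ <;>
    rw [lintegral_ofReal_eq_of_ae_bounds hf hm hfm hfB]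
  · simpa using h
  · exact ENNReal.ofReal_ne_top

theorem reweight_ofReal_eq (hf : Measurable f) (hm : 0 < m)
    (hfm : ∀ᵐ u ∂μ, m ≤ f u) (hfB : ∀ᵐ u ∂μ, f u ≤ B) :
    reweight μ (fun u => ENNReal.ofReal (f u)) =
      μ.withDensity fun u => ENNReal.ofReal (f u / ∫ v, f v ∂μ) := by
  have h := hm.trans_le (le_integral_of_ae_bounds hf hm hfm hfB)
  rw [reweight, lintegral_ofReal_eq_of_ae_bounds hf hm hfm hfB, ← withDensity_smul _ (by fun_prop)]
  congr 1
  ext u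
  rw [Pi.smul_apply, smul_eq_mul, ← ENNReal.ofReal_inv_of_pos h,
    ← ENNReal.ofReal_mul (inv_nonneg.2 h.le), inv_mul_eq_div]

/-- The weight is at most `B` and its integral at least `m`. This domination transfers null sets and
expectation bounds from the prior to all posteriors at once. -/
theorem reweight_ofReal_le (hf : Measurable f) (hm : 0 < m)
    (hfm : ∀ᵐ u ∂μ, m ≤ f u) (hfB : ∀ᵐ u ∂μ, f u ≤ B) :
    reweight μ (fun u => ENNReal.ofReal (f u)) ≤ ENNReal.ofReal (B / m) • μ := by
  have h := le_integral_of_ae_bounds hf hm hfm hfB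
  rw [reweight_ofReal_eq hf hm hfm hfB, ← withDensity_const]
  refine withDensity_mono ?_
  filter_upwards [hfm, hfB] with u h1 h2
  refine ENNReal.ofReal_le_ofReal (div_le_div₀ ?_ h2 hm h)
  exact hm.le.trans (h1.trans h2)

/-- Stability of reweighted measures: the total variation, hence also the Wasserstein distance of
push-forwards under bounded maps, is controlled by the uniform distance of the weights. -/
theorem W₁_map_reweight_le (hf : Measurable f) (hf' : Measurable f') (hm : 0 < m)
    (hfm : ∀ᵐ u ∂μ, m ≤ f u) (hfB : ∀ᵐ u ∂μ, f u ≤ B)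
    (hfm' : ∀ᵐ u ∂μ, m ≤ f' u) (hfB' : ∀ᵐ u ∂μ, f' u ≤ B)
    {δ : ℝ} (hδ : 0 ≤ δ) (hff : ∀ᵐ u ∂μ, |f u - f' u| ≤ δ) {S : X → X} (hS : Measurable S)
    {M : ℝ} (hSM : ∀ᵐ u ∂μ, ‖S u‖ ≤ M) :
    W₁ ((reweight μ fun u => ENNReal.ofReal (f u)).map S)
      ((reweight μ fun u => ENNReal.ofReal (f' u)).map S) ≤
      ENNReal.ofReal (2 * M * ((1 / m + B / m ^ 2) * δ)) := by
  have hM : 0 ≤ M := by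
    obtain ⟨u, hu⟩ := hSM.exists
    exact (norm_nonneg _).trans hu
  have hB : 0 ≤ B := by
    obtain ⟨u, h1, h2⟩ := (hfm.and hfB).exists
    exact hm.le.trans (h1.trans h2)
  have hp := isProbabilityMeasure_reweight_ofReal hf hm hfm hfB
  have hp' := isProbabilityMeasure_reweight_ofReal hf' hm hfm' hfB'
  have hz := le_integral_of_ae_bounds hf hm hfm hfB
  have hz' := le_integral_of_ae_bounds hf' hm hfm' hfB'
  have hzz : |(∫ u, f u ∂μ) - ∫ u, f' u ∂μ| ≤ δ := by
    rw [← integral_sub (integrable_of_ae_bounds hf hm hfm hfB)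
      (integrable_of_ae_bounds hf' hm hfm' hfB')]
    have := norm_integral_le_of_norm_le_const (μ := μ) (f := fun u => f u - f' u) (C := δ) hff
    simpa using this
  rw [reweight_ofReal_eq hf hm hfm hfB] at hp ⊢
  rw [reweight_ofReal_eq hf' hm hfm' hfB'] at hp' ⊢
  set z := ∫ u, f u ∂μ
  set z' := ∫ u, f' u ∂μ
  have hz0 : 0 < z := hm.trans_le hz
  have hz0' : 0 < z' := hm.trans_le hz'
  -- the common part and the two excess parts
  set κ := μ.withDensity fun u => ENNReal.ofReal (min (f u / z) (f' u / z')) with hκ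
  set p := μ.withDensity fun u => ENNReal.ofReal (f u / z - f' u / z') with hpdef
  set q := μ.withDensity fun u => ENNReal.ofReal (f' u / z' - f u / z) with hqdef
  have split : ∀ a b : ℝ, 0 ≤ a → 0 ≤ b →
      ENNReal.ofReal a = ENNReal.ofReal (min a b) + ENNReal.ofReal (a - b) := by
    intro a b ha hb
    rcases le_total a b with h | h
    · rw [min_eq_left h, ENNReal.ofReal_of_nonpos (sub_nonpos.2 h), add_zero]
    · rw [min_eq_right h, ← ENNReal.ofReal_add hb (sub_nonneg.2 h), add_sub_cancel]
  have e1 : (μ.withDensity fun u => ENNReal.ofReal (f u / z)) = κ + p := by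
    rw [hκ, hpdef, ← withDensity_add_left (by fun_prop)]
    refine withDensity_congr_ae ?_
    filter_upwards [hfm, hfm'] with u h1 h2
    exact split _ _ (div_nonneg (hm.le.trans h1) hz0.le) (div_nonneg (hm.le.trans h2) hz0'.le)
  have e2 : (μ.withDensity fun u => ENNReal.ofReal (f' u / z')) = κ + q := by
    rw [hκ, hqdef, ← withDensity_add_left (by fun_prop)]
    refine withDensity_congr_ae ?_
    filter_upwards [hfm, hfm'] with u h1 h2
    rw [Pi.add_apply, min_comm]
    exact split _ _ (div_nonneg (hm.le.trans h2) hz0'.le) (div_nonneg (hm.le.trans h1) hz0.le)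
  rw [e1] at hp ⊢
  rw [e2] at hp' ⊢
  have hκf : IsFiniteMeasure κ :=
    ⟨(Measure.le_add_right (le_refl κ) univ).trans_lt (measure_lt_top (κ + p) univ)⟩
  have hpf : IsFiniteMeasure p :=
    ⟨(Measure.le_add_left (le_refl p) univ).trans_lt (measure_lt_top (κ + p) univ)⟩
  have hqf : IsFiniteMeasure q :=
    ⟨(Measure.le_add_left (le_refl q) univ).trans_lt (measure_lt_top (κ + q) univ)⟩
  have hpq : p univ = q univ := by
    have h1 := hp.measure_univ
    have h2 := hp'.measure_univ
    rw [Measure.add_apply] at h1 h2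
    exact (ENNReal.add_right_inj (measure_ne_top κ univ)).1 (h1.trans h2.symm)
  have hq : q univ ≤ ENNReal.ofReal ((1 / m + B / m ^ 2) * δ) := by
    rw [hqdef, withDensity_apply _ MeasurableSet.univ, Measure.restrict_univ]
    have : ∀ᵐ u ∂μ, ENNReal.ofReal (f' u / z' - f u / z) ≤
        ENNReal.ofReal ((1 / m + B / m ^ 2) * δ) := by
      filter_upwards [hfm, hfB, hff] with u h1 h2 h3
      refine ENNReal.ofReal_le_ofReal ?_
      -- The difference of densities splits into a change of weight, at most `δ / m`, and a change
      -- of normalization, at most `B δ / m²`.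
      have e : f' u / z' - f u / z = (f' u - f u) / z' + f u * (z - z') / (z' * z) := by
        field_simp
        ring
      rw [e, add_mul]
      refine add_le_add ?_ ?_
      · rw [one_div, inv_mul_eq_div]
        refine div_le_div₀ hδ ?_ hm hz'
        rw [abs_sub_comm] at h3
        exact (le_abs_self _).trans h3
      · rw [div_mul_eq_mul_div]
        refine div_le_div₀ (by positivity) ?_ (by positivity) ?_
        · exact (mul_le_mul_of_nonneg_left ((le_abs_self _).trans hzz) (hm.le.trans h1)).trans
            (mul_le_mul_of_nonneg_right h2 hδ)
        · rw [sq]; gcongr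
    refine (lintegral_mono_ae this).trans_eq (by simp)
  -- Whatever the density, the push-forward sits in the ball of radius `M`, so excess mass travels
  -- at most `2 * M`.
  have hac : ∀ {g : X → ℝ≥0∞}, ∀ᵐ x ∂((μ.withDensity g).map S), ‖x‖ ≤ M := fun {g} =>
    (ae_map_iff hS.aemeasurable (measurableSet_le measurable_norm measurable_const)).2
      ((withDensity_absolutelyContinuous μ g).ae_le hSM)
  rw [Measure.map_add _ _ hS, Measure.map_add _ _ hS]
  refine (W₁_add_le (κ.map S) (p.map S) (q.map S) ?_ (ENNReal.ofReal (2 * M)) ?_).trans ?_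
  · rw [Measure.map_apply hS MeasurableSet.univ, Measure.map_apply hS MeasurableSet.univ]
    exact hpq
  · filter_upwards [hac] with x hx
    filter_upwards [hac] with y hy
    rw [edist_dist, dist_eq_norm]
    refine ENNReal.ofReal_le_ofReal ((norm_sub_le x y).trans ?_)
    linarith
  · rw [Measure.map_apply hS MeasurableSet.univ, preimage_univ,
      ENNReal.ofReal_mul (p := 2 * M) (by positivity)]
    exact mul_le_mul' le_rfl hq

end Reweighting

/-! ### Domination, measurability and stability of the filtering distributions. -/

section Filtering

variable {T : ℝ} {n d N : ℕ}

/-- The filtering distributions are probability measures, uniformly dominated by the prior, depend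
measurably on time, and are stable in the measurements. -/
theorem exists_filtering_bounds {Γ : Matrix (Fin d) (Fin d) ℝ} (hΓ : Γ.PosDef)
    {ρ : EuclideanSpace ℝ (Fin d) → ℝ} (hρ : IsNoiseDensity Γ ρ) (hT : 0 < T) (N : ℕ) (L_G g₀ : ℝ) :
    ∃ C D : ℝ → ℝ → ℝ, (∀ R M, 0 < C R M) ∧ (∀ M, Continuous fun R => C R M) ∧
      (∀ M, MonotoneOn (fun R => C R M) (Ici 0)) ∧
      ∀ (n : ℕ) (t : Fin (N + 1) → ℝ) (G : Fin N → PathSpace T n → EuclideanSpace ℝ (Fin d)),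
        LipschitzObservables t G L_G → (∀ j, ‖G j 0‖ ≤ g₀) →
      ∀ (prior : Measure (L2x n)) [IsProbabilityMeasure prior] (M : ℝ) (S : Time T → L2x n → L2x n),
        (Measurable fun p : Time T × L2x n => S p.1 p.2) → (∀ᵐ u ∂prior, ∀ s, ‖S s u‖ ≤ M) →
      (∀ y s, IsProbabilityMeasure (posterior ρ t G S prior y s)) ∧
      (∀ R y s, gammaNormN Γ y ≤ R →
        posterior ρ t G S prior y s ≤ ENNReal.ofReal (D R M) • prior) ∧
      (∀ y, Measurable fun s => filtering ρ t G S prior y s) ∧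
      ∀ R y y' s, gammaNormN Γ y ≤ R → gammaNormN Γ y' ≤ R →
        W₁ (filtering ρ t G S prior y s) (filtering ρ t G S prior y' s) ≤
          ENNReal.ofReal (C R M * gammaNormN Γ (y - y')) := by
  obtain ⟨B, ℓ, m, hB, hℓ, hm, hmc, hma, hbd⟩ := exists_likelihood_bounds hΓ hρ hT N L_G g₀
  -- The first constant is the coefficient from `W₁_map_reweight_le` with `δ` proportional to the
  -- distance of the data, increased by one so that it is positive also for `M = 0`; the second is
  -- the domination constant.
  refine ⟨fun R M => 2 * |M| * ((1 / m R M + B / m R M ^ 2) * ℓ) + 1, fun R M => B / m R M,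
    fun R M => ?_, fun M => ?_, fun M R hR R' hR' hRR' => ?_, ?_⟩
  · have := hm R M
    positivity
  · have h0 : ∀ R, m R M ≠ 0 := fun R => (hm R M).ne'
    have h1 : ∀ R, m R M ^ 2 ≠ 0 := fun R => pow_ne_zero 2 (h0 R)
    have := hmc M
    fun_prop (disch := assumption)
  · have h1 : m R' M ≤ m R M := hma M hR hR' hRR'
    have := hm R' M
    dsimp only
    gcongr
  · intro n t G hG hg prior _ M S hS hSM
    have hmeas := measurable_likelihood hΓ hρ hG hS
    have hreal : ∀ y s, Measurable fun u => realLikelihood ρ t G S y s u := by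
      intro y s
      have h := ((hmeas y).comp (measurable_const (a := s) |>.prodMk measurable_id)).ennreal_toReal
      refine (congrArg Measurable (funext fun u => ?_)).mp h
      exact ENNReal.toReal_ofReal ((hbd n t G hG hg S hS s u).1 y).le
    have hlow : ∀ R y s, gammaNormN Γ y ≤ R →
        ∀ᵐ u ∂prior, m R M ≤ realLikelihood ρ t G S y s u := fun R y s hy =>
      hSM.mono fun u hu => (hbd n t G hG hg S hS s u).2.2.2 R M hu y hy
    have hup : ∀ y s, ∀ᵐ u ∂prior, realLikelihood ρ t G S y s u ≤ B := fun y s =>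
      Eventually.of_forall fun u => (hbd n t G hG hg S hS s u).2.1 y
    refine ⟨fun y s => ?_, fun R y s hy => ?_, fun y => ?_, fun R y y' s hy hy' => ?_⟩
    · exact isProbabilityMeasure_reweight_ofReal (hreal y s) (hm _ M) (hlow _ y s le_rfl) (hup y s)
    · exact reweight_ofReal_le (hreal y s) (hm R M) (hlow R y s hy) (hup y s)
    -- Time enters both the likelihood and the solution map; joint measurability makes numerator and
    -- normalization measurable in time.
    · refine Measure.measurable_of_measurable_coe _ fun A hA => ?_
      have e : ∀ s, filtering ρ t G S prior y s A = (∫⁻ u, likelihood ρ t G S y s u ∂prior)⁻¹ *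
          ∫⁻ u, (S s ⁻¹' A).indicator (likelihood ρ t G S y s) u ∂prior := by
        intro s
        have hSs : Measurable (S s) := hS.comp (measurable_const.prodMk measurable_id)
        rw [filtering, Measure.map_apply hSs hA, posterior, Measure.smul_apply,
          withDensity_apply _ (hSs hA), lintegral_indicator (hSs hA), smul_eq_mul]
      simp only [e]
      refine ((hmeas y).lintegral_prod_right').inv.mul ?_
      exact Measurable.lintegral_prod_right'
        (f := ((fun p : Time T × L2x n => S p.1 p.2) ⁻¹' A).indicator
          fun p : Time T × L2x n => likelihood ρ t G S y p.1 p.2) ((hmeas y).indicator (hS hA))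
    · have hSs : Measurable (S s) := hS.comp (measurable_const.prodMk measurable_id)
      refine (W₁_map_reweight_le (hreal y s) (hreal y' s) (hm R M) (hlow R y s hy) (hup y s)
        (hlow R y' s hy') (hup y' s) (δ := ℓ * gammaNormN Γ (y - y'))
        (mul_nonneg hℓ.le (gammaNormN_nonneg _ _))
        (Eventually.of_forall fun u => (hbd n t G hG hg S hS s u).2.2.1 y y') hSs
        (hSM.mono fun u hu => hu s)).trans ?_
      refine ENNReal.ofReal_le_ofReal ?_
      have h0 := gammaNormN_nonneg Γ (y - y')
      have hm0 := hm R M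
      have h1 : 2 * M * ((1 / m R M + B / m R M ^ 2) * ℓ) ≤
          2 * |M| * ((1 / m R M + B / m R M ^ 2) * ℓ) := by
        gcongr
        exact le_abs_self M
      calc _ = 2 * M * ((1 / m R M + B / m R M ^ 2) * ℓ) * gammaNormN Γ (y - y') := by ring
        _ ≤ _ := by
          gcongr
          linarith

end Filtering

/-! ### Finite `W₁`-nets for measures on compact sets. -/

section FiniteNets

variable {X : Type*} [NormedAddCommGroup X] [MeasurableSpace X] [BorelSpace X]
  [SecondCountableTopology X] [CompleteSpace X]

/-- The nearest-point map takes only finitely many values; the weights are the masses of the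
corresponding cells. Measures on a compact set are thereby approximated by points of a simplex. -/
theorem map_nearestPt_eq_atomic (e : ℕ → X) (m : ℕ) (μ : Measure X) [IsProbabilityMeasure μ] :
    ∃ w ∈ stdSimplex ℝ (Fin (m + 1)),
      μ.map (SimpleFunc.nearestPt e m) = atomic (fun i : Fin (m + 1) => e i) w := by
  set J : SimpleFunc X ℕ := SimpleFunc.nearestPtInd e m
  set P : SimpleFunc X X := SimpleFunc.nearestPt e m
  have hmap : μ.map P =
      atomic (fun i : Fin (m + 1) => e i) (fun i => μ.real (J ⁻¹' {(i : ℕ)})) := by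
    ext s hs
    rw [Measure.map_apply P.measurable hs]
    have hU : P ⁻¹' s = ⋃ i : Fin (m + 1), (J ⁻¹' {(i : ℕ)} ∩ {_x | e i ∈ s}) := by
      ext x
      simp only [mem_preimage, mem_iUnion, mem_inter_iff, mem_singleton_iff, mem_ofPred_eq]
      have hx : P x = e (J x) := rfl
      rw [hx]
      constructor
      · intro h
        exact ⟨⟨J x, Nat.lt_succ_of_le (SimpleFunc.nearestPtInd_le e m x)⟩, rfl, h⟩
      · rintro ⟨i, hi, h⟩
        rwa [hi]
    rw [hU, measure_iUnion]
    · simp only [atomic, Measure.coe_finsetSum, Finset.sum_apply, Measure.smul_apply,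
        tsum_fintype, smul_eq_mul, Measure.dirac_apply' _ hs]
      refine Finset.sum_congr rfl fun i _ => ?_
      rw [ofReal_measureReal]
      by_cases h : e i ∈ s <;> simp [h]
    · intro i j hij
      refine Disjoint.mono inter_subset_left inter_subset_left ?_
      rw [disjoint_left]
      rintro x (hx : J x = i) (hx' : J x = j)
      exact hij (Fin.ext (hx ▸ hx'))
    · intro i
      exact (J.measurableSet_preimage _).inter (MeasurableSet.const _)
  refine ⟨_, ⟨fun i => measureReal_nonneg, ?_⟩, hmap⟩
  have h1 : IsProbabilityMeasure (μ.map P) :=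
    Measure.isProbabilityMeasure_map P.measurable.aemeasurable
  have h2 := h1.measure_univ
  rw [hmap, atomic_univ, ← ENNReal.ofReal_sum_of_nonneg fun i _ => measureReal_nonneg] at h2
  simpa using h2

theorem lintegral_enorm_atomic_lt_top {m : ℕ} (e : Fin m → X) (w : Fin m → ℝ) :
    ∫⁻ u, ‖u‖ₑ ∂(atomic e w) < ∞ := by
  simp only [atomic, lintegral_finsetSum_measure, lintegral_smul_measure]
  refine ENNReal.sum_lt_top.2 fun i _ => ?_
  rw [lintegral_dirac]
  exact ENNReal.mul_lt_top ENNReal.ofReal_lt_top enorm_lt_top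

/-- The probability measures on a compact set are totally bounded with respect to `W₁`. -/
theorem exists_finite_W₁_net {K : Set X} (hK : IsCompact K) {ε : ℝ} (hε : 0 < ε) :
    ∃ Q : Set (Measure X), Q.Finite ∧
      (∀ q ∈ Q, IsProbabilityMeasure q ∧ ∫⁻ u, ‖u‖ₑ ∂q < ∞) ∧
      ∀ μ : Measure X, IsProbabilityMeasure μ → (∀ᵐ u ∂μ, u ∈ K) →
        ∃ q ∈ Q, W₁ μ q ≤ ENNReal.ofReal ε := by
  set e : ℕ → X := TopologicalSpace.denseSeq X
  have hε2 : (0 : ℝ≥0∞) < ENNReal.ofReal (ε / 2) := by simpa using hε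
  obtain ⟨I, hI⟩ := hK.elim_finite_subcover (fun i => Metric.eball (e i) (ENNReal.ofReal (ε / 2)))
    (fun _ => Metric.isOpen_eball) fun x _ => by
      obtain ⟨_, ⟨i, rfl⟩, hi⟩ := EMetric.mem_closure_iff.1
        (TopologicalSpace.denseRange_denseSeq X x) _ hε2
      exact mem_iUnion.2 ⟨i, hi⟩
  -- The nearest-point map searches all indices up to `m`, which includes the centers of the finite
  -- subcover.
  set m := I.sup id
  have hnear : ∀ x ∈ K, edist x (SimpleFunc.nearestPt e m x) ≤ ENNReal.ofReal (ε / 2) := by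
    intro x hx
    obtain ⟨i, hi, hxi⟩ := mem_iUnion₂.1 (hI hx)
    rw [edist_comm]
    refine (SimpleFunc.edist_nearestPt_le e x (Finset.le_sup (f := id) hi)).trans ?_
    rw [edist_comm]
    exact (Metric.mem_eball.1 hxi).le
  set D : ℝ := ∑ i : Fin (m + 1), ∑ j : Fin (m + 1), dist (e i) (e j) with hDdef
  have hD0 : 0 ≤ D := Finset.sum_nonneg fun _ _ => Finset.sum_nonneg fun _ _ => dist_nonneg
  have hD : ∀ i j : Fin (m + 1), edist (e i) (e j) ≤ ENNReal.ofReal D := by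
    intro i j
    rw [edist_dist]
    refine ENNReal.ofReal_le_ofReal ?_
    exact (Finset.single_le_sum (f := fun j : Fin (m + 1) => dist (e i) (e j))
        (fun _ _ => dist_nonneg) (Finset.mem_univ j)).trans
        (Finset.single_le_sum (f := fun i : Fin (m + 1) => ∑ j : Fin (m + 1), dist (e i) (e j))
        (fun _ _ => Finset.sum_nonneg fun _ _ => dist_nonneg) (Finset.mem_univ i))
  -- Weights at distance `η` give atomic measures at `W₁`-distance at most `D * (m + 1) * η ≤ ε /
  -- 2`; the added one keeps the denominator positive.
  set η : ℝ := ε / 2 / (D * (m + 1) + 1) with hη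
  have hη0 : 0 < η := by positivity
  obtain ⟨W, hWs, hWfin, hW⟩ := (isCompact_stdSimplex ℝ (Fin (m + 1))).finite_cover_balls hη0
  refine ⟨atomic (fun i : Fin (m + 1) => e i) '' W, hWfin.image _, ?_, fun μ hμ hμK => ?_⟩
  · rintro _ ⟨w, hw, rfl⟩
    exact ⟨isProbabilityMeasure_atomic _ (hWs hw), lintegral_enorm_atomic_lt_top _ _⟩
  · obtain ⟨w, hw, hmap⟩ := map_nearestPt_eq_atomic e m μ
    obtain ⟨w', hw', hww'⟩ := mem_iUnion₂.1 (hW hw)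
    refine ⟨_, mem_image_of_mem _ hw', ?_⟩
    have hpw := isProbabilityMeasure_atomic (fun i : Fin (m + 1) => e i) hw
    calc W₁ μ (atomic (fun i : Fin (m + 1) => e i) w')
        ≤ W₁ μ (μ.map (SimpleFunc.nearestPt e m)) +
          W₁ (atomic (fun i : Fin (m + 1) => e i) w) (atomic (fun i : Fin (m + 1) => e i) w') := by
          rw [hmap]; exact W₁_triangle _ _ _
      _ ≤ ENNReal.ofReal (ε / 2) + ENNReal.ofReal (ε / 2) := by
          refine add_le_add ?_ ?_
          · refine (W₁_map_le μ (SimpleFunc.nearestPt e m).measurable).trans ?_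
            refine (lintegral_mono_ae (hμK.mono hnear)).trans_eq (by simp)
          · refine (W₁_atomic_le _ _ hD hw (hWs hw')).trans ?_
            rw [edist_dist, ← ENNReal.ofReal_natCast, ← ENNReal.ofReal_mul hD0,
              ← ENNReal.ofReal_mul (by positivity)]
            refine ENNReal.ofReal_le_ofReal ?_
            have h1 : dist w w' ≤ η := (Metric.mem_ball.1 hww').le
            have h2 : η * (D * (m + 1) + 1) = ε / 2 := div_mul_cancel₀ _ (by positivity)
            push_cast
            nlinarith [mul_le_mul_of_nonneg_left h1 (by positivity : 0 ≤ D * ((m : ℝ) + 1))]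
      _ = ENNReal.ofReal ε := by
          rw [← ENNReal.ofReal_add (by positivity) (by positivity), add_halves]

end FiniteNets

/-! ### Rounding times to a finite grid. -/

section TimeGrid

variable {T : ℝ} {N : ℕ}

/-- Times are rounded down to a finite grid containing the observation times. -/
theorem exists_time_grid (hT : 0 ≤ T) {t : Fin (N + 1) → ℝ} (ht0 : ∀ j, 0 ≤ t j) {h : ℝ}
    (hh : 0 < h) :
    ∃ τ : Time T → Time T, Measurable τ ∧ (range τ).Finite ∧ (∀ s : Time T, |(s : ℝ) - τ s| ≤ h) ∧
      ∀ (s : Time T) j, t j ≤ s ↔ t j ≤ τ s := by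
  classical
  set pr : ℝ → Time T := projIcc 0 T hT
  -- Multiples of `h` control the rounding error; the observation times are included so that
  -- rounding down never crosses one. Points outside `[0,T]` are clamped.
  set E : Finset (Time T) := (Finset.univ.image fun j => pr (t j)) ∪
    ((Finset.range (⌊T / h⌋₊ + 1)).image fun i : ℕ => pr (i * h)) with hE
  have hmem : ∀ s : Time T, pr (⌊(s : ℝ) / h⌋₊ * h) ∈ E.filter (· ≤ s) ∧
      (s : ℝ) - pr (⌊(s : ℝ) / h⌋₊ * h) ≤ h := by
    intro s
    have hs0 : 0 ≤ (s : ℝ) / h := div_nonneg s.2.1 hh.le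
    have h1 : (⌊(s : ℝ) / h⌋₊ : ℝ) * h ≤ s := by
      have := Nat.floor_le hs0
      rwa [le_div_iff₀ hh] at this
    have h2 : (s : ℝ) < (⌊(s : ℝ) / h⌋₊ + 1) * h := by
      have := Nat.lt_floor_add_one ((s : ℝ) / h)
      rwa [div_lt_iff₀ hh] at this
    have h3 : ((pr (⌊(s : ℝ) / h⌋₊ * h) : Time T) : ℝ) = ⌊(s : ℝ) / h⌋₊ * h := by
      simp only [pr, projIcc_of_mem hT (⟨by positivity, h1.trans s.2.2⟩ :
        (⌊(s : ℝ) / h⌋₊ : ℝ) * h ∈ Icc 0 T)]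
    refine ⟨Finset.mem_filter.2 ⟨Finset.mem_union_right _ (Finset.mem_image.2
      ⟨_, Finset.mem_range.2 (Nat.lt_succ_of_le (Nat.floor_le_floor ?_)), rfl⟩), ?_⟩, ?_⟩
    · have := s.2.2
      gcongr
    · rw [← Subtype.coe_le_coe, h3]; exact h1
    · rw [h3]; linarith
  have hne : ∀ s : Time T, (E.filter (· ≤ s)).Nonempty := fun s => ⟨_, (hmem s).1⟩
  set τ : Time T → Time T := fun s => (E.filter (· ≤ s)).max' (hne s) with hτ
  have hτmem : ∀ s, τ s ∈ E ∧ τ s ≤ s := fun s => Finset.mem_filter.1 (Finset.max'_mem _ (hne s))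
  have hτle : ∀ s, ∀ e ∈ E, e ≤ s → e ≤ τ s := fun s e he hes =>
    Finset.le_max' _ _ (Finset.mem_filter.2 ⟨he, hes⟩)
  refine ⟨τ, ?_, E.finite_toSet.subset (by rintro _ ⟨s, rfl⟩; exact (hτmem s).1), fun s => ?_,
    fun s j => ⟨fun hj => ?_, fun hj => hj.trans (hτmem s).2⟩⟩
  · refine Monotone.measurable fun s s' hss' => hτle _ _ (hτmem s).1 ((hτmem s).2.trans hss')
  · have h1 : (τ s : ℝ) ≤ s := (hτmem s).2
    have h2 : (pr (⌊(s : ℝ) / h⌋₊ * h) : ℝ) ≤ τ s := Finset.le_max' _ _ (hmem s).1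
    rw [abs_of_nonneg (sub_nonneg.2 h1)]
    linarith [(hmem s).2]
  · have h3 : ((pr (t j) : Time T) : ℝ) = t j := by
      simp only [pr, projIcc_of_mem hT (⟨ht0 j, hj.trans s.2.2⟩ : t j ∈ Icc 0 T)]
    rw [← h3]
    refine hτle s _ (Finset.mem_union_left _ (Finset.mem_image_of_mem _ (Finset.mem_univ j))) ?_
    rw [← Subtype.coe_le_coe, h3]
    exact hj

end TimeGrid

/-! ### Two preliminaries: a measure bound without measurability, and compact balls in finite rank.
-/

section Compactness

/-- Measurable sets on which an arbitrary real function is large have uniformly small measure. -/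
theorem exists_nat_measure_le_of_lt {X : Type*} [MeasurableSpace X] (μ : Measure X)
    [IsProbabilityMeasure μ] (c : X → ℝ) {η : ℝ≥0∞} (hη : 0 < η) :
    ∃ K : ℕ, ∀ B : Set X, MeasurableSet B → (∀ᵐ u ∂μ, u ∈ B → (K : ℝ) < c u) → μ B ≤ η := by
  set A : ℕ → Set X := fun K => {u | c u ≤ K} with hA
  have hmono : Monotone A := fun K K' h u (hu : c u ≤ K) => hu.trans (Nat.cast_le.2 h)
  have hU : ⋃ K, A K = univ := eq_univ_of_forall fun u => mem_iUnion.2 (exists_nat_ge (c u))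
  -- The function `c` is arbitrary, so the sets `A K` need not be measurable; continuity from below
  -- along an increasing sequence holds nevertheless.
  have hlim := tendsto_measure_iUnion_atTop (μ := μ) hmono
  rw [hU, measure_univ] at hlim
  obtain ⟨K, hK⟩ := (hlim.eventually (lt_mem_nhds
    (ENNReal.sub_lt_self ENNReal.one_ne_top one_ne_zero hη.ne'))).exists
  refine ⟨K, fun B hB h => ?_⟩
  -- Complements are taken only of the measurable set `B`.
  have h1 : μ (A K) ≤ μ Bᶜ := by
    refine measure_mono_ae ?_
    filter_upwards [h] with u hu hA hB'
    exact absurd (hu hB') (not_lt.2 hA)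
  have h2 : μ (A K) + μ B ≤ μ (A K) + η := by
    calc μ (A K) + μ B ≤ μ Bᶜ + μ B := by gcongr
      _ = 1 := by rw [add_comm, prob_add_prob_compl hB]
      _ ≤ _ := tsub_le_iff_right.1 hK.le
  exact (ENNReal.add_le_add_iff_left (measure_ne_top _ _)).1 h2

theorem isCompact_range_inter_closedBall {n : ℕ} (P : L2x n →L[ℝ] L2x n)
    (hP : FiniteDimensional ℝ P.range) (M : ℝ) :
    IsCompact {v : L2x n | v ∈ P.range ∧ ‖v‖ ≤ M} := by
  have : ProperSpace P.range := FiniteDimensional.proper ℝ _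
  have h := (isCompact_closedBall (0 : P.range) M).image continuous_subtype_val
  refine (congrArg IsCompact ?_).mp h
  ext v
  constructor
  · rintro ⟨w, hw, rfl⟩
    exact ⟨w.2, mem_closedBall_zero_iff.1 hw⟩
  · rintro ⟨hv, hvM⟩
    exact ⟨⟨v, hv⟩, mem_closedBall_zero_iff.2 hvM, rfl⟩

end Compactness

/-! ### Total boundedness of push-forwards for fixed data. -/

section FilteringNet

variable {T : ℝ} {n N : ℕ}

/-- The expected error of a finite-rank approximation of dissipative trajectories. -/
theorem lintegral_edist_finiteRank_le {S : Time T → L2x n → L2x n}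
    (hS : Measurable fun p : Time T × L2x n => S p.1 p.2) (prior : Measure (L2x n))
    [IsProbabilityMeasure prior] {E δ : ℝ} (hE : 0 ≤ E) (hδ : 0 < δ) (hT : 0 ≤ T)
    (hgrad : ∀ᵐ u ∂prior, ∫⁻ s, gradNormSq (S s u) ∂(lebT T) ≤ ENNReal.ofReal E)
    (P : L2x n →L[ℝ] L2x n)
    (hP : ∀ v, ENNReal.ofReal (‖v - P v‖ ^ 2) ≤ ENNReal.ofReal (δ ^ 2) * gradNormSq v) :
    ∫⁻ s, ∫⁻ u, edist (S s u) (P (S s u)) ∂prior ∂(lebT T) ≤ ENNReal.ofReal (δ * (T + E)) := by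
  have hpt : ∀ v, edist v (P v) ≤ ENNReal.ofReal δ + ENNReal.ofReal δ * gradNormSq v := by
    intro v
    -- Young's inequality trades the first power for the square that the gradient controls.
    have h1 : ‖v - P v‖ ≤ δ + δ⁻¹ * ‖v - P v‖ ^ 2 := by
      have h2 : δ * ‖v - P v‖ ≤ δ * (δ + δ⁻¹ * ‖v - P v‖ ^ 2) := by
        rw [mul_add, ← mul_assoc, mul_inv_cancel₀ hδ.ne']
        nlinarith [sq_nonneg (δ - ‖v - P v‖), mul_nonneg hδ.le (norm_nonneg (v - P v))]
      exact le_of_mul_le_mul_left h2 hδ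
    rw [edist_dist, dist_eq_norm]
    calc ENNReal.ofReal ‖v - P v‖ ≤ ENNReal.ofReal (δ + δ⁻¹ * ‖v - P v‖ ^ 2) :=
          ENNReal.ofReal_le_ofReal h1
      _ = ENNReal.ofReal δ + ENNReal.ofReal δ⁻¹ * ENNReal.ofReal (‖v - P v‖ ^ 2) := by
          rw [ENNReal.ofReal_add hδ.le (by positivity), ENNReal.ofReal_mul (by positivity)]
      _ ≤ ENNReal.ofReal δ + ENNReal.ofReal δ⁻¹ * (ENNReal.ofReal (δ ^ 2) * gradNormSq v) := by
          gcongr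
          exact hP v
      _ = _ := by
          rw [← mul_assoc, ← ENNReal.ofReal_mul (by positivity)]
          congr 3
          field_simp
  have hg : Measurable fun p : Time T × L2x n => gradNormSq (S p.1 p.2) :=
    measurable_gradNormSq.comp hS
  calc ∫⁻ s, ∫⁻ u, edist (S s u) (P (S s u)) ∂prior ∂(lebT T)
      ≤ ∫⁻ s, ∫⁻ u, (ENNReal.ofReal δ + ENNReal.ofReal δ * gradNormSq (S s u)) ∂prior ∂(lebT T) :=
        lintegral_mono fun s => lintegral_mono fun u => hpt _
    _ = ENNReal.ofReal δ * ENNReal.ofReal T +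
        ENNReal.ofReal δ * ∫⁻ s, ∫⁻ u, gradNormSq (S s u) ∂prior ∂(lebT T) := by
        simp only [lintegral_add_left measurable_const, lintegral_const, measure_univ, mul_one,
          lintegral_const_mul' _ _ ENNReal.ofReal_ne_top, lebT_univ]
    _ = ENNReal.ofReal δ * ENNReal.ofReal T +
        ENNReal.ofReal δ * ∫⁻ u, ∫⁻ s, gradNormSq (S s u) ∂(lebT T) ∂prior := by
        rw [lintegral_lintegral_swap hg.aemeasurable]
    _ ≤ ENNReal.ofReal δ * ENNReal.ofReal T + ENNReal.ofReal δ * ENNReal.ofReal E := by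
        gcongr
        exact (lintegral_mono_ae hgrad).trans_eq (by simp)
    _ = _ := by
        rw [← mul_add, ← ENNReal.ofReal_add hT hE, ← ENNReal.ofReal_mul hδ.le]

/-- The time oscillation of a finite-rank approximation of the trajectories is uniformly small in
expectation. -/
theorem exists_time_step {visc : ℝ} {S : Set.Ioi (0 : ℝ) → Time T → L2x n → L2x n}
    (hS : ApproxSolutionOperators visc S) (prior : Measure (L2x n)) [IsProbabilityMeasure prior]
    (hdiv : ∀ᵐ u ∂prior, DivFree u) {M : ℝ} (hM : ∀ᵐ u ∂prior, ‖u‖ ≤ M) {δ : ℝ} (hδ : 0 < δ)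
    (P : L2x n →L[ℝ] L2x n) (hPn : ∀ v, ‖P v‖ ≤ ‖v‖)
    (hP : ∀ L > 0, ∃ C : ℝ≥0, ∀ v, ‖P v‖ₑ ≤ C * sobolevNorm (-L) v) :
    ∃ h > 0, ∀ Δ (s s' : Time T), |(s : ℝ) - s'| ≤ h →
      ∫⁻ u, edist (P (S Δ s u)) (P (S Δ s' u)) ∂prior ≤ ENNReal.ofReal (δ * (1 + 2 * M)) := by
  obtain ⟨L, hL, c, hc⟩ := hS.timeRegularity
  obtain ⟨C, hC⟩ := hP L hL
  -- The time-regularity constant depends on `‖u‖` through an arbitrary function, which may be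
  -- unbounded on bounded sets; off an event of small prior measure it is at most `K`.
  obtain ⟨K, hK⟩ := exists_nat_measure_le_of_lt prior (fun u => c ‖u‖)
    (η := ENNReal.ofReal δ) (by simpa using hδ)
  have hM0 : 0 ≤ M := by
    obtain ⟨u, hu⟩ := hM.exists
    exact (norm_nonneg _).trans hu
  -- With this step the oscillation is at most `C * K * h ≤ δ` wherever `c ‖u‖ ≤ K`; on the
  -- remaining set only the energy bound `2 * M` is used.
  refine ⟨δ / (C * K + 1), by positivity, fun Δ s s' hss' => ?_⟩
  set g : L2x n → ℝ≥0∞ := fun u => edist (P (S Δ s u)) (P (S Δ s' u)) with hg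
  have hSs : ∀ s, Measurable (S Δ s) := fun s =>
    (hS.measurable Δ).comp (measurable_const.prodMk measurable_id)
  have hgm : Measurable g :=
    (P.continuous.measurable.comp (hSs s)).edist (P.continuous.measurable.comp (hSs s'))
  set B : Set (L2x n) := {u | ENNReal.ofReal δ < g u} with hB
  have hBm : MeasurableSet B := measurableSet_lt measurable_const hgm
  have hBle : prior B ≤ ENNReal.ofReal δ := by
    refine hK B hBm ?_
    filter_upwards [hdiv] with u hu huB
    by_contra hlt
    rw [not_lt] at hlt
    have huB' : ENNReal.ofReal δ < g u := huB
    refine absurd huB' (not_lt.2 ?_)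
    calc g u = ‖P (S Δ s u - S Δ s' u)‖ₑ := by rw [map_sub, ← edist_eq_enorm_sub]
      _ ≤ C * ENNReal.ofReal (c ‖u‖ * |(s : ℝ) - s'|) := (hC _).trans (by
          gcongr
          exact hc Δ u hu s s')
      _ ≤ ENNReal.ofReal C * ENNReal.ofReal (K * (δ / (C * K + 1))) := by
          rw [ENNReal.ofReal_coe_nnreal]
          gcongr
      _ ≤ ENNReal.ofReal δ := by
          rw [← ENNReal.ofReal_mul C.coe_nonneg]
          refine ENNReal.ofReal_le_ofReal ?_
          rw [← mul_assoc, mul_div_assoc', div_le_iff₀ (by positivity)]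
          nlinarith
  have hgle : ∀ᵐ u ∂prior, g u ≤ ENNReal.ofReal δ + B.indicator (fun _ => ENNReal.ofReal (2 * M)) u := by
    filter_upwards [hdiv, hM] with u hu huM
    by_cases huB : u ∈ B
    · rw [indicator_of_mem huB]
      refine le_add_left ?_
      change edist (P (S Δ s u)) (P (S Δ s' u)) ≤ _
      rw [edist_dist, dist_eq_norm]
      refine ENNReal.ofReal_le_ofReal ((norm_sub_le _ _).trans ?_)
      have h1 := (hPn (S Δ s u)).trans ((hS.energy Δ s u hu).trans huM)
      have h2 := (hPn (S Δ s' u)).trans ((hS.energy Δ s' u hu).trans huM)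
      linarith
    · exact le_add_right (not_lt.1 huB)
  refine (lintegral_mono_ae hgle).trans ?_
  rw [lintegral_add_left measurable_const, lintegral_indicator_const hBm, lintegral_const,
    measure_univ, mul_one]
  calc ENNReal.ofReal δ + ENNReal.ofReal (2 * M) * prior B
      ≤ ENNReal.ofReal δ + ENNReal.ofReal (2 * M) * ENNReal.ofReal δ := by gcongr
    _ = _ := by
        rw [← ENNReal.ofReal_mul (by positivity), ← ENNReal.ofReal_add hδ.le (by positivity)]
        congr 1
        ring

/-- Piecewise constant families with finitely many values. -/
theorem exists_L1P_comp {X : Type*} [NormedAddCommGroup X] [MeasurableSpace X] [BorelSpace X]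
    {τ : Time T → Time T} (hτ : Measurable τ) (hfin : (range τ).Finite)
    (w : range τ → Measure X)
    (hw : ∀ e, IsProbabilityMeasure (w e) ∧ ∫⁻ u, ‖u‖ₑ ∂(w e) < ∞) :
    ∃ q : L1P T X, ∀ s, q.meas s = w ⟨τ s, mem_range_self s⟩ := by
  have : Finite (range τ) := hfin
  have : Fintype (range τ) := Fintype.ofFinite _
  have hτ' : Measurable fun s => (⟨τ s, mem_range_self s⟩ : range τ) := hτ.subtype_mk
  have hwm : Measurable w := measurable_of_countable w
  refine ⟨L1P.ofMeasurable (fun s => w ⟨τ s, mem_range_self s⟩) (fun s => (hw _).1)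
    (hwm.comp hτ') (fun s => (hw _).2) ?_, fun s => rfl⟩
  calc ∫⁻ s, ∫⁻ u, ‖u‖ₑ ∂(w ⟨τ s, mem_range_self s⟩) ∂(lebT T)
      ≤ ∫⁻ _s, ∑ e, ∫⁻ u, ‖u‖ₑ ∂(w e) ∂(lebT T) := lintegral_mono fun s =>
        Finset.single_le_sum (f := fun e => ∫⁻ u, ‖u‖ₑ ∂(w e)) (fun _ _ => zero_le)
          (Finset.mem_univ _)
    _ < ∞ := by
        rw [lintegral_const]
        exact ENNReal.mul_lt_top (ENNReal.sum_lt_top.2 fun e _ => (hw e).2) (measure_lt_top _ _)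

/-- Push-forwards of measures dominated by the prior and piecewise constant in time form a totally
bounded family. -/
theorem exists_finite_pushforward_net (hT : 0 ≤ T) {visc : ℝ} (hvisc : 0 < visc)
    {S : Set.Ioi (0 : ℝ) → Time T → L2x n → L2x n} (hS : ApproxSolutionOperators visc S)
    (prior : Measure (L2x n)) [IsProbabilityMeasure prior] (hdiv : ∀ᵐ u ∂prior, DivFree u)
    {M : ℝ} (hM : ∀ᵐ u ∂prior, ‖u‖ ≤ M) {t : Fin (N + 1) → ℝ} (ht0 : ∀ j, 0 ≤ t j)
    (p : Set.Ioi (0 : ℝ) → Time T → Measure (L2x n)) (hp : ∀ Δ s, IsProbabilityMeasure (p Δ s))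
    (D : ℝ) (hD : ∀ Δ s, p Δ s ≤ ENNReal.ofReal D • prior)
    (hpt : ∀ Δ (s s' : Time T), (∀ j, t j ≤ s ↔ t j ≤ s') → p Δ s = p Δ s') {ε : ℝ} (hε : 0 < ε) :
    ∃ Q : Set (L1P T (L2x n)), Q.Finite ∧ ∀ Δ, ∃ q ∈ Q,
      ∫⁻ s, W₁ ((p Δ s).map (S Δ s)) (q.meas s) ∂(lebT T) ≤ ENNReal.ofReal ε := by
  have hM0 : 0 ≤ M := by
    obtain ⟨u, hu⟩ := hM.exists
    exact (norm_nonneg _).trans hu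
  set D' : ℝ := max D 0 with hD'
  have hD0 : 0 ≤ D' := le_max_right _ _
  set E : ℝ := visc⁻¹ * M ^ 2 with hE
  have hE0 : 0 ≤ E := by positivity
  -- `A` collects the coefficients of `δ` in the total error: projection, then time rounding and net
  -- approximation integrated over `[0,T]`. The last summand makes it positive.
  set A : ℝ := D' * (T + E) + (D' * (1 + 2 * M) + 1) * T + 1 with hA
  have hA0 : 0 < A := by positivity
  set δ : ℝ := ε / A with hδdef
  have hδ : 0 < δ := by positivity
  have hDle : ∀ Δ s (f : L2x n → ℝ≥0∞), ∫⁻ u, f u ∂(p Δ s) ≤ ENNReal.ofReal D' * ∫⁻ u, f u ∂prior := by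
    intro Δ s f
    refine (lintegral_mono' (hD Δ s) le_rfl).trans ?_
    rw [lintegral_smul_measure, smul_eq_mul]
    gcongr
    exact le_max_left _ _
  have hac : ∀ Δ s, p Δ s ≪ prior := fun Δ s =>
    (Measure.absolutelyContinuous_of_le (hD Δ s)).trans Measure.smul_absolutelyContinuous
  obtain ⟨P, hPfin, hPn, hPg, hPs⟩ := exists_finiteRank_approx n (ε := δ ^ 2) (by positivity)
  obtain ⟨h, hh, hstep⟩ := exists_time_step hS prior hdiv hM hδ P hPn hPs
  obtain ⟨τ, hτ, hτfin, hτh, hτt⟩ := exists_time_grid hT ht0 hh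
  obtain ⟨Q₀, hQ₀fin, hQ₀, hnet⟩ := exists_finite_W₁_net
    (isCompact_range_inter_closedBall P hPfin M) hδ
  have : Finite (range τ) := hτfin
  have : Finite Q₀ := hQ₀fin
  -- One candidate for each map from the grid to the net; there are finitely many.
  choose q hq using fun w : range τ → Q₀ => exists_L1P_comp hτ hτfin (fun e => (w e : Measure (L2x n)))
    fun e => hQ₀ _ (w e).2
  have hSs : ∀ Δ s, Measurable (S Δ s) := fun Δ s =>
    (hS.measurable Δ).comp (measurable_const.prodMk measurable_id)
  have hPm : Measurable P := P.continuous.measurable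
  have hPS : ∀ Δ s, Measurable fun u => P (S Δ s u) := fun Δ s => hPm.comp (hSs Δ s)
  refine ⟨range q, finite_range q, fun Δ => ?_⟩
  have hprob : ∀ s, IsProbabilityMeasure ((p Δ s).map (S Δ s)) := fun s =>
    Measure.isProbabilityMeasure_map (hSs Δ s).aemeasurable
  have hprob' : ∀ s s', IsProbabilityMeasure ((p Δ s').map fun u => P (S Δ s u)) := fun s s' =>
    Measure.isProbabilityMeasure_map (hPS Δ s).aemeasurable
  have hsel : ∀ e : range τ, ∃ q ∈ Q₀, W₁ ((p Δ e).map fun u => P (S Δ e u)) q ≤ ENNReal.ofReal δ := by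
    intro e
    refine hnet _ (hprob' e e) ?_
    refine (ae_map_iff (p := fun v => v ∈ {v : L2x n | v ∈ P.range ∧ ‖v‖ ≤ M})
      (hPS Δ e).aemeasurable
      (isCompact_range_inter_closedBall P hPfin M).isClosed.measurableSet).2 ?_
    refine (hac Δ e).ae_le ?_
    filter_upwards [hdiv, hM] with u hu huM
    exact ⟨⟨_, rfl⟩, (hPn _).trans ((hS.energy Δ e u hu).trans huM)⟩
  choose w hwQ hw using hsel
  refine ⟨q fun e => ⟨w e, hwQ e⟩, mem_range_self _, ?_⟩
  have hpoint : ∀ s, W₁ ((p Δ s).map (S Δ s)) ((q fun e => ⟨w e, hwQ e⟩).meas s) ≤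
      ENNReal.ofReal D' * ∫⁻ u, edist (S Δ s u) (P (S Δ s u)) ∂prior +
        ENNReal.ofReal (D' * (δ * (1 + 2 * M)) + δ) := by
    intro s
    -- Rounding preserves the set of past observation times, so only the solution map changes with
    -- time, not the posterior.
    have hps : p Δ (τ s) = p Δ s := hpt Δ _ _ fun j => (hτt s j).symm
    rw [hq]
    have := hprob' s s
    have := hprob' (τ s) s
    refine (W₁_triangle _ ((p Δ s).map fun u => P (S Δ s u)) _).trans ?_
    refine add_le_add ((W₁_map_map_le _ (hSs Δ s) (hPS Δ s)).trans (hDle _ _ _)) ?_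
    refine (W₁_triangle _ ((p Δ s).map fun u => P (S Δ (τ s) u)) _).trans ?_
    rw [ENNReal.ofReal_add (by positivity) hδ.le, ENNReal.ofReal_mul hD0]
    refine add_le_add ?_ ?_
    · refine (W₁_map_map_le _ (hPS Δ s) (hPS Δ (τ s))).trans ((hDle _ _ _).trans ?_)
      gcongr
      exact hstep Δ s (τ s) (hτh s)
    · rw [← hps]
      exact hw ⟨τ s, mem_range_self s⟩
  refine (lintegral_mono hpoint).trans ?_
  have hgrad : ∀ᵐ u ∂prior, ∫⁻ s, gradNormSq (S Δ s u) ∂(lebT T) ≤ ENNReal.ofReal E := by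
    filter_upwards [hdiv, hM] with u hu huM
    refine (hS.coercivity Δ u hu).trans (ENNReal.ofReal_le_ofReal ?_)
    rw [hE]
    gcongr
  have h1 := lintegral_edist_finiteRank_le (hS.measurable Δ) prior hE0 hδ hT hgrad P hPg
  rw [lintegral_add_right _ measurable_const, lintegral_const, lebT_univ,
    lintegral_const_mul' _ _ ENNReal.ofReal_ne_top]
  calc _ ≤ ENNReal.ofReal D' * ENNReal.ofReal (δ * (T + E)) +
        ENNReal.ofReal (D' * (δ * (1 + 2 * M)) + δ) * ENNReal.ofReal T := by gcongr
    _ = ENNReal.ofReal (D' * (δ * (T + E)) + (D' * (δ * (1 + 2 * M)) + δ) * T) := by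
        rw [← ENNReal.ofReal_mul hD0, ← ENNReal.ofReal_mul (by positivity),
          ← ENNReal.ofReal_add (by positivity) (by positivity)]
    _ ≤ ENNReal.ofReal ε := by
        refine ENNReal.ofReal_le_ofReal ?_
        have h2 : δ * A = ε := div_mul_cancel₀ _ hA0.ne'
        rw [← h2, hA]
        nlinarith

end FilteringNet

/-! ### An Arzelà–Ascoli theorem for compact convergence. -/

section Ascoli

/-- An equicontinuous and pointwise totally bounded family of continuous maps is relatively compact
for compact convergence. -/
theorem isCompact_closure_range_of_equicontinuous {ι Y Z : Type*} [TopologicalSpace Y]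
    [CompactlyCoherentSpace Y] [UniformSpace Z] [CompleteSpace Z] (F : ι → C(Y, Z))
    (hF : Equicontinuous fun i => (F i : Y → Z))
    (hb : ∀ y, TotallyBounded (range fun i => F i y)) : IsCompact (closure (range F)) := by
  -- With the uniformity pulled back along `F`, it suffices to show that the index set is totally
  -- bounded.
  let _ : UniformSpace ι := UniformSpace.comap F inferInstance
  have hFi : IsUniformInducing F := ⟨rfl⟩
  have hpi : IsUniformInducing fun i => (F i : Y → Z) := by
    -- On an equicontinuous family the uniformities of compact and of pointwise convergence
    -- coincide.
    rw [← EquicontinuousOn.isUniformInducing_uniformOnFun_iff_pi (𝔖 := {K | IsCompact K})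
      (eq_univ_iff_forall.2 fun y => ⟨{y}, isCompact_singleton, rfl⟩) (fun K hK => hK)
      fun K _ => hF.equicontinuousOn K]
    exact ContinuousMap.isUniformEmbedding_toUniformOnFunIsCompact.isUniformInducing.comp hFi
  have htb : TotallyBounded (univ : Set ι) := by
    refine totallyBounded_iff_ultrafilter.2 fun u _ => ?_
    rw [← hpi.cauchy_map_iff, cauchy_pi_iff']
    intro y
    refine totallyBounded_iff_ultrafilter.1 (hb y) (u.map fun i => F i y) ?_
    exact le_principal_iff.2 (Filter.mem_map.2 (univ_mem' fun i => mem_range_self i))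
  rw [← image_univ]
  exact (htb.image hFi.uniformContinuous).closure.isCompact_of_isClosed isClosed_closure

end Ascoli

/-! ### Passing stability estimates to limits in `L1P`. -/

section StableFamilies

variable {T : ℝ} {X : Type*} [NormedAddCommGroup X] [MeasurableSpace X] [BorelSpace X]
  [SecondCountableTopology X] [CompleteSpace X] {Y : Type*}

theorem L1P.equicontinuous_of_W₁_le {ι : Type*} [TopologicalSpace Y] {c : Y → Y → ℝ≥0∞}
    (hc : Continuous (Function.uncurry c)) (hc0 : ∀ y, c y y = 0) (F : ι → Y → L1P T X)
    (h : ∀ i y y' s, W₁ ((F i y).meas s) ((F i y').meas s) ≤ c y y') : Equicontinuous F := by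
  intro y U hU
  obtain ⟨ε, hε, hεU⟩ := mem_uniformity_edist.1 hU
  have h1 : Tendsto (fun y' => c y y' * lebT T univ) (𝓝 y) (𝓝 0) := by
    have h2 : Tendsto (fun y' => c y y') (𝓝 y) (𝓝 (c y y)) :=
      (hc.comp (Continuous.prodMk_right y)).tendsto y
    rw [hc0] at h2
    simpa using ENNReal.Tendsto.mul_const h2 (Or.inr (measure_ne_top (lebT T) univ))
  filter_upwards [h1.eventually (gt_mem_nhds hε)] with y' hy' i
  refine hεU (lt_of_le_of_lt ?_ hy')
  rw [L1P.edist_def]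
  exact (lintegral_mono fun s => h i y y' s).trans_eq (lintegral_const _)

/-- By the triangle inequality the excess of the limit distance over `c` integrates to at most the
distances of `a k` and `b k` to their limits, hence to zero. -/
theorem L1P.ae_W₁_le_of_tendsto {a b : ℕ → L1P T X} {ν ν' : L1P T X} {c : ℝ≥0∞}
    (ha : Tendsto a atTop (𝓝 ν)) (hb : Tendsto b atTop (𝓝 ν'))
    (h : ∀ k s, W₁ ((a k).meas s) ((b k).meas s) ≤ c) :
    ∀ᵐ s ∂(lebT T), W₁ (ν.meas s) (ν'.meas s) ≤ c := by
  have hle : ∀ k, ∫⁻ s, (W₁ (ν.meas s) (ν'.meas s) - c) ∂(lebT T) ≤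
      edist (a k) ν + edist (b k) ν' := by
    intro k
    rw [L1P.edist_def, L1P.edist_def, ← lintegral_add_left ((a k).measurable_W₁ ν)]
    refine lintegral_mono fun s => tsub_le_iff_right.2 ?_
    calc W₁ (ν.meas s) (ν'.meas s)
        ≤ W₁ (ν.meas s) ((a k).meas s) +
            (W₁ ((a k).meas s) ((b k).meas s) + W₁ ((b k).meas s) (ν'.meas s)) :=
          (W₁_triangle _ ((a k).meas s) _).trans
            (add_le_add le_rfl (W₁_triangle _ ((b k).meas s) _))
      _ ≤ W₁ ((a k).meas s) (ν.meas s) + (c + W₁ ((b k).meas s) (ν'.meas s)) := by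
          rw [W₁_comm (ν.meas s)]
          gcongr
          exact h k s
      _ = _ := by ring
  have h0 : ∫⁻ s, (W₁ (ν.meas s) (ν'.meas s) - c) ∂(lebT T) = 0 := by
    refine le_antisymm (ge_of_tendsto' (x := atTop) ?_ hle) bot_le
    simpa using (tendsto_iff_edist_tendsto_0.1 ha).add (tendsto_iff_edist_tendsto_0.1 hb)
  rw [lintegral_eq_zero_iff ((ν.measurable_W₁ ν').sub_const c)] at h0
  filter_upwards [h0] with s hs
  exact tsub_eq_zero_iff_le.1 hs

/-- In a separable space, a point can be approximated by points of the dense sequence with summable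
increments. -/
theorem exists_denseSeq_tendsto_summable [TopologicalSpace Y] [FirstCountableTopology Y]
    [TopologicalSpace.SeparableSpace Y] [Nonempty Y] {c : Y → Y → ℝ≥0∞}
    (hc : Continuous (Function.uncurry c)) (hc0 : ∀ y, c y y = 0) (y : Y) :
    ∃ q : ℕ → ℕ, Tendsto (fun k => TopologicalSpace.denseSeq Y (q k)) atTop (𝓝 y) ∧
      ∀ k, c (TopologicalSpace.denseSeq Y (q k)) (TopologicalSpace.denseSeq Y (q (k + 1))) ≤
        2⁻¹ ^ k := by
  obtain ⟨x, hx, hxy⟩ := mem_closure_iff_seq_limit.1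
    (TopologicalSpace.denseRange_denseSeq Y y)
  choose r hr using hx
  have hlim : Tendsto (fun p : ℕ × ℕ => c (x p.1) (x p.2)) atTop (𝓝 0) := by
    rw [← prod_atTop_atTop_eq]
    have h1 := (hc.tendsto (y, y)).comp
      ((hxy.comp tendsto_fst).prodMk_nhds (hxy.comp tendsto_snd))
    simp only [Function.uncurry_apply_pair, hc0] at h1
    exact h1
  -- Since the gauge vanishes on the diagonal and is continuous, it is small between all late terms;
  -- no triangle inequality for `c` is required.
  obtain ⟨φ, hφ, hφc⟩ := extraction_forall_of_eventually'
    (P := fun k j => ∀ l ≥ j, c (x j) (x l) ≤ 2⁻¹ ^ k) fun k => by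
      have := hlim.eventually (ge_mem_nhds (ENNReal.pow_pos (a := 2⁻¹) (by simp) k))
      obtain ⟨a, ha⟩ := eventually_atTop_prod_self'.1 this
      exact ⟨a, fun j hj l hl => ha j hj l (hj.le.trans hl)⟩
  refine ⟨fun k => r (φ k), ?_, fun k => ?_⟩
  · simp only [hr]
    exact hxy.comp hφ.tendsto_atTop
  · simp only [hr]
    exact hφc k _ (hφ.monotone (Nat.le_succ k))

/-- A family of elements of `L1P` whose `W₁`-distances are bounded for almost every time, with an
exceptional set depending on the two parameters, has a modification for which the bound holds for
all times. -/
theorem L1P.exists_modification [TopologicalSpace Y] [FirstCountableTopology Y]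
    [TopologicalSpace.SeparableSpace Y] [Nonempty Y] {c : Y → Y → ℝ≥0∞}
    (hc : Continuous (Function.uncurry c)) (hc0 : ∀ y, c y y = 0) (ν : Y → L1P T X)
    (h : ∀ y y', ∀ᵐ s ∂(lebT T), W₁ ((ν y).meas s) ((ν y').meas s) ≤ c y y') :
    ∃ ν' : Y → L1P T X, (∀ y, ∀ᵐ s ∂(lebT T), (ν' y).meas s = (ν y).meas s) ∧
      ∀ y y' s, W₁ ((ν' y).meas s) ((ν' y').meas s) ≤ c y y' := by
  set e := TopologicalSpace.denseSeq Y
  -- Only countably many pairs are used, so the good times have full measure, independently of `y`.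
  set 𝒢 : Set (Time T) :=
    ⋂ (i : ℕ) (j : ℕ), {s | W₁ ((ν (e i)).meas s) ((ν (e j)).meas s) ≤ c (e i) (e j)} with h𝒢def
  have h𝒢 : MeasurableSet 𝒢 := MeasurableSet.iInter fun i => MeasurableSet.iInter fun j =>
    measurableSet_le ((ν (e i)).measurable_W₁ _) measurable_const
  have h𝒢le : ∀ s ∈ 𝒢, ∀ i j, W₁ ((ν (e i)).meas s) ((ν (e j)).meas s) ≤ c (e i) (e j) :=
    fun s hs i j => mem_iInter.1 (mem_iInter.1 hs i) j
  have h𝒢ae : ∀ᵐ s ∂(lebT T), s ∈ 𝒢 := by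
    have : ∀ᵐ s ∂(lebT T), ∀ i j, W₁ ((ν (e i)).meas s) ((ν (e j)).meas s) ≤ c (e i) (e j) :=
      ae_all_iff.2 fun i => ae_all_iff.2 fun j => h (e i) (e j)
    filter_upwards [this] with s hs
    exact mem_iInter.2 fun i => mem_iInter.2 fun j => hs i j
  have hgeo : ∑' k : ℕ, (2⁻¹ : ℝ≥0∞) ^ k ≠ ∞ := by
    rw [ENNReal.tsum_geometric]
    simp
  have key : ∀ y, ∃ (q : ℕ → ℕ) (ν' : L1P T X), Tendsto (fun k => e (q k)) atTop (𝓝 y) ∧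
      (∀ s ∈ 𝒢, Tendsto (fun k => W₁ ((ν (e (q k))).meas s) (ν'.meas s)) atTop (𝓝 0)) ∧
      ∀ s ∉ 𝒢, ν'.meas s = Measure.dirac 0 := by
    intro y
    obtain ⟨q, hqy, hqc⟩ := exists_denseSeq_tendsto_summable hc hc0 y
    have hs𝒢 : ∀ s ∈ 𝒢, ∑' k, W₁ ((ν (e (q k))).meas s) ((ν (e (q (k + 1)))).meas s) ≤
        ∑' k : ℕ, (2⁻¹ : ℝ≥0∞) ^ k :=
      fun s hs => ENNReal.tsum_le_tsum fun k => (h𝒢le s hs _ _).trans (hqc k)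
    -- At every good time the increments along the approximating sequence are summable, so the limit
    -- exists at each such time rather than almost everywhere.
    have hex : ∀ s, ∃ b : Measure X, s ∈ 𝒢 → IsProbabilityMeasure b ∧
        Tendsto (fun k => W₁ ((ν (e (q k))).meas s) b) atTop (𝓝 0) := by
      intro s
      by_cases hs : s ∈ 𝒢
      · obtain ⟨b, hb⟩ := exists_tendsto_W₁ (fun k => (ν (e (q k))).meas s)
          (ne_top_of_le_ne_top hgeo (hs𝒢 s hs))
        exact ⟨b, fun _ => hb⟩
      · exact ⟨0, fun h => absurd h hs⟩
    choose b hb using hex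
    obtain ⟨ν', hν', hν'0⟩ := L1P.exists_of_tendsto (fun k => ν (e (q k))) h𝒢 b
      (fun s hs => (hb s hs).1) (fun s hs => (hb s hs).2) (by
        refine ne_top_of_le_ne_top (b := (∑' k : ℕ, (2⁻¹ : ℝ≥0∞) ^ k) * lebT T 𝒢)
          (ENNReal.mul_ne_top hgeo (measure_ne_top _ _)) ?_
        rw [← setLIntegral_const]
        refine setLIntegral_mono' h𝒢 fun s hs => ?_
        have := (hb s hs).1
        rw [W₁_comm]
        refine (W₁_le_tsum_of_tendsto (μ := fun k => (ν (e (q k))).meas s) (hb s hs).2 0).trans ?_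
        simpa using hs𝒢 s hs)
    refine ⟨q, ν', hqy, fun s hs => ?_, hν'0⟩
    rw [hν' s hs]
    exact (hb s hs).2
  choose q ν' hq hν' hν'0 using key
  refine ⟨ν', fun y => ?_, fun y y' s => ?_⟩
  -- For a single `y`, a further null set may be discarded; both versions are then limits of the
  -- same sequence, and `W₁` separates measures.
  · have hy : ∀ᵐ s ∂(lebT T), ∀ k, W₁ ((ν (e (q y k))).meas s) ((ν y).meas s) ≤ c (e (q y k)) y :=
      ae_all_iff.2 fun k => h _ _
    filter_upwards [h𝒢ae, hy] with s hs hsy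
    refine eq_of_W₁_eq_zero (le_antisymm ?_ bot_le)
    have hlim : Tendsto (fun k => W₁ ((ν (e (q y k))).meas s) ((ν' y).meas s) + c (e (q y k)) y)
        atTop (𝓝 0) := by
      have h1 : Tendsto (fun k => c (e (q y k)) y) atTop (𝓝 (c y y)) :=
        (hc.tendsto (y, y)).comp ((hq y).prodMk_nhds tendsto_const_nhds)
      rw [hc0] at h1
      simpa using (hν' y s hs).add h1
    refine ge_of_tendsto' hlim fun k => (W₁_triangle _ ((ν (e (q y k))).meas s) _).trans ?_
    rw [W₁_comm]
    exact add_le_add le_rfl (hsy k)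
  · by_cases hs : s ∈ 𝒢
    · have hlim : Tendsto (fun k => W₁ ((ν (e (q y k))).meas s) ((ν' y).meas s) +
          (c (e (q y k)) (e (q y' k)) + W₁ ((ν (e (q y' k))).meas s) ((ν' y').meas s)))
          atTop (𝓝 (c y y')) := by
        have h1 : Tendsto (fun k => c (e (q y k)) (e (q y' k))) atTop (𝓝 (c y y')) :=
          (hc.tendsto (y, y')).comp ((hq y).prodMk_nhds (hq y'))
        simpa using (hν' y s hs).add (h1.add (hν' y' s hs))
      refine ge_of_tendsto' hlim fun k => (W₁_triangle _ ((ν (e (q y k))).meas s) _).trans ?_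
      rw [W₁_comm]
      refine add_le_add le_rfl ((W₁_triangle _ ((ν (e (q y' k))).meas s) _).trans ?_)
      exact add_le_add (h𝒢le s hs _ _) le_rfl
    -- At bad times all members of the family are the same Dirac mass.
    · rw [hν'0 y s hs, hν'0 y' s hs, W₁_self]
      exact bot_le

end StableFamilies

/-! ### The filtering distributions in `L1P` and uniform convergence on compact sets. -/

section Compactness

variable {d N n : ℕ} {T : ℝ}

/-- The filtering distributions as elements of `L1P`. -/
theorem exists_L1P_filtering {ρ : EuclideanSpace ℝ (Fin d) → ℝ} {t : Fin (N + 1) → ℝ}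
    {G : Fin N → PathSpace T n → EuclideanSpace ℝ (Fin d)} {S : Time T → L2x n → L2x n}
    {prior : Measure (L2x n)} {M : ℝ} {y : Fin N → EuclideanSpace ℝ (Fin d)}
    (hS : Measurable fun p : Time T × L2x n => S p.1 p.2)
    (hM : ∀ᵐ u ∂prior, ∀ s, ‖S s u‖ ≤ M)
    (hp : ∀ s, IsProbabilityMeasure (posterior ρ t G S prior y s))
    (hac : ∀ s, posterior ρ t G S prior y s ≪ prior)
    (hm : Measurable fun s => filtering ρ t G S prior y s) :
    ∃ ν : L1P T (L2x n), ∀ s, ν.meas s = filtering ρ t G S prior y s := by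
  have hSs : ∀ s, Measurable (S s) := fun s => hS.comp measurable_prodMk_left
  have hmom : ∀ s, ∫⁻ u, ‖u‖ₑ ∂(filtering ρ t G S prior y s) ≤ ENNReal.ofReal M := by
    intro s
    have := hp s
    rw [filtering, lintegral_map (by fun_prop) (hSs s)]
    calc ∫⁻ u, ‖S s u‖ₑ ∂(posterior ρ t G S prior y s)
        ≤ ∫⁻ _u, ENNReal.ofReal M ∂(posterior ρ t G S prior y s) := by
          refine lintegral_mono_ae ?_
          filter_upwards [(hac s).ae_le hM] with u hu
          rw [← ofReal_norm]
          exact ENNReal.ofReal_le_ofReal (hu s)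
      _ = ENNReal.ofReal M := by simp
  refine ⟨L1P.ofMeasurable _ (fun s => ?_) hm (fun s => (hmom s).trans_lt ENNReal.ofReal_lt_top)
    ?_, fun s => rfl⟩
  · have := hp s
    exact Measure.isProbabilityMeasure_map (hSs s).aemeasurable
  · refine (lintegral_mono hmom).trans_lt ?_
    rw [lintegral_const]
    exact ENNReal.mul_lt_top ENNReal.ofReal_lt_top (measure_lt_top _ _)

theorem posterior_congr_time {ρ : EuclideanSpace ℝ (Fin d) → ℝ} {t : Fin (N + 1) → ℝ}
    {G : Fin N → PathSpace T n → EuclideanSpace ℝ (Fin d)} {S : Time T → L2x n → L2x n}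
    {prior : Measure (L2x n)} {y : Fin N → EuclideanSpace ℝ (Fin d)} {s s' : Time T}
    (h : ∀ j, t j ≤ s ↔ t j ≤ s') :
    posterior ρ t G S prior y s = posterior ρ t G S prior y s' := by
  have : likelihood ρ t G S y s = likelihood ρ t G S y s' := by
    ext u
    simp only [likelihood, h]
  simp only [posterior, this]

theorem tendsto_iSup_edist {ι Y Z : Type*} [TopologicalSpace Y] [PseudoEMetricSpace Z]
    {l : Filter ι} {F : ι → C(Y, Z)} {f : C(Y, Z)} (h : Tendsto F l (𝓝 f)) {K : Set Y}
    (hK : IsCompact K) : Tendsto (fun i => ⨆ y ∈ K, edist (F i y) (f y)) l (𝓝 0) := by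
  have h1 := ContinuousMap.tendsto_iff_forall_isCompact_tendstoUniformlyOn.1 h K hK
  refine ENNReal.tendsto_nhds_zero.2 fun ε hε => ?_
  filter_upwards [EMetric.tendstoUniformlyOn_iff.1 h1 ε hε] with i hi
  refine iSup₂_le fun y hy => ?_
  rw [edist_comm]
  exact (hi y hy).le

end Compactness

end FilteringNS
end

/-! ### Assembly of the main theorem. -/

theorem mainTheorem3 {d N : ℕ} (Γ : Matrix (Fin d) (Fin d) ℝ) (hΓ : Γ.PosDef)
    (ρ : EuclideanSpace ℝ (Fin d) → ℝ) (hρ : IsNoiseDensity Γ ρ)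
    (T : ℝ) (hT : 0 < T) (L_G g₀ : ℝ) :
    ∃ C : ℝ → ℝ → ℝ, (∀ R M, 0 < C R M) ∧
      ∀ (n : ℕ) (t : Fin (N + 1) → ℝ), StrictMono t → t 0 = 0 → t (Fin.last N) = T →
      ∀ G : Fin N → PathSpace T n → EuclideanSpace ℝ (Fin d),
        LipschitzObservables t G L_G → (∀ j, ‖G j 0‖ ≤ g₀) →
      ∀ (prior : Measure (L2x n)) [IsProbabilityMeasure prior] (M : ℝ), 0 < M →
        prior {u | ‖u‖ ≤ M} = 1 → (∀ᵐ u ∂prior, DivFree u) →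
      ∀ visc : ℝ, 0 < visc →
      ∀ S : Set.Ioi (0 : ℝ) → Time T → L2x n → L2x n, ApproxSolutionOperators visc S →
      (∃ F : Set.Ioi (0 : ℝ) → C(Fin N → EuclideanSpace ℝ (Fin d), L1P T (L2x n)),
        (∀ Δ y s, (F Δ y).meas s = filtering ρ t G (S Δ) prior y s) ∧
        IsCompact (closure (Set.range F))) ∧
      (∀ R, 0 < R → ∀ Δ y y', gammaNormN Γ y ≤ R → gammaNormN Γ y' ≤ R → ∀ s,
        W₁ (filtering ρ t G (S Δ) prior y s) (filtering ρ t G (S Δ) prior y' s) ≤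
          ENNReal.ofReal (C R M * gammaNormN Γ (y - y'))) ∧
      (∀ Δ : ℕ → Set.Ioi (0 : ℝ), Tendsto (fun k => (Δ k : ℝ)) atTop (𝓝 0) →
        ∃ φ : ℕ → ℕ, StrictMono φ ∧
        ∃ νlim : C(Fin N → EuclideanSpace ℝ (Fin d), L1P T (L2x n)), ∀ R, 0 < R →
          Tendsto (fun k => ⨆ (y) (_ : gammaNormN Γ y ≤ R),
            ∫⁻ s, W₁ (filtering ρ t G (S (Δ (φ k))) prior y s) ((νlim y).meas s) ∂(lebT T))
            atTop (𝓝 0)) ∧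
      (∀ Δ : ℕ → Set.Ioi (0 : ℝ), Tendsto (fun k => (Δ k : ℝ)) atTop (𝓝 0) →
        ∀ νlim : (Fin N → EuclideanSpace ℝ (Fin d)) → L1P T (L2x n),
        (∀ R, 0 < R →
          Tendsto (fun k => ⨆ (y) (_ : gammaNormN Γ y ≤ R),
            ∫⁻ s, W₁ (filtering ρ t G (S (Δ k)) prior y s) ((νlim y).meas s) ∂(lebT T))
            atTop (𝓝 0)) →
        ∃ νver : (Fin N → EuclideanSpace ℝ (Fin d)) → L1P T (L2x n),
          (∀ y, ∀ᵐ s ∂(lebT T), (νver y).meas s = (νlim y).meas s) ∧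
          ∀ R, 0 < R → ∀ y y', gammaNormN Γ y ≤ R → gammaNormN Γ y' ≤ R → ∀ s,
            W₁ ((νver y).meas s) ((νver y').meas s) ≤
              ENNReal.ofReal (C R M * gammaNormN Γ (y - y'))) := by
  obtain ⟨C, D, hC0, hCc, hCm, hB⟩ := exists_filtering_bounds hΓ hρ hT N L_G g₀
  refine ⟨C, hC0, ?_⟩
  intro n t ht ht0 htT G hG hg prior _ M hM0 hM hdiv visc hvisc S hS
  have hMae : ∀ᵐ u ∂prior, ‖u‖ ≤ M :=
    (mem_ae_iff_prob_eq_one (measurableSet_le measurable_norm measurable_const)).2 hM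
  have hMS : ∀ Δ, ∀ᵐ u ∂prior, ∀ s, ‖S Δ s u‖ ≤ M := fun Δ => by
    filter_upwards [hMae, hdiv] with u hu hu' s
    exact (hS.energy Δ s u hu').trans hu
  have hb := fun Δ => hB n t G hG hg prior M (S Δ) (hS.measurable Δ) (hMS Δ)
  -- Using the larger of the two norms as radius turns the estimates for all `R` into one continuous
  -- gauge; monotonicity of `C` recovers each of them with the same constant.
  set c : (Fin N → EuclideanSpace ℝ (Fin d)) → (Fin N → EuclideanSpace ℝ (Fin d)) → ℝ≥0∞ :=
    fun y y' => ENNReal.ofReal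
      (C (max (gammaNormN Γ y) (gammaNormN Γ y')) M * gammaNormN Γ (y - y')) with hcdef
  have hγ : Continuous (gammaNormN Γ : (Fin N → EuclideanSpace ℝ (Fin d)) → ℝ) :=
    continuous_gammaNormN hΓ
  have hc : Continuous (Function.uncurry c) := by
    refine ENNReal.continuous_ofReal.comp (Continuous.mul ((hCc M).comp ?_) ?_)
    · exact (hγ.comp continuous_fst).max (hγ.comp continuous_snd)
    · exact hγ.comp (continuous_fst.sub continuous_snd)
  have hc0 : ∀ y, c y y = 0 := fun y => by simp [hcdef, gammaNormN, gammaNorm]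
  have hcle : ∀ R y y', gammaNormN Γ y ≤ R → gammaNormN Γ y' ≤ R →
      c y y' ≤ ENNReal.ofReal (C R M * gammaNormN Γ (y - y')) := by
    intro R y y' hy hy'
    refine ENNReal.ofReal_le_ofReal (mul_le_mul_of_nonneg_right ?_ (gammaNormN_nonneg Γ _))
    have h0 : 0 ≤ max (gammaNormN Γ y) (gammaNormN Γ y') :=
      (gammaNormN_nonneg Γ y).trans (le_max_left _ _)
    exact hCm M h0 (h0.trans (max_le hy hy')) (max_le hy hy')
  have hst : ∀ Δ y y' s, W₁ (filtering ρ t G (S Δ) prior y s) (filtering ρ t G (S Δ) prior y' s) ≤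
      c y y' := fun Δ y y' s => (hb Δ).2.2.2 _ y y' s (le_max_left _ _) (le_max_right _ _)
  have hac : ∀ Δ y s, posterior ρ t G (S Δ) prior y s ≪ prior := fun Δ y s =>
    (Measure.absolutelyContinuous_of_le ((hb Δ).2.1 _ y s le_rfl)).trans
      Measure.smul_absolutelyContinuous
  choose F₀ hF₀ using fun Δ y => exists_L1P_filtering (hS.measurable Δ) (hMS Δ)
    ((hb Δ).1 y) (hac Δ y) ((hb Δ).2.2.1 y)
  have hF₀st : ∀ Δ y y' s, W₁ ((F₀ Δ y).meas s) ((F₀ Δ y').meas s) ≤ c y y' :=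
    fun Δ y y' s => by
      rw [hF₀, hF₀]
      exact hst Δ y y' s
  have heq : Equicontinuous F₀ := L1P.equicontinuous_of_W₁_le hc hc0 F₀ hF₀st
  set F : Set.Ioi (0 : ℝ) → C(Fin N → EuclideanSpace ℝ (Fin d), L1P T (L2x n)) :=
    fun Δ => ⟨F₀ Δ, heq.continuous Δ⟩ with hF
  -- For fixed data the filtering distributions are push-forwards of posteriors dominated by the
  -- prior and constant between observation times, so the finite net applies uniformly in `Δ`.
  have htb : ∀ y, TotallyBounded (range fun Δ => F Δ y) := by
    intro y
    refine EMetric.totallyBounded_iff.2 fun ε hε => ?_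
    obtain ⟨δ, hδ0, hδ⟩ := ENNReal.lt_iff_exists_real_btwn.1 hε
    have hδpos : 0 < δ := ENNReal.ofReal_pos.1 hδ.1
    obtain ⟨Q, hQ, hQc⟩ := exists_finite_pushforward_net hT.le hvisc hS prior hdiv hMae
      (fun j => ht0 ▸ ht.monotone (Fin.zero_le j)) (fun Δ s => posterior ρ t G (S Δ) prior y s)
      (fun Δ s => (hb Δ).1 y s) (D (gammaNormN Γ y) M) (fun Δ s => (hb Δ).2.1 _ y s le_rfl)
      (fun Δ s s' h => posterior_congr_time h) hδpos
    refine ⟨Q, hQ, ?_⟩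
    rintro _ ⟨Δ, rfl⟩
    obtain ⟨q, hq, hΔq⟩ := hQc Δ
    refine mem_iUnion₂.2 ⟨q, hq, lt_of_le_of_lt ?_ hδ.2⟩
    rw [L1P.edist_def]
    simpa only [hF, ContinuousMap.coe_mk, hF₀, filtering] using hΔq
  have hcomp : IsCompact (closure (range F)) := isCompact_closure_range_of_equicontinuous F heq htb
  refine ⟨⟨F, hF₀, hcomp⟩, fun R _ Δ y y' hy hy' s => (hst Δ y y' s).trans (hcle R y y' hy hy'),
    fun Δ _ => ?_, fun Δ _ νlim hlim => ?_⟩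
  · obtain ⟨νlim, -, φ, hφ, hlim⟩ :=
      hcomp.tendsto_subseq fun k => subset_closure (mem_range_self (Δ k))
    refine ⟨φ, hφ, νlim, fun R _ => ?_⟩
    have := tendsto_iSup_edist hlim (isCompact_gammaNormN_le (N := N) hΓ R)
    simpa only [L1P.edist_def, Function.comp_apply, hF, ContinuousMap.coe_mk, hF₀,
      mem_ofPred_eq] using this
  · have htend : ∀ y, Tendsto (fun k => F₀ (Δ k) y) atTop (𝓝 (νlim y)) := by
      intro y
      -- The added one gives a positive radius also for `y = 0`.
      have hR : gammaNormN Γ y ≤ gammaNormN Γ y + 1 := by linarith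
      refine tendsto_iff_edist_tendsto_0.2 (tendsto_of_tendsto_of_tendsto_of_le_of_le
        tendsto_const_nhds (hlim (gammaNormN Γ y + 1) (by linarith [gammaNormN_nonneg Γ y]))
        (fun _ => zero_le) fun k => ?_)
      simp only [L1P.edist_def, hF₀]
      exact le_iSup₂ (f := fun y (_ : gammaNormN Γ y ≤ _) => ∫⁻ s,
        W₁ (filtering ρ t G (S (Δ k)) prior y s) ((νlim y).meas s) ∂(lebT T)) y hR
    obtain ⟨νver, hver, hvst⟩ := L1P.exists_modification hc hc0 νlim fun y y' =>
      L1P.ae_W₁_le_of_tendsto (htend y) (htend y') fun k s => hF₀st (Δ k) y y' s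
    exact ⟨νver, hver, fun R _ y y' hy hy' s => (hvst y y' s).trans (hcle R y y' hy hy')⟩
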